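/- Setting. Let $\mu$ be a probability measure on $[0,1]$ with a strictly positive $C^1$ density on $[0,1]$ with respect to Lebesgue measure, and let $H:\mathbb R\to\mathbb R$ be strictly convex and $C^2$, with $H'$ Lipschitz and $\varepsilon<H'(x)<K$ for all $x$, for some constants $0<\varepsilon<K$. For $n\ge 1$ the game $G_n(\mu)$ is played as follows. Nature draws $L\sim\mu$; player 1 observes $L$, player 2 does not. At each stage $q=1,\dots,n$ player 1 chooses $u_q\in\{-1,+1\}$ and, simultaneously, player 2 chooses $p_q\in\mathbb R$; both actions are then publicly revealed. A behavioral strategy $\sigma$ of player 1 gives, for each $q$, a (measurable) probability on $\{-1,+1\}$ depending on $(u_1,p_1,\dots,u_{q-1},p_{q-1})$ and $L$; a behavioral strategy $\tau$ of player 2 gives, for each $q$, a (measurable) Borel probability on $\mathbb R$ depending on $(u_1,p_1,\dots,u_{q-1},p_{q-1})$. With $Z:=\frac1{\sqrt n}\sum_{q=1}^n u_q(L-p_q)$, player 1 maximizes $g_1(\sigma,\tau)=E_{\mu,\sigma,\tau}[Z]$ and player 2 minimizes $g_2(\sigma,\tau)=E_{\mu,\sigma,\tau}[H(Z)]$. A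 Nash equilibrium is a pair $(\sigma,\tau)$ with finite payoffs such that no unilateral deviation for which the deviating player's expected payoff exists in $[-\infty,+\infty]$ is profitable. The reduced game $\overline G_n(\mu)$ is the same game in which player 1 may only use strategies that do not depend on the past actions of player 2, and player 2 may only use pure strategies, i.e. $p_q$ is a deterministic function of $(u_1,\dots,u_{q-1})$. For probability measures with finite second moment, $W_2$ is the Wasserstein distance of order 2; $\Delta_f(\mathbb R)$ is the set of probability measures on $\mathbb R$ with finite support. Let $F_\mu,F_\nu$ be distribution functions, with right inverses $F^{-1}(y)=\inf\{x: F(x)>y\}$, where $F_\mu^{-1}$ is understood as $[0,1]$-valued, $F_\mu^{-1}(1)=1$. For probability measures $\lambda,\nu$ on $\mathbb R$ with finite second moment put $\phi_\nu=F_\nu^{-1}\circ F_\mu$, $\gamma_\nu=F_\mu^{-1}\circ F_\nu$, $\Gamma_\nu(s)=\int_0^s\gamma_\nu(t)\,dt$, $\Psi_{\nu,\lambda}=\Gamma_\nu-\int\Gamma_\nu\,d\lambda$, let $\overline\Pi_\nu$ be the law of $(L,S)=(L,\phi_\nu(L))$ for $L\sim\mu$, let $Y_{\nu,\lambda}(S)=E_{\overline\Pi_\nu}[H'(LS-\Psi_{\nu,\lambda}(S))\mid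 S]$, and let $T_\lambda(\nu)$ be the probability measure with density $Y_{\nu,\lambda}/E_\nu[Y_{\nu,\lambda}]$ with respect to $\nu$. Let $\overline\lambda_n$ be the law of $\frac1{\sqrt n}\sum_{q=1}^n u_q$ when $(u_1,\dots,u_n)$ is uniform on $\{-1,+1\}^n$. Theorem. (1) Every map $T:\Delta_f(\mathbb R)\to\Delta_f(\mathbb R)$ that is continuous for $W_2$ and satisfies $T(\nu)\ll\nu$ for all $\nu$ is onto. (2) If $\lambda_k,\nu_k,\lambda,\nu$ are probability measures on $\mathbb R$ with finite second moment and $W_2(\lambda_k,\lambda)\to0$, $W_2(\nu_k,\nu)\to0$, then all $T_{\lambda_k}(\nu_k)$ and $T_\lambda(\nu)$ are probability measures with finite second moment and $W_2(T_{\lambda_k}(\nu_k),T_\lambda(\nu))\to0$. (3) For every $n\ge1$, $T_{\overline\lambda_n}$ restricts to a $W_2$-continuous map from $\Delta_f(\mathbb R)$ onto $\Delta_f(\mathbb R)$ with $T_{\overline\lambda_n}(\nu)\ll\nu$ for all $\nu$. (4) For every $n\ge1$, every Nash equilibrium of $\overline G_n(\mu)$ is a Nash equilibrium of $G_n(\mu)$.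 (5) For every $n\ge1$ there is a Nash equilibrium of $\overline G_n(\mu)$, and hence there is one of $G_n(\mu)$. -/

import Mathlib

open MeasureTheory ProbabilityTheory Filter Topology Set
open scoped ENNReal NNReal

noncomputable section

namespace InsiderGame

/-! ### Assumptions on the law of the asset and on the risk-aversion function -/

/-- `μ` is carried by `[0,1]`, with a strictly positive `C¹` density on `[0,1]`. -/
def HasPositiveC1Density (μ : Measure ℝ) : Prop :=
  ∃ f : ℝ → ℝ, ContDiffOn ℝ 1 f (Icc 0 1) ∧ (∀ x ∈ Icc (0 : ℝ) 1, 0 < f x) ∧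
    μ = (volume.restrict (Icc (0 : ℝ) 1)).withDensity (fun x => ENNReal.ofReal (f x))

/-- Strictly convex `C²` functions whose derivative is Lipschitz and takes its values in some
interval `(ε, K)` with `ε > 0`. -/
structure IsRiskAversion (H : ℝ → ℝ) : Prop where
  contDiff : ContDiff ℝ 2 H
  strictConvex : StrictConvexOn ℝ univ H
  lipschitz_deriv : ∃ C : ℝ≥0, LipschitzWith C (deriv H)
  deriv_bounds : ∃ ε K : ℝ, 0 < ε ∧ ∀ x, ε < deriv H x ∧ deriv H x < K

/-! ### The repeated game -/

/-- The numerical value of an action of player 1: `true` is "buy", `false` is "sell". -/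
def sgn (u : Bool) : ℝ := if u then 1 else -1

/-- Histories `(u₁, p₁, …, u_q, p_q)` of length `q`. -/
abbrev Hist (q : ℕ) : Type := Fin q → Bool × ℝ

/-- The actions of player 1 along a history. -/
def Hist.moves {q : ℕ} (h : Hist q) : Fin q → Bool := fun i => (h i).1

theorem Hist.measurable_moves (q : ℕ) : Measurable (Hist.moves (q := q)) :=
  measurable_pi_lambda _ fun i => (measurable_pi_apply i).fst

/-- Behavioral strategies of player 1 in the `n`-stage game: the lottery at stage `q + 1` depends
on the history of length `q` and on `L`. -/
structure Strategy1 (n : ℕ) where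
  kernel : ∀ q : ℕ, q < n → Kernel (Hist q × ℝ) Bool
  markov : ∀ q hq, IsMarkovKernel (kernel q hq)

/-- Behavioral strategies of player 2 in the `n`-stage game. -/
structure Strategy2 (n : ℕ) where
  kernel : ∀ q : ℕ, q < n → Kernel (Hist q) ℝ
  markov : ∀ q hq, IsMarkovKernel (kernel q hq)

attribute [instance] Strategy1.markov Strategy2.markov

/-- The joint law of `(h_q, L)` induced by `(μ, σ, τ)`. Given `(h_q, L)` the two players draw
`u_{q+1}` and `p_{q+1}` simultaneously, hence independently. -/
def law (μ : Measure ℝ) {n : ℕ} (σ : Strategy1 n) (τ : Strategy2 n) :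
    (q : ℕ) → q ≤ n → Measure (Hist q × ℝ)
  | 0, _ => μ.map (fun l => (Fin.elim0, l))
  | q + 1, hq =>
      ((law μ σ τ q (Nat.le_of_succ_le hq)) ⊗ₘ
        ((σ.kernel q hq) ×ₖ ((τ.kernel q hq).comap Prod.fst measurable_fst))).map
        (fun z : (Hist q × ℝ) × (Bool × ℝ) => ((Fin.snoc z.1.1 z.2 : Hist (q + 1)), z.1.2))

/-- The law of `(h_n, L)`. -/
def outcome (μ : Measure ℝ) {n : ℕ} (σ : Strategy1 n) (τ : Strategy2 n) :
    Measure (Hist n × ℝ) := law μ σ τ n le_rfl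

/-- The normalized final gain `n^{-1/2} ∑_q u_q (L - p_q)` of player 1. -/
def gain (n : ℕ) (z : Hist n × ℝ) : ℝ :=
  (1 / √(n : ℝ)) * ∑ q, sgn (z.1 q).1 * (z.2 - (z.1 q).2)

/-- The expectation of `f` exists in `[-∞, +∞]`. -/
def ExpectationExists {Ω : Type} [MeasurableSpace Ω] (P : Measure Ω) (f : Ω → ℝ) : Prop :=
  ∫⁻ x, ENNReal.ofReal (f x) ∂P ≠ ⊤ ∨ ∫⁻ x, ENNReal.ofReal (-f x) ∂P ≠ ⊤

/-- The expectation of `f` in `[-∞, +∞]`, meaningful when `ExpectationExists P f`. -/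
def expectation {Ω : Type} [MeasurableSpace Ω] (P : Measure Ω) (f : Ω → ℝ) : EReal :=
  ((∫⁻ x, ENNReal.ofReal (f x) ∂P : ℝ≥0∞) : EReal) -
    ((∫⁻ x, ENNReal.ofReal (-f x) ∂P : ℝ≥0∞) : EReal)

/-- The payoff that player 1 maximizes. -/
def payoff1 (μ : Measure ℝ) {n : ℕ} (σ : Strategy1 n) (τ : Strategy2 n) : EReal :=
  expectation (outcome μ σ τ) (gain n)

/-- The payoff that player 2 minimizes. -/
def payoff2 (μ : Measure ℝ) (H : ℝ → ℝ) {n : ℕ} (σ : Strategy1 n) (τ : Strategy2 n) : EReal :=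
  expectation (outcome μ σ τ) (fun z => H (gain n z))

/-- Nash equilibria of the game in which player 1 is restricted to `A` and player 2 to `B`.
The equilibrium payoffs are finite, and every deviation whose payoff is defined, possibly infinite,
is unprofitable. -/
structure IsEquilibriumIn (μ : Measure ℝ) (H : ℝ → ℝ) {n : ℕ} (A : Set (Strategy1 n))
    (B : Set (Strategy2 n)) (σ : Strategy1 n) (τ : Strategy2 n) : Prop where
  mem1 : σ ∈ A
  mem2 : τ ∈ B
  integrable1 : Integrable (gain n) (outcome μ σ τ)
  integrable2 : Integrable (fun z => H (gain n z)) (outcome μ σ τ)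
  best1 : ∀ σ' ∈ A, ExpectationExists (outcome μ σ' τ) (gain n) →
    payoff1 μ σ' τ ≤ payoff1 μ σ τ
  best2 : ∀ τ' ∈ B, ExpectationExists (outcome μ σ τ') (fun z => H (gain n z)) →
    payoff2 μ H σ τ ≤ payoff2 μ H σ τ'

/-- A strategy of player 1 is reduced if it does not depend on the actions of player 2. -/
def Strategy1.IsReduced {n : ℕ} (σ : Strategy1 n) : Prop :=
  ∀ (q : ℕ) (hq : q < n), ∃ κ : Kernel ((Fin q → Bool) × ℝ) Bool,
    σ.kernel q hq = κ.comap (fun x : Hist q × ℝ => (x.1.moves, x.2))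
      (((Hist.measurable_moves q).comp measurable_fst).prodMk measurable_snd)

/-- A strategy of player 2 is pure if each price is a deterministic function of the past actions
of player 1. -/
def Strategy2.IsPure {n : ℕ} (τ : Strategy2 n) : Prop :=
  ∀ (q : ℕ) (hq : q < n), ∃ p : (Fin q → Bool) → ℝ,
    τ.kernel q hq = Kernel.deterministic (fun h : Hist q => p h.moves)
      ((measurable_of_finite p).comp (Hist.measurable_moves q))

/-- Nash equilibria of the game `G_n(μ)`. -/
def IsEquilibrium (μ : Measure ℝ) (H : ℝ → ℝ) {n : ℕ} (σ : Strategy1 n) (τ : Strategy2 n) : Prop :=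
  IsEquilibriumIn μ H univ univ σ τ

/-- Nash equilibria of the reduced game: player 1 does not observe the actions of player 2, and
player 2 does not randomize. -/
def IsReducedEquilibrium (μ : Measure ℝ) (H : ℝ → ℝ) {n : ℕ} (σ : Strategy1 n)
    (τ : Strategy2 n) : Prop :=
  IsEquilibriumIn μ H {σ | σ.IsReduced} {τ | τ.IsPure} σ τ

/-! ### The Wasserstein distance -/

/-- Probability measures on `ℝ` with a finite second moment. -/
def InP2 (ν : Measure ℝ) : Prop :=
  IsProbabilityMeasure ν ∧ ∫⁻ x, ‖x‖ₑ ^ 2 ∂ν < ⊤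

/-- The Wasserstein distance of order 2, as an infimum over couplings. -/
def W2 (ν₁ ν₂ : Measure ℝ) : ℝ≥0∞ :=
  (⨅ (π : Measure (ℝ × ℝ)) (_ : π.map Prod.fst = ν₁ ∧ π.map Prod.snd = ν₂),
    ∫⁻ z, edist z.1 z.2 ^ 2 ∂π) ^ (1 / 2 : ℝ)

/-- `Δ_f(ℝ)`: probability measures on `ℝ` with finite support. -/
def FinSupp : Type :=
  {ν : Measure ℝ // IsProbabilityMeasure ν ∧ ∃ s : Finset ℝ, ν (s : Set ℝ)ᶜ = 0}

/-- Continuity of a self-map of `Δ_f(ℝ)` for the metric `W2`. -/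
def W2Continuous (T : FinSupp → FinSupp) : Prop :=
  ∀ ν : FinSupp, ∀ ε : ℝ≥0∞, 0 < ε → ∃ δ : ℝ≥0∞, 0 < δ ∧
    ∀ ν' : FinSupp, W2 ν'.1 ν.1 < δ → W2 (T ν').1 (T ν).1 < ε

/-! ### The operator `T_lam` -/

/-- `φ_ν = F_ν⁻¹ ∘ F_μ` with the right inverse `F_ν⁻¹(y) = inf {x | F_ν(x) > y}`. -/
def phi (μ ν : Measure ℝ) (l : ℝ) : ℝ := sInf {x | cdf μ l < cdf ν x}

/-- `γ_ν = F_μ⁻¹ ∘ F_ν`. As `μ` lives on `[0,1]`, the right inverse `F_μ⁻¹` takes values in `[0,1]`,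
with `F_μ⁻¹(1) = 1`; this is the role of the point `1`, which is redundant below `F_ν(s) = 1`. -/
def gam (μ ν : Measure ℝ) (s : ℝ) : ℝ := sInf (insert 1 {x | cdf ν s < cdf μ x})

/-- `Γ_ν(s) = ∫₀ˢ γ_ν`. -/
def Gam (μ ν : Measure ℝ) (s : ℝ) : ℝ := ∫ t in (0 : ℝ)..s, gam μ ν t

/-- The law of `(L, φ_ν(L))` when `L` has law `μ`. -/
def joint (μ ν : Measure ℝ) : Measure (ℝ × ℝ) := μ.map (fun l => (l, phi μ ν l))

instance (μ ν : Measure ℝ) [IsFiniteMeasure μ] : IsFiniteMeasure (joint μ ν) := by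
  unfold joint; infer_instance

/-- `Ψ_{ν,lam} = Γ_ν - E_lam[Γ_ν]`. -/
def Psi (μ lam ν : Measure ℝ) (s : ℝ) : ℝ := Gam μ ν s - ∫ t, Gam μ ν t ∂lam

/-- `Y_{ν,lam}(s) = E[H'(L S - Ψ_{ν,lam}(S)) | S = s]`, where `(L, S)` has law `joint μ ν`. -/
def Y (μ : Measure ℝ) [IsFiniteMeasure μ] (H : ℝ → ℝ) (lam ν : Measure ℝ) (s : ℝ) : ℝ :=
  ∫ l, deriv H (l * s - Psi μ lam ν s) ∂(condDistrib Prod.fst Prod.snd (joint μ ν) s)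

/-- `T_lam(ν) = α Y_{ν,lam} ν`, where `α = 1 / E_ν[Y_{ν,lam}]` is the normalizing constant. -/
def opT (μ : Measure ℝ) [IsFiniteMeasure μ] (H : ℝ → ℝ) (lam ν : Measure ℝ) : Measure ℝ :=
  ν.withDensity (fun s => ENNReal.ofReal ((∫ t, Y μ H lam ν t ∂ν)⁻¹ * Y μ H lam ν s))

/-- The law of `S_n = n^{-1/2} ∑_q u_q` under the uniform probability on `{-1,+1}ⁿ`. -/
def lamBar (n : ℕ) : Measure ℝ :=
  (PMF.uniformOfFintype (Fin n → Bool)).toMeasure.map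
    (fun ω => (1 / √(n : ℝ)) * ∑ q, sgn (ω q))

end InsiderGame

end

open InsiderGame

/-! Against a pure strategy, player 2's prices enter the payoffs only through the total payment
attached to each complete action sequence `u`, and after normalization these payments can be any
function of zero sum on the cube (`sum_normTransfer`, `exists_normTransfer_eq`). Player 1 enters
only through the joint law of `L` and `u`, and every measurable conditional law of `u` given `L` is
available to him (`exists_isReduced_weight_eq`). The reduced game is thus a one-shot game. Given
`l`, player 1 maximizes `l * score u - V u`. Player 2 minimizes a convex functional of `V` on a
hyperplane, so it suffices that the integral of `H'(L * score u - V u)` over the event `u` be the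
same for every `u`.

Seek `V u = Ψ(score u)`. Since `φ_ν(l)` maximizes `s ↦ l s - Γ_ν(s)`
(`IsFullOnUnit.mul_sub_Gam_le`), player 1 is optimal as soon as the score is `φ_ν(L)`. Let him
choose uniformly among the sequences with that score. Player 2's first-order condition then holds
if, after `μ` is reweighted by `H'`, the score has the law `lamBar n`, that is, if `T_{lamBar n}(ν)
= lamBar n`. Existence is therefore a question of surjectivity
(`exists_isReducedEquilibrium_of_opT_eq`).

Surjectivity is topological. On the measures carried by a fixed finite set, a continuous `T` with `T
ν ≪ ν` is a continuous self-map of a simplex that preserves every face, and such maps are onto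
(`exists_eq_of_face_preserving`). This follows from Brouwer's theorem, which is derived here from
Scarf's combinatorial lemma on a fine grid; Scarf's lemma itself is a parity count.

Continuity of the operator rests on `opT_eq_map`: `T_lam(ν)` is the image under `φ_ν` of `μ`
reweighted by a bounded density. All these laws live over the single space of `L`, so a coupling
bound (`cost_map_withDensity_le`) reduces the claim to convergence of `φ_ν` in mean square and of
the densities almost everywhere.

To pass from the reduced game to the full one, past prices are useless to player 1 against a pure
opponent (`exists_reduced_actionLaw_eq`). Against a player 1 who ignores prices, player 2 may
replace random prices by their means, by Jensen (`payoff2_meanPrice_le`). The delicate point is that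
these means exist. At a reduced equilibrium every action sequence has positive probability, and `H`
has slope at least `ε > 0`, so a deviation whose payoff is not `+∞` has integrable prices. -/

namespace InsiderGame

/-! ### Scarf's lemma and Brouwer's theorem on the simplex -/

section Scarf

variable {V I : Type*}

/-- `T` dominates `V` for the rankings `r i`: no element of `V` lies, for every ranking, strictly
above the minimum of `T`. -/
def Dominant (r : I → V → ℕ) (T : Finset V) : Prop :=
  ∀ z, ∃ i, ∀ y ∈ T, r i z ≤ r i y

theorem Dominant.mono {r : I → V → ℕ} {S T : Finset V} (h : Dominant r T) (hST : S ⊆ T) :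
    Dominant r S := fun z => (h z).imp fun _ hi y hy => hi y (hST hy)

variable [DecidableEq V] [DecidableEq I]

/-- A dominant set with one element less than there are rankings has a repeated minimum, and the
dominant sets that extend it by one point are governed by the two rankings involved. -/
theorem Dominant.exists_extension [Fintype I] {r : I → V → ℕ} (hr : ∀ i, Function.Injective (r i))
    {T : Finset V} (hT : Dominant r T) (hne : T.Nonempty) (hcard : T.card + 1 = Fintype.card I) :
    ∃ (m : I → V) (i j : I), i ≠ j ∧ m i = m j ∧ (∀ k, m k ∈ T) ∧
      (∀ k, ∀ y ∈ T, r k (m k) ≤ r k y) ∧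
      (∀ z, (∀ k, k ≠ i → r k (m k) < r k z) → (∀ k, k ≠ j → r k (m k) < r k z) → False) ∧
      (∀ z, z ∉ T ∧ Dominant r (insert z T) ↔
        ((∀ k, k ≠ i → r k (m k) < r k z) ∧
          ∀ w, (∀ k, k ≠ i → r k (m k) < r k w) → r i w ≤ r i z) ∨
        ((∀ k, k ≠ j → r k (m k) < r k z) ∧
          ∀ w, (∀ k, k ≠ j → r k (m k) < r k w) → r j w ≤ r j z)) := by
  have hex : ∀ k, ∃ v ∈ T, ∀ y ∈ T, r k v ≤ r k y := fun k => T.exists_min_image (r k) hne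
  choose m hmT hmle using hex
  have huniq : ∀ k y, y ∈ T → (∀ w ∈ T, r k y ≤ r k w) → m k = y := fun k y hy h =>
    hr k (le_antisymm (hmle k y hy) (h _ (hmT k)))
  -- Domination applied to `y` itself: some ranking puts `y` at the minimum of `T`.
  have hsurj : ∀ y ∈ T, ∃ k, m k = y := fun y hy =>
    (hT y).imp fun k hk => huniq k y hy hk
  have hninj : ∃ i ∈ (Finset.univ : Finset I), ∃ j ∈ (Finset.univ : Finset I), i ≠ j ∧ m i = m j :=
    Finset.exists_ne_map_eq_of_card_lt_of_maps_to (t := T)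
      (by rw [Finset.card_univ]; omega) (fun k _ => hmT k)
  obtain ⟨i, -, j, -, hij, hmij⟩ := hninj
  -- Without the index `a`, whose minimum is repeated at `b`, `m` is still onto `T`, and there are
  -- exactly `T.card` indices left. Hence `{i, j}` is the only coincidence of `m`.
  have hinj : ∀ a b, a ≠ b → m a = m b → ∀ k l, k ≠ a → l ≠ a → m k = m l → k = l := by
    intro a b hab hmab k l hk hl hkl
    have him : (Finset.univ.erase a).image m = T := by
      ext y
      simp only [Finset.mem_image, Finset.mem_erase, Finset.mem_univ, and_true]
      constructor
      · rintro ⟨k, -, rfl⟩; exact hmT k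
      · intro hy
        obtain ⟨k, rfl⟩ := hsurj y hy
        by_cases hka : k = a
        · exact ⟨b, hab.symm, by rw [hka, hmab]⟩
        · exact ⟨k, hka, rfl⟩
    have hc : ((Finset.univ.erase a).image m).card = (Finset.univ.erase a).card := by
      rw [him, Finset.card_erase_of_mem (Finset.mem_univ a), Finset.card_univ]; omega
    exact Finset.card_image_iff.mp hc (by simpa using hk) (by simpa using hl) hkl
  have hdisj : ∀ z, (∀ k, k ≠ i → r k (m k) < r k z) → (∀ k, k ≠ j → r k (m k) < r k z) →
      False := by
    intro z hi hj
    obtain ⟨k, hk⟩ := hT z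
    have := hk _ (hmT k)
    by_cases hki : k = i
    · exact absurd (hj k (hki ▸ hij)) (not_lt.mpr this)
    · exact absurd (hi k hki) (not_lt.mpr this)
  have hback : ∀ a b, a ≠ b → m a = m b → ∀ z, (∀ k, k ≠ a → r k (m k) < r k z) →
      (∀ w, (∀ k, k ≠ a → r k (m k) < r k w) → r a w ≤ r a z) →
      z ∉ T ∧ Dominant r (insert z T) := by
    intro a b hab hmab z hz hmax
    refine ⟨fun hzT => ?_, fun w => ?_⟩
    · obtain ⟨k, rfl⟩ := hsurj z hzT
      by_cases hka : k = a
      · subst hka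
        have := hz b hab.symm
        rw [hmab] at this; exact lt_irrefl _ this
      · exact lt_irrefl _ (hz k hka)
    · have hza : ∀ y ∈ T, r a z ≤ r a y := by
        obtain ⟨k, hk⟩ := hT z
        by_cases hka : k = a
        · subst hka; exact hk
        · exact absurd (hz k hka) (not_lt.mpr (hk _ (hmT k)))
      by_cases hw : ∀ k, k ≠ a → r k (m k) < r k w
      · refine ⟨a, fun y hy => ?_⟩
        rcases Finset.mem_insert.mp hy with rfl | hy
        · exact hmax w hw
        · exact (hmax w hw).trans (hza y hy)
      · push Not at hw
        obtain ⟨k, hka, hk⟩ := hw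
        refine ⟨k, fun y hy => ?_⟩
        rcases Finset.mem_insert.mp hy with rfl | hy
        · exact hk.trans (hz k hka).le
        · exact hk.trans (hmle k y hy)
  refine ⟨m, i, j, hij, hmij, hmT, hmle, hdisj, fun z => ⟨?_, ?_⟩⟩
  · rintro ⟨hzT, hdom⟩
    obtain ⟨k, hk⟩ := hdom z
    -- The new point `z` takes over the minimum in ranking `k`, so every old point must keep a
    -- minimum in some other ranking.
    have hkey : ∀ y ∈ T, ∃ k', k' ≠ k ∧ m k' = y ∧ r k' y < r k' z := by
      intro y hy
      obtain ⟨k', hk'⟩ := hdom y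
      have hne' : z ≠ y := fun h => hzT (h ▸ hy)
      have h1 : r k' y < r k' z := lt_of_le_of_ne (hk' z (Finset.mem_insert_self _ _))
        fun h => hne' (hr k' h).symm
      refine ⟨k', ?_, huniq k' y hy fun w hw => hk' w (Finset.mem_insert_of_mem hw), h1⟩
      rintro rfl
      exact absurd (hk y (Finset.mem_insert_of_mem hy)) (not_le.mpr h1)
    have hfin : ∀ a b, a ≠ b → m a = m b → k = a →
        ((∀ k, k ≠ a → r k (m k) < r k z) ∧
          ∀ w, (∀ k, k ≠ a → r k (m k) < r k w) → r a w ≤ r a z) := by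
      rintro a b hab hmab rfl
      constructor
      · intro k'' hk''
        obtain ⟨k', hk'k, hmk', hlt⟩ := hkey _ (hmT k'')
        have : k' = k'' := hinj k b hab hmab k' k'' hk'k hk'' hmk'
        subst this; exact hlt
      · intro w hw
        obtain ⟨k', hk'⟩ := hdom w
        by_cases h : k' = k
        · subst h; exact hk' z (Finset.mem_insert_self _ _)
        · exact absurd (hw k' h) (not_lt.mpr (hk' _ (Finset.mem_insert_of_mem (hmT k'))))
    by_cases hki : k = i
    · exact Or.inl (hfin i j hij hmij hki)
    by_cases hkj : k = j
    · exact Or.inr (hfin j i hij.symm hmij.symm hkj)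
    -- If `k` were neither `i` nor `j`, then `m k` would also be the minimum of another ranking
    -- `k'`, and uniqueness of the coincidence would force `k' = i` and `k' = j`.
    exfalso
    obtain ⟨k', hk'k, hmk', -⟩ := hkey _ (hmT k)
    have h1 : k' = i := by
      by_contra h
      exact hk'k (hinj i j hij hmij k' k h hki hmk')
    have h2 : k' = j := by
      by_contra h
      exact hk'k (hinj j i hij.symm hmij.symm k' k h hkj hmk')
    exact hij (h1.symm.trans h2)
  · rintro (⟨h1, h2⟩ | ⟨h1, h2⟩)
    · exact hback i j hij hmij z h1 h2
    · exact hback j i hij.symm hmij.symm z h1 h2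

/-- In a set with as many elements as there are colours, but on which not all colours occur, the
number of elements whose removal leaves all colours but `i₀` is even. -/
theorem even_card_filter_image_erase [Fintype I] (c : V → I) (i₀ : I) {R : Finset V}
    (hR : R.card = Fintype.card I) (hc : R.image c ≠ Finset.univ) :
    Even (R.filter fun x => (R.erase x).image c = Finset.univ.erase i₀).card := by
  by_cases h : ∃ x₀ ∈ R, (R.erase x₀).image c = Finset.univ.erase i₀
  swap
  · have : (R.filter fun x => (R.erase x).image c = Finset.univ.erase i₀) = ∅ := by
      ext x; simp only [Finset.mem_filter, Finset.notMem_empty, iff_false, not_and]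
      exact fun hx hx' => h ⟨x, hx, hx'⟩
    simp [this]
  obtain ⟨x₀, hx₀, him⟩ := h
  have hx₀c : c x₀ ≠ i₀ := by
    intro hx
    apply hc
    rw [← Finset.insert_erase hx₀, Finset.image_insert, him, hx,
      Finset.insert_erase (Finset.mem_univ _)]
  have hinj : Set.InjOn c (R.erase x₀) := by
    rw [← Finset.card_image_iff, him, Finset.card_erase_of_mem (Finset.mem_univ _),
      Finset.card_erase_of_mem hx₀, hR, Finset.card_univ]
  have hmem : c x₀ ∈ (R.erase x₀).image c := by rw [him]; simp [hx₀c]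
  obtain ⟨x₁, hx₁, hcx₁⟩ := Finset.mem_image.mp hmem
  have hx₁R : x₁ ∈ R := Finset.mem_of_mem_erase hx₁
  have hx₁₀ : x₁ ≠ x₀ := Finset.ne_of_mem_erase hx₁
  -- The removable points are exactly the two that share the repeated colour.
  have : (R.filter fun x => (R.erase x).image c = Finset.univ.erase i₀) = {x₀, x₁} := by
    ext x
    simp only [Finset.mem_filter, Finset.mem_insert, Finset.mem_singleton]
    constructor
    · rintro ⟨hx, hxim⟩
      by_contra hne
      push Not at hne
      have hxc : c x ≠ i₀ := by
        have : c x ∈ (R.erase x₀).image c :=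
          Finset.mem_image_of_mem c (Finset.mem_erase.mpr ⟨hne.1, hx⟩)
        rw [him] at this
        exact Finset.ne_of_mem_erase this
      have hxm : c x ∈ (R.erase x).image c := by rw [hxim]; simp [hxc]
      obtain ⟨w, hw, hwx⟩ := Finset.mem_image.mp hxm
      have hwne := Finset.ne_of_mem_erase hw
      by_cases hw0 : w = x₀
      · subst hw0
        have : x₁ = x := hinj (Finset.mem_coe.mpr hx₁) (by simp [hne.1, hx]) (hcx₁.trans hwx)
        exact hne.2 this.symm
      · exact hwne (hinj (by simp [hw0, Finset.mem_of_mem_erase hw]) (by simp [hne.1, hx]) hwx)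
    · rintro (rfl | rfl)
      · exact ⟨hx₀, him⟩
      · refine ⟨hx₁R, ?_⟩
        rw [← him]
        apply Finset.Subset.antisymm
        · intro y hy
          obtain ⟨w, hw, rfl⟩ := Finset.mem_image.mp hy
          by_cases hw0 : w = x₀
          · subst hw0; rw [← hcx₁]; exact Finset.mem_image_of_mem c hx₁
          · exact Finset.mem_image_of_mem c
              (Finset.mem_erase.mpr ⟨hw0, Finset.mem_of_mem_erase hw⟩)
        · intro y hy
          obtain ⟨w, hw, rfl⟩ := Finset.mem_image.mp hy
          by_cases hw1 : w = x
          · subst hw1; rw [hcx₁]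
            exact Finset.mem_image_of_mem c (Finset.mem_erase.mpr ⟨hx₁₀.symm, hx₀⟩)
          · exact Finset.mem_image_of_mem c
              (Finset.mem_erase.mpr ⟨hw1, Finset.mem_of_mem_erase hw⟩)
  rw [this, Finset.card_pair hx₁₀.symm]
  exact even_two

/-- The parity argument: if the sets of all colours but `i₀` extend to dominant sets of full size in
an even number of ways, with one exception, then some dominant set of full size has all colours. -/
theorem exists_dominant_image_eq_univ [Fintype V] [Fintype I] {r : I → V → ℕ} (c : V → I) (i₀ : I)
    (T₀ : Finset V) (hT₀ : Dominant r T₀ ∧ T₀.card + 1 = Fintype.card I ∧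
      T₀.image c = Finset.univ.erase i₀)
    (hodd : ∀ E : Finset V, (∀ z, z ∈ E ↔ z ∉ T₀ ∧ Dominant r (insert z T₀)) → Odd E.card)
    (heven : ∀ T, Dominant r T → T.card + 1 = Fintype.card I → T.image c = Finset.univ.erase i₀ →
      T ≠ T₀ → ∀ E : Finset V, (∀ z, z ∈ E ↔ z ∉ T ∧ Dominant r (insert z T)) → Even E.card) :
    ∃ R, Dominant r R ∧ R.card = Fintype.card I ∧ R.image c = Finset.univ := by
  classical
  by_contra hcon
  push Not at hcon
  set D : Finset (Finset V) := Finset.univ.filter fun T =>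
    Dominant r T ∧ T.card + 1 = Fintype.card I ∧ T.image c = Finset.univ.erase i₀ with hD
  set Q : Finset (Finset V) := Finset.univ.filter fun R =>
    Dominant r R ∧ R.card = Fintype.card I with hQ
  have hDm : ∀ T, T ∈ D ↔ Dominant r T ∧ T.card + 1 = Fintype.card I ∧
      T.image c = Finset.univ.erase i₀ := fun T => by simp [hD]
  have hQm : ∀ R, R ∈ Q ↔ Dominant r R ∧ R.card = Fintype.card I := fun R => by simp [hQ]
  -- Double counting of the inclusions `T ⊆ R` between the two families. Counted from `R`, each
  -- contribution is even when no `R` shows all colours. Counted from `T`, only the exceptional `T₀`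
  -- contributes an odd number.
  have hcount := Finset.sum_card_bipartiteAbove_eq_sum_card_bipartiteBelow
    (s := D) (t := Q) (fun T R => T ⊆ R)
  have hleft : ∀ T ∈ D, (Q.bipartiteAbove (fun T R => T ⊆ R) T).card =
      (Finset.univ.filter fun z => z ∉ T ∧ Dominant r (insert z T)).card := by
    intro T hT
    obtain ⟨-, hTc, -⟩ := (hDm T).mp hT
    symm
    refine Finset.card_nbij (fun z => insert z T) ?_ ?_ ?_
    · intro z hz
      simp only [Finset.coe_filter, Finset.mem_univ, true_and, Set.mem_ofPred_eq] at hz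
      simp only [Finset.bipartiteAbove, Finset.coe_filter, Set.mem_ofPred_eq, hQm]
      exact ⟨⟨hz.2, by rw [Finset.card_insert_of_notMem hz.1, hTc]⟩, Finset.subset_insert _ _⟩
    · intro z hz w hw hzw
      simp only [Finset.coe_filter, Finset.mem_univ, true_and, Set.mem_ofPred_eq] at hz hw
      exact (Finset.insert_inj hz.1).mp hzw
    · intro R hR
      simp only [Finset.bipartiteAbove, Finset.coe_filter, Set.mem_ofPred_eq, hQm] at hR
      obtain ⟨⟨hRd, hRc⟩, hTR⟩ := hR
      obtain ⟨z, hz, rfl⟩ := (Finset.exists_eq_insert_iff (s := T) (t := R)).mpr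
        ⟨hTR, by omega⟩
      exact ⟨z, by simp [hz, hRd], rfl⟩
  have hright : ∀ R ∈ Q, (D.bipartiteBelow (fun T R => T ⊆ R) R).card =
      (R.filter fun x => (R.erase x).image c = Finset.univ.erase i₀).card := by
    intro R hR
    obtain ⟨hRd, hRc⟩ := (hQm R).mp hR
    symm
    refine Finset.card_nbij (fun x => R.erase x) ?_ ?_ ?_
    · intro x hx
      simp only [Finset.coe_filter, Set.mem_ofPred_eq] at hx
      simp only [Finset.bipartiteBelow, Finset.coe_filter, Set.mem_ofPred_eq, hDm]
      refine ⟨⟨hRd.mono (Finset.erase_subset _ _), ?_, hx.2⟩, Finset.erase_subset _ _⟩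
      rw [Finset.card_erase_add_one hx.1, hRc]
    · intro x hx w hw hxw
      simp only [Finset.coe_filter, Set.mem_ofPred_eq] at hx hw
      exact Finset.erase_injOn R (Finset.mem_coe.mpr hx.1) (Finset.mem_coe.mpr hw.1) hxw
    · intro T hT
      simp only [Finset.bipartiteBelow, Finset.coe_filter, Set.mem_ofPred_eq, hDm] at hT
      obtain ⟨⟨hTd, hTc, hTi⟩, hTR⟩ := hT
      obtain ⟨z, hz, rfl⟩ := (Finset.exists_eq_insert_iff (s := T) (t := R)).mpr
        ⟨hTR, by omega⟩
      exact ⟨z, by simp [hz, hTi], by simp [hz]⟩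
  rw [Finset.sum_congr rfl hleft, Finset.sum_congr rfl hright] at hcount
  have hE : Even (∑ R ∈ Q, (R.filter fun x =>
      (R.erase x).image c = Finset.univ.erase i₀).card) :=
    Finset.even_sum _ fun R hR => by
      obtain ⟨hRd, hRc⟩ := (hQm R).mp hR
      exact even_card_filter_image_erase c i₀ hRc (hcon R hRd hRc)
  rw [← hcount, ← Finset.add_sum_erase D _ ((hDm T₀).mpr hT₀)] at hE
  have h1 := hodd (Finset.univ.filter fun z => z ∉ T₀ ∧ Dominant r (insert z T₀)) (by simp)
  have h2 : Even (∑ T ∈ D.erase T₀,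
      (Finset.univ.filter fun z => z ∉ T ∧ Dominant r (insert z T)).card) :=
    Finset.even_sum _ fun T hT => by
      obtain ⟨hne, hT⟩ := Finset.mem_erase.mp hT
      obtain ⟨a, b, d⟩ := (hDm T).mp hT
      exact heven T a b d hne _ (by simp)
  exact (Nat.not_even_iff_odd.mpr (h1.add_even h2)) hE

/-- The ranking of `X ⊕ I` that puts `i` below `X`, and the other elements of `I` above `X`. -/
def extendedRank {X : Type*} (s : I → X → ℕ) (e : I → ℕ) (M : ℕ) (i : I) : X ⊕ I → ℕ
  | .inl x => s i x + 1
  | .inr k => if k = i then 0 else M + 1 + e k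

/-- **Scarf's lemma**. For rankings `s i` and a colouring `c` of a finite set `X`, some set of points
shows all the colours of `C` and dominates `X` for the rankings in `C`. -/
theorem exists_dominant_colorful {X : Type*} [DecidableEq X] [Fintype X] [Nonempty X] [Fintype I]
    [Nontrivial I] (s : I → X → ℕ) (hs : ∀ i, Function.Injective (s i)) (c : X → I) :
    ∃ (σ : Finset X) (C : Finset I), (∀ i ∈ C, ∃ x ∈ σ, c x = i) ∧
      ∀ z, ∃ i ∈ C, ∀ y ∈ σ, s i z ≤ s i y := by
  classical
  obtain ⟨M, hM⟩ : ∃ M, ∀ i x, s i x < M := by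
    obtain ⟨M, hM⟩ := (Set.finite_range (fun p : I × X => s p.1 p.2)).bddAbove
    exact ⟨M + 1, fun i x => Nat.lt_succ_of_le (hM ⟨(i, x), rfl⟩)⟩
  set e : I → ℕ := fun i => (Fintype.equivFin I i : ℕ) with he
  have heinj : Function.Injective e := fun a b h =>
    (Fintype.equivFin I).injective (Fin.ext h)
  set r : I → X ⊕ I → ℕ := extendedRank s e M with hrdef
  have rinl : ∀ i x, r i (.inl x) = s i x + 1 := fun i x => rfl
  have rinr : ∀ i k, r i (.inr k) = if k = i then 0 else M + 1 + e k := fun i k => rfl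
  have rself : ∀ i, r i (.inr i) = 0 := fun i => by simp [rinr]
  have rne : ∀ i k, k ≠ i → r i (.inr k) = M + 1 + e k := fun i k h => by simp [rinr, h]
  have hr : ∀ i, Function.Injective (r i) := by
    rintro i (x | k) (y | l) h
    · rw [rinl, rinl] at h; exact congrArg _ (hs i (Nat.succ_injective h))
    · have := hM i x
      rw [rinl, rinr] at h; split_ifs at h; omega
    · have := hM i y
      rw [rinl, rinr] at h; split_ifs at h; omega
    · rw [rinr, rinr] at h
      split_ifs at h with h1 h2 h2
      · rw [h1, h2]
      · omega
      · omega
      · exact congrArg _ (heinj (by omega))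
  obtain ⟨i₀⟩ : Nonempty I := inferInstance
  set col : X ⊕ I → I := Sum.elim c id with hcol
  -- The exceptional set of the parity argument: the fictitious points other than that of `i₀`,
  -- where the fictitious point of `k` has colour `k`.
  set T₀ : Finset (X ⊕ I) := (Finset.univ.erase i₀).image Sum.inr with hT₀
  have hT₀m : ∀ k, Sum.inr k ∈ T₀ ↔ k ≠ i₀ := fun k => by simp [hT₀]
  have hT₀l : ∀ x, Sum.inl x ∉ T₀ := fun x => by simp [hT₀]
  have hT₀card : T₀.card + 1 = Fintype.card I := by
    rw [hT₀, Finset.card_image_of_injective _ Sum.inr_injective,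
      Finset.card_erase_add_one (Finset.mem_univ _), Finset.card_univ]
  have hT₀dom : Dominant r T₀ := by
    rintro (x | k)
    · refine ⟨i₀, fun y hy => ?_⟩
      rcases y with y | l
      · exact absurd hy (hT₀l y)
      · have := hM i₀ x
        rw [rinl, rne _ _ ((hT₀m l).mp hy)]; omega
    · exact ⟨k, fun y _ => by rw [rself]; exact Nat.zero_le _⟩
  have hpos : ∀ T : Finset (X ⊕ I), T.card + 1 = Fintype.card I → T.Nonempty := by
    intro T h
    rw [← Finset.card_pos]
    have := Fintype.one_lt_card (α := I)
    omega
  have hodd : ∀ E : Finset (X ⊕ I), (∀ z, z ∈ E ↔ z ∉ T₀ ∧ Dominant r (insert z T₀)) →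
      Odd E.card := by
    intro E hE
    obtain ⟨m, i, j, hij, hmij, hmT, hmle, hdisj, hiff⟩ :=
      hT₀dom.exists_extension hr (hpos _ hT₀card) hT₀card
    have hmk : ∀ k, k ≠ i₀ → m k = .inr k := fun k hk =>
      hr k (le_antisymm (hmle k _ ((hT₀m k).mpr hk)) (by rw [rself]; exact Nat.zero_le _))
    have hcase : i = i₀ ∨ j = i₀ := by
      by_contra h
      push Not at h
      rw [hmk i h.1, hmk j h.2] at hmij
      exact hij (Sum.inr_injective hmij)
    -- Only one of the two exchange directions can be realized. Freeing the ranking `i₀` admits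
    -- exactly one point, the top of `X` in that ranking. Freeing the other ranking `b` would
    -- require a fictitious point above that of `b` in the ranking `i₀`, but such a point is the
    -- lowest in its own ranking.
    have hA : ∀ a b, a ≠ b → m a = m b → a = i₀ →
        (∃! z, (∀ k, k ≠ a → r k (m k) < r k z) ∧
          ∀ w, (∀ k, k ≠ a → r k (m k) < r k w) → r a w ≤ r a z) ∧
        ∀ z, ¬ (∀ k, k ≠ b → r k (m k) < r k z) := by
      rintro a b hab hmab rfl
      constructor
      · obtain ⟨x, -, hx⟩ := Finset.exists_max_image (Finset.univ : Finset X) (s a)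
          Finset.univ_nonempty
        refine ⟨.inl x, ⟨fun k hk => ?_, fun w hw => ?_⟩, fun z hz => ?_⟩
        · rw [hmk k hk, rself, rinl]; omega
        · rcases w with y | l
          · rw [rinl, rinl]
            exact Nat.succ_le_succ (hx y (Finset.mem_univ _))
          · by_cases hl : l = a
            · subst hl; rw [rself]; exact Nat.zero_le _
            · have := hw l hl
              rw [hmk l hl] at this
              exact absurd this (lt_irrefl _)
        · rcases z with y | l
          · have h1 := hz.2 (.inl x) fun k hk => by rw [hmk k hk, rself, rinl]; omega
            rw [rinl, rinl] at h1
            have h2 := hx y (Finset.mem_univ _)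
            exact congrArg _ (hs a (by omega))
          · by_cases hl : l = a
            · subst hl
              have h1 := hz.2 (.inl x) fun k hk => by rw [hmk k hk, rself, rinl]; omega
              rw [rinl, rself] at h1; omega
            · have := hz.1 l hl
              rw [hmk l hl] at this
              exact absurd this (lt_irrefl _)
      · intro z hz
        have hma : m a = .inr b := by rw [hmab, hmk b hab.symm]
        have h1 := hz a hab
        rw [hma, rne a b hab.symm] at h1
        rcases z with x | l
        · have := hM a x
          rw [rinl] at h1; omega
        · by_cases hl : l = a
          · subst hl; rw [rself] at h1; omega
          by_cases hlb : l = b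
          · subst hlb; rw [rne _ _ hl] at h1; omega
          · have := hz l hlb
            rw [hmk l hl] at this
            exact absurd this (lt_irrefl _)
    have : E.card = 1 := by
      rw [Finset.card_eq_one]
      rcases hcase with h | h
      · obtain ⟨⟨z, hz, hu⟩, hno⟩ := hA i j hij hmij h
        refine ⟨z, ?_⟩
        ext w
        rw [hE, hiff, Finset.mem_singleton]
        exact ⟨fun hw => hw.elim (hu w) fun hw => absurd hw.1 (hno w), fun hw => hw ▸ Or.inl hz⟩
      · obtain ⟨⟨z, hz, hu⟩, hno⟩ := hA j i hij.symm hmij.symm h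
        refine ⟨z, ?_⟩
        ext w
        rw [hE, hiff, Finset.mem_singleton]
        exact ⟨fun hw => hw.elim (fun hw => absurd hw.1 (hno w)) (hu w), fun hw => hw ▸ Or.inr hz⟩
    rw [this]; exact odd_one
  have heven : ∀ T, Dominant r T → T.card + 1 = Fintype.card I →
      T.image col = Finset.univ.erase i₀ → T ≠ T₀ → ∀ E : Finset (X ⊕ I),
      (∀ z, z ∈ E ↔ z ∉ T ∧ Dominant r (insert z T)) → Even E.card := by
    intro T hTd hTc hTi hTne E hE
    have hX : ∃ x, Sum.inl x ∈ T := by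
      by_contra hX
      push Not at hX
      apply hTne
      have hsub : T ⊆ T₀ := by
        intro v hv
        rcases v with x | k
        · exact absurd hv (hX x)
        · rw [hT₀m]
          have : k ∈ T.image col := Finset.mem_image.mpr ⟨_, hv, rfl⟩
          rw [hTi] at this
          exact Finset.ne_of_mem_erase this
      exact Finset.eq_of_subset_of_card_le hsub (by omega)
    obtain ⟨x, hx⟩ := hX
    obtain ⟨m, i, j, hij, hmij, hmT, hmle, hdisj, hiff⟩ := hTd.exists_extension hr (hpos _ hTc) hTc
    have hA : ∀ a, ∃! z, (∀ k, k ≠ a → r k (m k) < r k z) ∧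
          ∀ w, (∀ k, k ≠ a → r k (m k) < r k w) → r a w ≤ r a z := by
      intro a
      -- Since `T` contains a point of `X`, its minimum in ranking `k` lies below every fictitious
      -- point other than that of `k`. So both directions of exchange have a candidate, and `T` has
      -- exactly two extensions.
      have hmem : ∀ k, k ≠ a → r k (m k) < r k (.inr a) := by
        intro k hk
        refine (hmle k _ hx).trans_lt ?_
        have := hM k x
        rw [rinl, rne k a hk.symm]; omega
      obtain ⟨z, hz, hzmax⟩ := Finset.exists_max_image
        (Finset.univ.filter fun z => ∀ k, k ≠ a → r k (m k) < r k z) (r a)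
        ⟨.inr a, by simpa using hmem⟩
      simp only [Finset.mem_filter, Finset.mem_univ, true_and] at hz hzmax
      exact ⟨z, ⟨hz, hzmax⟩, fun w hw => hr a (le_antisymm (hzmax w hw.1) (hw.2 z hz))⟩
    obtain ⟨z, hz, hzu⟩ := hA i
    obtain ⟨w, hw, hwu⟩ := hA j
    have hzw : z ≠ w := fun h => hdisj z hz.1 (h ▸ hw.1)
    have : E = {z, w} := by
      ext v
      rw [hE, hiff, Finset.mem_insert, Finset.mem_singleton]
      refine ⟨fun h => h.imp (hzu v) (hwu v), ?_⟩
      rintro (rfl | rfl)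
      · exact Or.inl hz
      · exact Or.inr hw
    rw [this, Finset.card_pair hzw]
    exact even_two
  obtain ⟨R, hRd, hRc, hRi⟩ := exists_dominant_image_eq_univ (r := r) col i₀ T₀
    ⟨hT₀dom, hT₀card, by rw [hT₀, Finset.image_image]; simp [hcol]⟩ hodd heven
  -- A colour whose fictitious point is absent from `R` must be shown by a point of `X`. A ranking
  -- whose fictitious point belongs to `R` has minimum rank `0` there, so it cannot be the one that
  -- dominates a point of `X`.
  refine ⟨Finset.univ.filter fun x => Sum.inl x ∈ R, Finset.univ.filter fun i => Sum.inr i ∉ R,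
    ?_, ?_⟩
  · intro i hi
    simp only [Finset.mem_filter, Finset.mem_univ, true_and] at hi
    have : i ∈ R.image col := by rw [hRi]; exact Finset.mem_univ _
    obtain ⟨v, hv, rfl⟩ := Finset.mem_image.mp this
    rcases v with x | k
    · exact ⟨x, by simpa using hv, rfl⟩
    · exact absurd hv hi
  · intro z
    obtain ⟨i, hi⟩ := hRd (.inl z)
    refine ⟨i, ?_, ?_⟩
    · simp only [Finset.mem_filter, Finset.mem_univ, true_and]
      intro h
      have := hi _ h
      rw [rself, rinl] at this
      omega
    · intro y hy
      simp only [Finset.mem_filter, Finset.mem_univ, true_and] at hy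
      have := hi _ hy
      rw [rinl, rinl] at this
      omega

end Scarf

/-! ### Brouwer's theorem from Scarf's lemma, and surjectivity of face-preserving maps. -/

section Brouwer

variable {I : Type*} [Fintype I]

/-- The points of the grid of mesh `1 / N` in the simplex, up to scaling. -/
abbrev GridPoint (I : Type*) [Fintype I] (N : ℕ) : Type _ :=
  {x : I → Fin (N + 1) // ∑ i, (x i : ℕ) = N}

theorem exists_gridPoint {N : ℕ} (z : I → ℕ) (hz : ∑ i, z i = N) :
    ∃ x : GridPoint I N, ∀ i, (x.1 i : ℕ) = z i := by
  have hle : ∀ i, z i < N + 1 := fun i =>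
    Nat.lt_succ_of_le (hz ▸ Finset.single_le_sum (fun j _ => Nat.zero_le (z j)) (Finset.mem_univ i))
  exact ⟨⟨fun i => ⟨z i, hle i⟩, hz⟩, fun i => rfl⟩

theorem exists_gridPoint_ge [DecidableEq I] {N : ℕ} {C : Finset I} (hC : C.Nonempty) (m : I → ℕ)
    (hm : ∑ i ∈ C, m i ≤ N) : ∃ x : GridPoint I N, ∀ i ∈ C, m i ≤ (x.1 i : ℕ) := by
  obtain ⟨a, ha⟩ := hC
  obtain ⟨x, hx⟩ := exists_gridPoint (N := N)
    (fun i => (if i ∈ C then m i else 0) + if i = a then N - ∑ i ∈ C, m i else 0) (by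
      rw [Finset.sum_add_distrib, Finset.sum_ite_eq' Finset.univ a]
      simp only [Finset.mem_univ, if_true, Finset.sum_ite_mem, Finset.univ_inter]
      omega)
  exact ⟨x, fun i hi => by rw [hx, if_pos hi]; omega⟩

/-- Each colouring of the grid has a small cell whose vertices show every colour that is not
almost absent from the barycentric coordinates. -/
theorem exists_small_colorful_cell [DecidableEq I] [Nontrivial I] {N : ℕ}
    (c : GridPoint I N → I) : ∃ x : GridPoint I N, ∀ i, (x.1 i : ℕ) ≤ Fintype.card I ∨
      ∃ y : GridPoint I N, c y = i ∧ ∀ k, (x.1 k : ℕ) ≤ y.1 k + Fintype.card I ∧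
        (y.1 k : ℕ) ≤ x.1 k + Fintype.card I := by
  classical
  set n := Fintype.card (GridPoint I N) with hn
  set e : GridPoint I N → ℕ := fun x => (Fintype.equivFin (GridPoint I N) x : ℕ) with he
  have heinj : Function.Injective e := fun a b h => (Fintype.equivFin _).injective (Fin.ext h)
  have hlt : ∀ x, e x < n := fun x => (Fintype.equivFin (GridPoint I N) x).2
  have hdiv : ∀ (a : ℕ) x, (a * n + e x) / n = a := fun a x => by
    have h0 : 0 < n := (Nat.zero_le _).trans_lt (hlt x)
    rw [mul_comm, Nat.mul_add_div h0, Nat.div_eq_of_lt (hlt x), add_zero]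
  obtain ⟨a₀⟩ : Nonempty I := inferInstance
  have : Nonempty (GridPoint I N) :=
    ⟨(exists_gridPoint (N := N) (fun i => if i = a₀ then N else 0) (by simp)).choose⟩
  -- The `i`-th ranking compares `i`-th coordinates and breaks ties by a fixed enumeration of the
  -- grid; dividing by `n` recovers the coordinate.
  obtain ⟨σ, C, hcol, hdom⟩ := exists_dominant_colorful
    (fun (i : I) (x : GridPoint I N) => (x.1 i : ℕ) * n + e x) (by
      intro i x y h
      have h1 : (x.1 i : ℕ) = y.1 i := by rw [← hdiv (x.1 i) x, ← hdiv (y.1 i) y]; exact congrArg (· / n) h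
      simp only [h1] at h
      exact heinj (Nat.add_left_cancel h)) c
  have hdom' : ∀ z : GridPoint I N, ∃ i ∈ C, ∀ y ∈ σ, (z.1 i : ℕ) ≤ y.1 i := by
    intro z
    obtain ⟨i, hi, h⟩ := hdom z
    refine ⟨i, hi, fun y hy => ?_⟩
    rw [← hdiv (z.1 i) z, ← hdiv (y.1 i) y]
    exact Nat.div_le_div_right (h y hy)
  have hCne : C.Nonempty := by
    obtain ⟨i, hi, -⟩ := hdom' (Classical.arbitrary _)
    exact ⟨i, hi⟩
  have hσne : σ.Nonempty := by
    obtain ⟨i, hi⟩ := hCne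
    obtain ⟨x, hx, -⟩ := hcol i hi
    exact ⟨x, hx⟩
  have hex : ∀ k, ∃ v ∈ σ, ∀ y ∈ σ, (v.1 k : ℕ) ≤ y.1 k := fun k =>
    σ.exists_min_image (fun y => (y.1 k : ℕ)) hσne
  choose v hvσ hvle using hex
  -- Otherwise some grid point would exceed, in every coordinate of `C`, the minimum of `σ`, against
  -- domination. So the minima over `C` already use up all of `N` but fewer than `C.card` units.
  have hsum : N < ∑ i ∈ C, ((v i).1 i + 1 : ℕ) := by
    by_contra h
    obtain ⟨z, hz⟩ := exists_gridPoint_ge hCne (fun i => ((v i).1 i + 1 : ℕ)) (not_lt.mp h)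
    obtain ⟨i, hi, h'⟩ := hdom' z
    have h1 := hz i hi
    have h2 := h' _ (hvσ i)
    omega
  have hcardC : C.card ≤ Fintype.card I := Finset.card_le_univ C
  rw [Finset.sum_add_distrib, Finset.sum_const, smul_eq_mul, mul_one] at hsum
  have hsplit : ∀ y : GridPoint I N, ∑ i ∈ C, (y.1 i : ℕ) + ∑ i ∈ Cᶜ, (y.1 i : ℕ) = N :=
    fun y => (Finset.sum_add_sum_compl C _).trans y.2
  -- A point of `σ` has only the remaining slack to distribute: its coordinates in `C` are close to
  -- the minima, and those outside `C` are close to `0`.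
  have hin : ∀ y ∈ σ, ∀ k ∈ C, (y.1 k : ℕ) ≤ (v k).1 k + Fintype.card I := by
    intro y hy k hk
    have h1 := hsplit y
    rw [← Finset.add_sum_erase C _ hk] at h1 hsum
    have h2 : ∑ i ∈ C.erase k, ((v i).1 i : ℕ) ≤ ∑ i ∈ C.erase k, (y.1 i : ℕ) :=
      Finset.sum_le_sum fun i _ => hvle i y hy
    omega
  have hout : ∀ y ∈ σ, ∀ k, k ∉ C → (y.1 k : ℕ) ≤ Fintype.card I := by
    intro y hy k hk
    have h1 := hsplit y
    have h2 : ∑ i ∈ C, ((v i).1 i : ℕ) ≤ ∑ i ∈ C, (y.1 i : ℕ) :=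
      Finset.sum_le_sum fun i _ => hvle i y hy
    have h3 : (y.1 k : ℕ) ≤ ∑ i ∈ Cᶜ, (y.1 i : ℕ) :=
      Finset.single_le_sum (f := fun i => (y.1 i : ℕ)) (fun i _ => Nat.zero_le _)
        (Finset.mem_compl.mpr hk)
    omega
  obtain ⟨x, hx⟩ := hσne
  refine ⟨x, fun i => ?_⟩
  by_cases hi : i ∈ C
  · right
    obtain ⟨y, hy, hyc⟩ := hcol i hi
    refine ⟨y, hyc, fun k => ?_⟩
    by_cases hk : k ∈ C
    · have := hin x hx k hk
      have := hin y hy k hk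
      have := hvle k x hx
      have := hvle k y hy
      omega
    · have := hout x hx k hk
      have := hout y hy k hk
      omega
  · exact Or.inl (hout x hx i hi)

/-- **Brouwer's fixed point theorem** on the standard simplex. -/
theorem exists_fixed_point_stdSimplex [Nonempty I] (f : (I → ℝ) → I → ℝ)
    (hf : ContinuousOn f (stdSimplex ℝ I)) (hmaps : MapsTo f (stdSimplex ℝ I) (stdSimplex ℝ I)) :
    ∃ x ∈ stdSimplex ℝ I, f x = x := by
  classical
  have hcompact : IsCompact (stdSimplex ℝ I) := isCompact_stdSimplex ℝ I
  have hne : (stdSimplex ℝ I).Nonempty :=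
    ⟨_, single_mem_stdSimplex ℝ (Classical.arbitrary I)⟩
  rcases subsingleton_or_nontrivial I with hI | hI
  · obtain ⟨x, hx⟩ := hne
    refine ⟨x, hx, funext fun i => ?_⟩
    have h1 := hx.2
    have h2 := (hmaps hx).2
    rw [Fintype.sum_subsingleton _ i] at h1 h2
    rw [h1, h2]
  have hkey : ∀ η : ℝ, 0 < η → ∃ x ∈ stdSimplex ℝ I, ∀ i, x i - f x i ≤ η := by
    intro η hη
    have huc := hcompact.uniformContinuousOn_of_continuous hf
    rw [Metric.uniformContinuousOn_iff] at huc
    obtain ⟨δ, hδ, hδf⟩ := huc (η / 2) (half_pos hη)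
    -- Cells have size at most `Fintype.card I / N`. Size below `δ` controls the variation of `f`,
    -- and size below `η / 2` controls the variation of the coordinates.
    obtain ⟨N, hN⟩ := exists_nat_gt ((Fintype.card I : ℝ) / min δ (η / 2))
    have hmin : 0 < min δ (η / 2) := lt_min hδ (half_pos hη)
    have hNpos : (0 : ℝ) < N := (by positivity : (0:ℝ) ≤ _).trans_lt hN
    have hmesh : (Fintype.card I : ℝ) / N < min δ (η / 2) := by
      rw [div_lt_iff₀ hmin] at hN
      rw [div_lt_iff₀ hNpos]; linarith
    set p : GridPoint I N → I → ℝ := fun x i => (x.1 i : ℕ) / (N : ℝ) with hp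
    have hpmem : ∀ x, p x ∈ stdSimplex ℝ I := by
      intro x
      refine ⟨fun i => by positivity, ?_⟩
      simp only [hp]
      rw [← Finset.sum_div, ← Nat.cast_sum, x.2, div_self hNpos.ne']
    -- The colour of a grid point is a coordinate that `f` does not decrease; one exists because
    -- both coordinate sums are `1`.
    have hcol : ∀ x : GridPoint I N, ∃ i, p x i ≤ f (p x) i := by
      intro x
      by_contra h
      push Not at h
      have := Finset.sum_lt_sum_of_nonempty (Finset.univ_nonempty (α := I)) fun i _ => h i
      rw [(hpmem x).2, (hmaps (hpmem x)).2] at this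
      exact lt_irrefl _ this
    choose c hc using hcol
    obtain ⟨x, hx⟩ := exists_small_colorful_cell c
    refine ⟨p x, hpmem x, fun i => ?_⟩
    rcases hx i with h | ⟨y, rfl, hy⟩
    · have h1 : p x i ≤ (Fintype.card I : ℝ) / N :=
        div_le_div_of_nonneg_right (by exact_mod_cast h) hNpos.le
      have h2 := (hmaps (hpmem x)).1 i
      have h3 := min_le_right δ (η / 2)
      linarith
    · have hclose : ∀ k, |p x k - p y k| ≤ (Fintype.card I : ℝ) / N := by
        intro k
        obtain ⟨h1, h2⟩ := hy k
        have h1' : ((x.1 k : ℕ) : ℝ) ≤ (y.1 k : ℕ) + Fintype.card I := by exact_mod_cast h1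
        have h2' : ((y.1 k : ℕ) : ℝ) ≤ (x.1 k : ℕ) + Fintype.card I := by exact_mod_cast h2
        simp only [hp]
        rw [← sub_div, abs_div, abs_of_pos hNpos]
        exact div_le_div_of_nonneg_right (abs_le.mpr ⟨by linarith, by linarith⟩) hNpos.le
      have hd : dist (p x) (p y) < δ := by
        rw [dist_pi_lt_iff hδ]
        intro k
        exact (hclose k).trans_lt (hmesh.trans_le (min_le_left _ _))
      have h1 := (dist_le_pi_dist _ _ (c y)).trans_lt (hδf _ (hpmem x) _ (hpmem y) hd)
      rw [Real.dist_eq, abs_lt] at h1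
      have h2 := (abs_le.mp (hclose (c y))).2
      have h3 := hc y
      have h4 := min_le_right δ (η / 2)
      linarith
  -- The approximate fixed points make the infimum of this total decrease nonpositive, and
  -- compactness attains it. There `x ≤ f x` coordinatewise with equal sums, hence equality.
  set g : (I → ℝ) → ℝ := fun x => ∑ i, max (x i - f x i) 0 with hg
  have hgc : ContinuousOn g (stdSimplex ℝ I) := by
    refine continuousOn_finsetSum _ fun i _ => ?_
    have h1 : ContinuousOn (fun x => f x i) (stdSimplex ℝ I) :=
      (continuous_apply i).comp_continuousOn hf
    exact ContinuousOn.sup (((continuous_apply i).continuousOn).sub h1) continuousOn_const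
  obtain ⟨x, hx, hmin⟩ := hcompact.exists_isMinOn hne hgc
  have hgx : g x ≤ 0 := by
    refine le_of_forall_pos_le_add fun η hη => ?_
    have hcard : (0 : ℝ) < Fintype.card I := by exact_mod_cast Fintype.card_pos
    obtain ⟨y, hy, hyη⟩ := hkey (η / Fintype.card I) (by positivity)
    refine (hmin hy).trans ?_
    calc g y ≤ ∑ _i : I, η / Fintype.card I :=
          Finset.sum_le_sum fun i _ => max_le (hyη i) (by positivity)
      _ = 0 + η := by
          rw [Finset.sum_const, Finset.card_univ, nsmul_eq_mul]; field_simp; ring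
  have hle : ∀ i, x i ≤ f x i := by
    intro i
    have h1 : max (x i - f x i) 0 ≤ g x :=
      Finset.single_le_sum (f := fun i => max (x i - f x i) 0) (fun _ _ => le_max_right _ _)
        (Finset.mem_univ i)
    have h2 := le_max_left (x i - f x i) 0
    linarith
  refine ⟨x, hx, funext fun i => ?_⟩
  have heq : ∑ i, x i = ∑ i, f x i := by rw [hx.2, (hmaps hx).2]
  exact ((Finset.sum_eq_sum_iff_of_le fun i _ => hle i).mp heq i (Finset.mem_univ i)).symm

/-- A continuous self-map of the simplex that preserves every face is onto. -/
theorem exists_eq_of_face_preserving (f : (I → ℝ) → I → ℝ) (hf : ContinuousOn f (stdSimplex ℝ I))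
    (hmaps : MapsTo f (stdSimplex ℝ I) (stdSimplex ℝ I))
    (hface : ∀ x ∈ stdSimplex ℝ I, ∀ i, x i = 0 → f x i = 0) {y : I → ℝ}
    (hy : y ∈ stdSimplex ℝ I) : ∃ x ∈ stdSimplex ℝ I, f x = y := by
  classical
  have : Nonempty I := by
    by_contra h
    rw [not_nonempty_iff] at h
    have := hy.2
    simp at this
  set d : (I → ℝ) → I → ℝ := fun x i => max (y i - f x i) 0 with hd
  have hd0 : ∀ x i, 0 ≤ d x i := fun x i => le_max_right _ _
  have hS0 : ∀ x, 0 ≤ ∑ j, d x j := fun x => Finset.sum_nonneg fun i _ => hd0 x i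
  have hdc : ∀ i, ContinuousOn (fun x => d x i) (stdSimplex ℝ I) := fun i =>
    ContinuousOn.sup (continuousOn_const.sub ((continuous_apply i).comp_continuousOn hf))
      continuousOn_const
  -- As in Nash's existence proof, mass is pushed towards the coordinates where `f x` falls short of
  -- `y`. At a fixed point the shortfalls `d x i` are proportional to `x i`.
  obtain ⟨x, hx, hfix⟩ := exists_fixed_point_stdSimplex
    (fun x i => (x i + d x i) / (1 + ∑ j, d x j))
    (by
      refine continuousOn_pi.mpr fun i => ContinuousOn.div ?_ ?_ ?_
      · exact (continuous_apply i).continuousOn.add (hdc i)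
      · exact continuousOn_const.add (continuousOn_finsetSum _ fun j _ => hdc j)
      · intro x _
        have := hS0 x
        positivity)
    (by
      intro x hx
      have h0 := hS0 x
      refine ⟨fun i => div_nonneg (add_nonneg (hx.1 i) (hd0 x i)) (by linarith), ?_⟩
      rw [← Finset.sum_div, Finset.sum_add_distrib, hx.2, div_self]
      positivity)
  refine ⟨x, hx, ?_⟩
  set S := ∑ j, d x j with hS
  have hS' : 0 ≤ S := hS0 x
  have hdi : ∀ i, d x i = x i * S := by
    intro i
    have : (x i + d x i) / (1 + S) = x i := congrFun hfix i
    rw [div_eq_iff (by positivity)] at this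
    linarith
  have hsum := (hmaps hx).2
  -- If `S > 0`, then `f x i < y i` wherever `x i > 0`, while preservation of faces gives `f x i = 0
  -- ≤ y i` elsewhere. The two coordinate sums could not agree.
  have hSzero : S = 0 := by
    by_contra hne
    have hpos : 0 < S := lt_of_le_of_ne hS' (Ne.symm hne)
    have hlt : ∀ i, 0 < x i → f x i < y i := by
      intro i hi
      have h1 : 0 < d x i := by rw [hdi]; positivity
      simp only [hd] at h1
      rcases lt_max_iff.mp h1 with h | h
      · linarith
      · exact absurd h (lt_irrefl _)
    have hle : ∀ i, f x i ≤ y i := by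
      intro i
      rcases (hx.1 i).eq_or_lt with h | h
      · rw [hface x hx i h.symm]; exact hy.1 i
      · exact (hlt i h).le
    obtain ⟨i, hi⟩ : ∃ i, 0 < x i := by
      by_contra h
      push Not at h
      have : ∑ i, x i ≤ 0 := Finset.sum_nonpos fun i _ => h i
      rw [hx.2] at this
      linarith
    have := Finset.sum_lt_sum (fun i _ => hle i) ⟨i, Finset.mem_univ i, hlt i hi⟩
    rw [hsum, hy.2] at this
    exact lt_irrefl _ this
  have hge : ∀ i, y i ≤ f x i := by
    intro i
    have h1 := hdi i
    rw [hSzero, mul_zero] at h1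
    have h2 : y i - f x i ≤ d x i := le_max_left _ _
    linarith
  have heq : ∑ i, y i = ∑ i, f x i := by rw [hy.2, hsum]
  exact funext fun i =>
    ((Finset.sum_eq_sum_iff_of_le fun i _ => hge i).mp heq i (Finset.mem_univ i)).symm

end Brouwer

/-! ### The transport cost -/

/-- The optimal quadratic transport cost, that is, the square of `W2`. -/
noncomputable def cost (ν₁ ν₂ : Measure ℝ) : ℝ≥0∞ :=
  ⨅ (π : Measure (ℝ × ℝ)) (_ : π.map Prod.fst = ν₁ ∧ π.map Prod.snd = ν₂),
    ∫⁻ z, edist z.1 z.2 ^ 2 ∂π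

theorem W2_eq_cost (ν₁ ν₂ : Measure ℝ) : W2 ν₁ ν₂ = cost ν₁ ν₂ ^ (1 / 2 : ℝ) := rfl

theorem W2_sq (ν₁ ν₂ : Measure ℝ) : W2 ν₁ ν₂ ^ 2 = cost ν₁ ν₂ := by
  rw [W2_eq_cost, ← ENNReal.rpow_natCast, ← ENNReal.rpow_mul]
  norm_num

theorem tendsto_W2_iff {ι : Type*} {l : Filter ι} {ν₁ ν₂ : ι → Measure ℝ} :
    Tendsto (fun k => W2 (ν₁ k) (ν₂ k)) l (𝓝 0) ↔ Tendsto (fun k => cost (ν₁ k) (ν₂ k)) l (𝓝 0) := by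
  constructor
  · intro h
    have := ((ENNReal.continuous_pow 2).tendsto 0).comp h
    simpa [Function.comp_def, W2_sq] using this
  · intro h
    have := ((ENNReal.continuous_rpow_const (y := (1 / 2 : ℝ))).tendsto 0).comp h
    simpa [Function.comp_def, W2_eq_cost] using this

theorem cost_le {ν₁ ν₂ : Measure ℝ} {π : Measure (ℝ × ℝ)} (h₁ : π.map Prod.fst = ν₁)
    (h₂ : π.map Prod.snd = ν₂) : cost ν₁ ν₂ ≤ ∫⁻ z, edist z.1 z.2 ^ 2 ∂π :=
  iInf₂_le π ⟨h₁, h₂⟩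

theorem cost_comm (ν₁ ν₂ : Measure ℝ) : cost ν₁ ν₂ = cost ν₂ ν₁ := by
  have key : ∀ ν₁ ν₂ : Measure ℝ, cost ν₁ ν₂ ≤ cost ν₂ ν₁ := by
    intro ν₁ ν₂
    refine le_iInf₂ fun π hπ => ?_
    refine (cost_le (π := π.map Prod.swap) ?_ ?_).trans ?_
    · rw [Measure.map_map measurable_fst measurable_swap]; exact hπ.2
    · rw [Measure.map_map measurable_snd measurable_swap]; exact hπ.1
    · rw [lintegral_map (by fun_prop) measurable_swap]
      simp [edist_comm]
  exact le_antisymm (key _ _) (key _ _)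

/-- Moving mass over a distance at least `δ` costs at least `δ²` per unit. -/
theorem mul_measure_sub_le_cost {ν₁ ν₂ : Measure ℝ} {A B : Set ℝ} (hA : MeasurableSet A)
    (hB : MeasurableSet B) {δ : ℝ≥0∞} (h : ∀ a ∈ A, ∀ b ∉ B, δ ≤ edist a b) :
    δ ^ 2 * (ν₁ A - ν₂ B) ≤ cost ν₁ ν₂ := by
  refine le_iInf₂ fun π hπ => ?_
  have hE : MeasurableSet (Prod.fst ⁻¹' A ∩ (Prod.snd ⁻¹' B)ᶜ : Set (ℝ × ℝ)) :=
    (measurable_fst hA).inter (measurable_snd hB).compl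
  have h1 : ν₁ A - ν₂ B ≤ π (Prod.fst ⁻¹' A ∩ (Prod.snd ⁻¹' B)ᶜ) := by
    rw [← hπ.1, ← hπ.2, Measure.map_apply measurable_fst hA, Measure.map_apply measurable_snd hB,
      ← sdiff_eq]
    exact le_measure_sdiff
  calc δ ^ 2 * (ν₁ A - ν₂ B)
      ≤ δ ^ 2 * π (Prod.fst ⁻¹' A ∩ (Prod.snd ⁻¹' B)ᶜ) := by gcongr
    _ = ∫⁻ _z in (Prod.fst ⁻¹' A ∩ (Prod.snd ⁻¹' B)ᶜ : Set (ℝ × ℝ)), δ ^ 2 ∂π := by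
        rw [setLIntegral_const]
    _ ≤ ∫⁻ z in (Prod.fst ⁻¹' A ∩ (Prod.snd ⁻¹' B)ᶜ : Set (ℝ × ℝ)), edist z.1 z.2 ^ 2 ∂π := by
        refine setLIntegral_mono (by fun_prop) fun z hz => ?_
        gcongr
        exact h _ hz.1 _ hz.2
    _ ≤ ∫⁻ z, edist z.1 z.2 ^ 2 ∂π := setLIntegral_le_lintegral _ _

theorem edist_sq_le (a b : ℝ) : edist a b ^ 2 ≤ 2 * (‖a‖ₑ ^ 2 + ‖b‖ₑ ^ 2) := by
  have h : edist a b ≤ ‖a‖ₑ + ‖b‖ₑ := by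
    rw [edist_eq_enorm_sub]; exact enorm_sub_le
  calc edist a b ^ 2 ≤ (‖a‖ₑ + ‖b‖ₑ) ^ 2 := by gcongr
    _ ≤ 2 * (‖a‖ₑ ^ 2 + ‖b‖ₑ ^ 2) := by
      have := ENNReal.rpow_add_le_mul_rpow_add_rpow ‖a‖ₑ ‖b‖ₑ (p := 2) (by norm_num)
      norm_num at this
      exact this

/-- The cost between the images of two measures that have densities with respect to a common one:
transport the common part along the two maps, and the excesses independently. -/
theorem cost_map_withDensity_le {Ω : Type*} [MeasurableSpace Ω] (μ : Measure Ω) [SFinite μ]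
    {g₁ g₂ : Ω → ℝ≥0∞} (hg₁ : Measurable g₁) (hg₂ : Measurable g₂)
    (h₁ : ∫⁻ x, g₁ x ∂μ = 1) (h₂ : ∫⁻ x, g₂ x ∂μ = 1) {φ₁ φ₂ : Ω → ℝ} (hφ₁ : Measurable φ₁)
    (hφ₂ : Measurable φ₂) :
    cost ((μ.withDensity g₁).map φ₁) ((μ.withDensity g₂).map φ₂) ≤
      ∫⁻ x, g₁ x * edist (φ₁ x) (φ₂ x) ^ 2 ∂μ +
        (2 * ∫⁻ x, (g₁ x - g₂ x) * ‖φ₁ x‖ₑ ^ 2 ∂μ + 2 * ∫⁻ x, (g₂ x - g₁ x) * ‖φ₂ x‖ₑ ^ 2 ∂μ) := by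
  set e₁ : Ω → ℝ≥0∞ := fun x => g₁ x - g₂ x with he₁
  set e₂ : Ω → ℝ≥0∞ := fun x => g₂ x - g₁ x with he₂
  set k : Ω → ℝ≥0∞ := fun x => min (g₁ x) (g₂ x) with hk
  have me₁ : Measurable e₁ := hg₁.sub hg₂
  have me₂ : Measurable e₂ := hg₂.sub hg₁
  have mk : Measurable k := hg₁.min hg₂
  have add₁ : g₁ = k + e₁ := by
    funext x
    rcases le_total (g₁ x) (g₂ x) with h | h
    · simp [hk, he₁, h, tsub_eq_zero_of_le h]
    · simp [hk, he₁, h, add_tsub_cancel_of_le h]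
  have add₂ : g₂ = k + e₂ := by
    funext x
    rcases le_total (g₂ x) (g₁ x) with h | h
    · simp [hk, he₂, h, tsub_eq_zero_of_le h]
    · simp [hk, he₂, h, add_tsub_cancel_of_le h]
  have s₁ : ∫⁻ x, k x ∂μ + ∫⁻ x, e₁ x ∂μ = 1 := by
    rw [← h₁, add₁, ← lintegral_add_left mk]; rfl
  have s₂ : ∫⁻ x, k x ∂μ + ∫⁻ x, e₂ x ∂μ = 1 := by
    rw [← h₂, add₂, ← lintegral_add_left mk]; rfl
  have kfin : ∫⁻ x, k x ∂μ ≠ ⊤ := ne_top_of_le_ne_top ENNReal.one_ne_top (s₁ ▸ le_self_add)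
  set m : ℝ≥0∞ := ∫⁻ x, e₁ x ∂μ with hm
  have hm₂ : ∫⁻ x, e₂ x ∂μ = m := (ENNReal.add_right_inj kfin).mp (s₂.trans s₁.symm)
  have mfin : m ≠ ⊤ := ne_top_of_le_ne_top ENNReal.one_ne_top (s₁ ▸ le_add_self)
  set ν₁ : Measure ℝ := (μ.withDensity e₁).map φ₁ with hν₁
  set ν₂ : Measure ℝ := (μ.withDensity e₂).map φ₂ with hν₂
  have t₁ : ν₁ univ = m := by
    rw [hν₁, Measure.map_apply hφ₁ MeasurableSet.univ, preimage_univ,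
      withDensity_apply _ MeasurableSet.univ, Measure.restrict_univ]
  have t₂ : ν₂ univ = m := by
    rw [hν₂, Measure.map_apply hφ₂ MeasurableSet.univ, preimage_univ,
      withDensity_apply _ MeasurableSet.univ, Measure.restrict_univ, hm₂]
  have : IsFiniteMeasure ν₁ := ⟨by rw [t₁]; exact mfin.lt_top⟩
  have : IsFiniteMeasure ν₂ := ⟨by rw [t₂]; exact mfin.lt_top⟩
  -- This includes `m = 0`, where `m⁻¹ = ⊤` but the excess measures vanish.
  have hmm : ∀ ν : Measure ℝ, ν univ = m → m⁻¹ • m • ν = ν := by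
    intro ν hν
    by_cases h0 : m = 0
    · rw [h0, Measure.measure_univ_eq_zero] at hν
      simp [hν]
    · rw [smul_smul, ENNReal.inv_mul_cancel h0 mfin, one_smul]
  have hscal : ∀ ν : Measure ℝ, ν univ = m → ∀ f : ℝ → ℝ≥0∞,
      m⁻¹ * (m * ∫⁻ x, f x ∂ν) = ∫⁻ x, f x ∂ν := by
    intro ν hν f
    conv_rhs => rw [← hmm ν hν]
    rw [lintegral_smul_measure, lintegral_smul_measure, smul_eq_mul, smul_eq_mul]
  set π : Measure (ℝ × ℝ) := (μ.withDensity k).map (fun x => (φ₁ x, φ₂ x)) + m⁻¹ • ν₁.prod ν₂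
    with hπ
  refine (cost_le (π := π) ?_ ?_).trans ?_
  · rw [hπ, Measure.map_add _ _ measurable_fst, Measure.map_map measurable_fst (hφ₁.prodMk hφ₂),
      Measure.map_smul, Measure.map_fst_prod, t₂, hmm _ t₁, add₁, withDensity_add_left mk,
      Measure.map_add _ _ hφ₁]
    rfl
  · rw [hπ, Measure.map_add _ _ measurable_snd, Measure.map_map measurable_snd (hφ₁.prodMk hφ₂),
      Measure.map_smul, Measure.map_snd_prod, t₁, hmm _ t₂, add₂, withDensity_add_left mk,
      Measure.map_add _ _ hφ₂]
    rfl
  · rw [hπ, lintegral_add_measure, lintegral_map (by fun_prop) (hφ₁.prodMk hφ₂),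
      lintegral_withDensity_eq_lintegral_mul _ mk (by fun_prop), lintegral_smul_measure]
    refine add_le_add (lintegral_mono fun x => ?_) ?_
    · exact mul_le_mul_left (min_le_left _ _) _
    · have hsq : Measurable fun x : ℝ => ‖x‖ₑ ^ 2 := by fun_prop
      have i₁ : ∫⁻ x, ‖x‖ₑ ^ 2 ∂ν₁ = ∫⁻ x, e₁ x * ‖φ₁ x‖ₑ ^ 2 ∂μ := by
        rw [hν₁, lintegral_map hsq hφ₁,
          lintegral_withDensity_eq_lintegral_mul _ me₁ (by fun_prop)]; rfl
      have i₂ : ∫⁻ x, ‖x‖ₑ ^ 2 ∂ν₂ = ∫⁻ x, e₂ x * ‖φ₂ x‖ₑ ^ 2 ∂μ := by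
        rw [hν₂, lintegral_map hsq hφ₂,
          lintegral_withDensity_eq_lintegral_mul _ me₂ (by fun_prop)]; rfl
      rw [← i₁, ← i₂, smul_eq_mul, ← hscal ν₁ t₁, ← hscal ν₂ t₂]
      calc m⁻¹ * ∫⁻ z, edist z.1 z.2 ^ 2 ∂(ν₁.prod ν₂)
          ≤ m⁻¹ * ∫⁻ z, 2 * (‖z.1‖ₑ ^ 2 + ‖z.2‖ₑ ^ 2) ∂(ν₁.prod ν₂) := by
            gcongr with z; exact edist_sq_le _ _
        _ = _ := by
            rw [lintegral_const_mul _ (by fun_prop), lintegral_add_left (by fun_prop),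
              lintegral_prod _ (by fun_prop), lintegral_prod _ (by fun_prop)]
            simp only [lintegral_const, t₁, t₂]
            rw [lintegral_mul_const _ hsq]
            ring

/-! ### Self-maps of the finitely supported measures -/

/-- The measure on `s` with weights `x`. -/
noncomputable def mixture (s : Finset ℝ) (x : s → ℝ) : Measure ℝ :=
  (Measure.count.withDensity fun a : s => ENNReal.ofReal (x a)).map (fun a : s => (a : ℝ))

theorem mixture_apply {s : Finset ℝ} (x : s → ℝ) {A : Set ℝ} (hA : MeasurableSet A) :
    mixture s x A = ∑ a : s, A.indicator (fun _ => ENNReal.ofReal (x a)) (a : ℝ) := by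
  rw [mixture, Measure.map_apply measurable_subtype_coe hA,
    withDensity_apply _ (measurable_subtype_coe hA), ← lintegral_indicator
    (measurable_subtype_coe hA), lintegral_count, tsum_fintype]
  refine Finset.sum_congr rfl fun a _ => ?_
  by_cases h : (a : ℝ) ∈ A
  · rw [indicator_of_mem (by exact h), indicator_of_mem h]
  · rw [indicator_of_notMem (by exact h), indicator_of_notMem h]

theorem lintegral_count_ofReal_stdSimplex {ι : Type*} [Fintype ι] [MeasurableSpace ι]
    [MeasurableSingletonClass ι] {x : ι → ℝ} (hx : x ∈ stdSimplex ℝ ι) :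
    ∫⁻ a, ENNReal.ofReal (x a) ∂(Measure.count : Measure ι) = 1 := by
  rw [lintegral_count, tsum_fintype, ← ENNReal.ofReal_sum_of_nonneg fun i _ => hx.1 i, hx.2,
    ENNReal.ofReal_one]

/-- The measure with weights `x`, for `x` in the simplex. -/
noncomputable def finSuppOfSimplex (s : Finset ℝ) (x : s → ℝ) (hx : x ∈ stdSimplex ℝ s) : FinSupp :=
  ⟨mixture s x, ⟨by
    rw [mixture_apply x MeasurableSet.univ]
    simp only [indicator_univ]
    rw [← ENNReal.ofReal_sum_of_nonneg fun i _ => hx.1 i, hx.2, ENNReal.ofReal_one]⟩, s, by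
    rw [mixture_apply x s.measurableSet.compl]
    simp⟩

theorem mixture_singleton {s : Finset ℝ} (x : s → ℝ) (a : s) :
    mixture s x {(a : ℝ)} = ENNReal.ofReal (x a) := by
  classical
  rw [mixture_apply x (measurableSet_singleton _), Finset.sum_eq_single a]
  · simp
  · intro b _ hb
    simp [hb]
  · simp

theorem measure_eq_of_singleton_eq {s : Finset ℝ} {ν₁ ν₂ : Measure ℝ} (h₁ : ν₁ (s : Set ℝ)ᶜ = 0)
    (h₂ : ν₂ (s : Set ℝ)ᶜ = 0) (h : ∀ a ∈ s, ν₁ {a} = ν₂ {a}) : ν₁ = ν₂ := by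
  have key : ∀ ν : Measure ℝ, ν (s : Set ℝ)ᶜ = 0 → ∀ A, MeasurableSet A →
      ν A = ∑ a ∈ s, A.indicator (fun a => ν {a}) a := by
    intro ν hν A hA
    classical
    rw [← measure_inter_add_sdiff A s.measurableSet,
      measure_mono_null (s := A \ s) (fun x hx => hx.2) hν, add_zero]
    have : A ∩ s = ((s.filter (· ∈ A) : Finset ℝ) : Set ℝ) := by ext; simp [and_comm]
    rw [this, ← sum_measure_singleton, Finset.sum_filter]
    exact Finset.sum_congr rfl fun a _ => by simp [Set.indicator]
  ext A hA
  rw [key ν₁ h₁ A hA, key ν₂ h₂ A hA]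
  exact Finset.sum_congr rfl fun a ha => by
    by_cases haA : a ∈ A <;> simp [haA, h a ha]

theorem sum_real_singleton {s : Finset ℝ} {ν : Measure ℝ} [IsProbabilityMeasure ν]
    (h : ν (s : Set ℝ)ᶜ = 0) : ∑ a : s, ν.real {(a : ℝ)} = 1 := by
  rw [Finset.sum_coe_sort s (fun a => ν.real {a}), sum_measureReal_singleton,
    ← probReal_univ (μ := ν)]
  have := measureReal_add_measureReal_compl (μ := ν) s.measurableSet
  rw [measureReal_def ν (s : Set ℝ)ᶜ, h] at this
  simpa using this

theorem exists_pos_edist_le (s : Finset ℝ) :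
    ∃ δ : ℝ≥0∞, δ ≠ 0 ∧ δ ≠ ⊤ ∧ ∀ a ∈ s, ∀ b ∈ s, a ≠ b → δ ≤ edist a b := by
  classical
  -- The cap at `1` keeps the separation finite when `s` has at most one point.
  refine ⟨min 1 ((s ×ˢ s).inf fun p => if p.1 = p.2 then ⊤ else edist p.1 p.2), ?_,
    ne_top_of_le_ne_top ENNReal.one_ne_top (min_le_left _ _), ?_⟩
  · refine (lt_min zero_lt_one ?_).ne'
    rw [Finset.lt_inf_iff (by simp)]
    intro p _
    split_ifs with h
    · simp
    · exact edist_pos.mpr h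
  · intro a ha b hb hab
    refine (min_le_right _ _).trans ((Finset.inf_le (Finset.mk_mem_product ha hb)).trans ?_)
    simp [hab]

/-- Since `ν₂` sits on the `δ`-separated set `s`, mass leaving the atom `a` has to travel at least
`δ`. -/
theorem measure_singleton_sub_le_cost {s : Finset ℝ} {δ : ℝ≥0∞}
    (hδ : ∀ a ∈ s, ∀ b ∈ s, a ≠ b → δ ≤ edist a b) {ν₁ ν₂ : Measure ℝ}
    (h₂ : ν₂ (s : Set ℝ)ᶜ = 0) {a : ℝ} (ha : a ∈ s) :
    δ ^ 2 * (ν₁ {a} - ν₂ {a}) ≤ cost ν₁ ν₂ := by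
  classical
  have hB : ν₂ ((s.erase a : Finset ℝ) : Set ℝ)ᶜ ≤ ν₂ {a} := by
    refine (measure_mono (t := {a} ∪ (s : Set ℝ)ᶜ) ?_).trans ((measure_union_le _ _).trans ?_)
    · intro x hx
      by_cases hxa : x = a
      · exact Or.inl hxa
      · exact Or.inr fun h => hx (by simp [hxa]; exact h)
    · rw [h₂, add_zero]
  refine le_trans ?_ (mul_measure_sub_le_cost (measurableSet_singleton a)
    (s.erase a).measurableSet.compl (δ := δ) ?_)
  · gcongr
  · intro x hx b hb
    rw [mem_singleton_iff] at hx
    subst hx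
    simp only [mem_compl_iff, not_not, Finset.mem_coe, Finset.mem_erase] at hb
    exact hδ _ ha _ hb.2 (Ne.symm hb.1)

theorem tendsto_measure_singleton {s : Finset ℝ} {δ : ℝ≥0∞} (hδ0 : δ ≠ 0) (hδt : δ ≠ ⊤)
    (hδ : ∀ a ∈ s, ∀ b ∈ s, a ≠ b → δ ≤ edist a b) {ι : Type*} {l : Filter ι}
    {ν : ι → Measure ℝ} {ν₀ : Measure ℝ} [IsFiniteMeasure ν₀]
    (h : ∀ᶠ k in l, ν k (s : Set ℝ)ᶜ = 0) (h₀ : ν₀ (s : Set ℝ)ᶜ = 0)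
    (hc : Tendsto (fun k => cost (ν k) ν₀) l (𝓝 0)) {a : ℝ} (ha : a ∈ s) :
    Tendsto (fun k => ν k {a}) l (𝓝 (ν₀ {a})) := by
  have hsub : ∀ {c d e : ℝ≥0∞}, δ ^ 2 * (c - d) ≤ e → c ≤ d + e / δ ^ 2 := by
    intro c d e hcde
    rw [← tsub_le_iff_left, ENNReal.le_div_iff_mul_le (Or.inl (pow_ne_zero 2 hδ0))
      (Or.inl (ENNReal.pow_ne_top hδt)), mul_comm]
    exact hcde
  have hc' : Tendsto (fun k => cost (ν k) ν₀ / δ ^ 2) l (𝓝 0) := by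
    simpa using ENNReal.Tendsto.div_const hc (Or.inr (pow_ne_zero 2 hδ0))
  refine tendsto_of_tendsto_of_tendsto_of_le_of_le' (g := fun k => ν₀ {a} - cost (ν k) ν₀ / δ ^ 2)
    (h := fun k => ν₀ {a} + cost (ν k) ν₀ / δ ^ 2) ?_ ?_ ?_ ?_
  · simpa using ENNReal.Tendsto.sub tendsto_const_nhds hc' (Or.inl (measure_ne_top ν₀ {a}))
  · simpa using tendsto_const_nhds.add hc'
  · filter_upwards [h] with k hk
    rw [tsub_le_iff_right]
    refine hsub ?_
    rw [cost_comm]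
    exact measure_singleton_sub_le_cost hδ hk ha
  · exact Eventually.of_forall fun k => hsub (measure_singleton_sub_le_cost hδ h₀ ha)

/-- The common part of two mixtures on `s` stays in place at no cost, so only the differences of the
weights are paid for. -/
theorem tendsto_cost_mixture (s : Finset ℝ) {x : s → ℝ} (hx : x ∈ stdSimplex ℝ s) :
    Tendsto (fun y => cost (mixture s y) (mixture s x)) (𝓝[stdSimplex ℝ s] x) (𝓝 0) := by
  have hbound : ∀ y ∈ stdSimplex ℝ s, cost (mixture s y) (mixture s x) ≤
      2 * ∑ a : s, (ENNReal.ofReal (y a) - ENNReal.ofReal (x a)) * ‖(a : ℝ)‖ₑ ^ 2 +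
        2 * ∑ a : s, (ENNReal.ofReal (x a) - ENNReal.ofReal (y a)) * ‖(a : ℝ)‖ₑ ^ 2 := by
    intro y hy
    refine (cost_map_withDensity_le (Measure.count : Measure s) (measurable_of_finite _)
      (measurable_of_finite _) (lintegral_count_ofReal_stdSimplex hy)
      (lintegral_count_ofReal_stdSimplex hx) measurable_subtype_coe
      measurable_subtype_coe).trans (le_of_eq ?_)
    simp only [lintegral_count, tsum_fintype, edist_self]
    simp
  refine tendsto_of_tendsto_of_tendsto_of_le_of_le' tendsto_const_nhds ?_
    (Eventually.of_forall fun _ => zero_le) (eventually_mem_nhdsWithin.mono hbound)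
  have hy : ∀ a : s, Tendsto (fun y : s → ℝ => ENNReal.ofReal (y a)) (𝓝[stdSimplex ℝ s] x)
      (𝓝 (ENNReal.ofReal (x a))) := fun a =>
    ((ENNReal.continuous_ofReal.comp (continuous_apply a)).tendsto x).mono_left nhdsWithin_le_nhds
  have h0 : (0 : ℝ≥0∞) = 2 * ∑ a : s, (ENNReal.ofReal (x a) - ENNReal.ofReal (x a)) * ‖(a : ℝ)‖ₑ ^ 2 +
      2 * ∑ a : s, (ENNReal.ofReal (x a) - ENNReal.ofReal (x a)) * ‖(a : ℝ)‖ₑ ^ 2 := by simp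
  rw [h0]
  have hfin : ∀ a : s, ‖(a : ℝ)‖ₑ ^ 2 ≠ ⊤ := fun a => ENNReal.pow_ne_top enorm_ne_top
  refine Tendsto.add ?_ ?_
  · refine ENNReal.Tendsto.const_mul (tendsto_finsetSum _ fun a _ =>
      ENNReal.Tendsto.mul_const ?_ (Or.inr (hfin a))) (Or.inr (by simp))
    exact ENNReal.Tendsto.sub (hy a) tendsto_const_nhds (Or.inl ENNReal.ofReal_ne_top)
  · refine ENNReal.Tendsto.const_mul (tendsto_finsetSum _ fun a _ =>
      ENNReal.Tendsto.mul_const ?_ (Or.inr (hfin a))) (Or.inr (by simp))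
    exact ENNReal.Tendsto.sub tendsto_const_nhds (hy a) (Or.inl ENNReal.ofReal_ne_top)

theorem W2Continuous.tendsto_cost {T : FinSupp → FinSupp} (hT : W2Continuous T) {ι : Type*}
    {l : Filter ι} {ν : ι → FinSupp} {ν₀ : FinSupp}
    (h : Tendsto (fun k => cost (ν k).1 ν₀.1) l (𝓝 0)) :
    Tendsto (fun k => cost (T (ν k)).1 (T ν₀).1) l (𝓝 0) := by
  rw [← tendsto_W2_iff] at h ⊢
  rw [ENNReal.tendsto_nhds_zero]
  intro ε hε
  obtain ⟨δ, hδ, hδT⟩ := hT ν₀ ε hε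
  filter_upwards [h.eventually_lt_const hδ] with k hk
  exact (hδT _ hk).le

/-- A `W2`-continuous self-map `T` of `Δ_f(ℝ)` with `T ν ≪ ν` is onto: it preserves the faces of
each simplex of measures carried by a given finite set. -/
theorem surjective_of_W2Continuous {T : FinSupp → FinSupp} (hT : W2Continuous T)
    (hac : ∀ ν, (T ν).1 ≪ ν.1) : Function.Surjective T := by
  classical
  rintro ⟨ν, hν, s, hs⟩
  obtain ⟨δ, hδ0, hδt, hδ⟩ := exists_pos_edist_le s
  -- `T` read in the weights on `s`. By absolute continuity `T` does not leave `s`, and an atom of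
  -- weight zero keeps weight zero; the latter is the preservation of faces. The value off the
  -- simplex is arbitrary.
  set f : (s → ℝ) → s → ℝ := fun x a =>
    if hx : x ∈ stdSimplex ℝ s then (T (finSuppOfSimplex s x hx)).1.real {(a : ℝ)} else 0 with hf
  have hfx : ∀ x (hx : x ∈ stdSimplex ℝ s) a,
      f x a = (T (finSuppOfSimplex s x hx)).1.real {(a : ℝ)} := fun x hx a => dif_pos hx
  have hnull : ∀ x (hx : x ∈ stdSimplex ℝ s), (T (finSuppOfSimplex s x hx)).1 (s : Set ℝ)ᶜ = 0 := by
    intro x hx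
    apply hac
    change mixture s x _ = 0
    rw [mixture_apply x s.measurableSet.compl]
    simp
  have hmaps : MapsTo f (stdSimplex ℝ s) (stdSimplex ℝ s) := by
    intro x hx
    have := (T (finSuppOfSimplex s x hx)).2.1
    refine ⟨fun a => by rw [hfx x hx]; exact measureReal_nonneg, ?_⟩
    simp only [hfx x hx]
    exact sum_real_singleton (hnull x hx)
  have hface : ∀ x ∈ stdSimplex ℝ s, ∀ a, x a = 0 → f x a = 0 := by
    intro x hx a ha
    rw [hfx x hx, measureReal_def]
    have : (T (finSuppOfSimplex s x hx)).1 {(a : ℝ)} = 0 := by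
      apply hac
      change mixture s x _ = 0
      rw [mixture_singleton, ha, ENNReal.ofReal_zero]
    rw [this, ENNReal.toReal_zero]
  have hcont : ContinuousOn f (stdSimplex ℝ s) := by
    intro x hx
    refine tendsto_pi_nhds.mpr fun a => ?_
    have hP := (T (finSuppOfSimplex s x hx)).2.1
    set F : (s → ℝ) → FinSupp := fun y =>
      if hy : y ∈ stdSimplex ℝ s then finSuppOfSimplex s y hy else finSuppOfSimplex s x hx with hF
    have hFy : ∀ y (hy : y ∈ stdSimplex ℝ s), F y = finSuppOfSimplex s y hy := fun y hy =>
      dif_pos hy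
    have hc : Tendsto (fun y => cost (F y).1 (finSuppOfSimplex s x hx).1)
        (𝓝[stdSimplex ℝ s] x) (𝓝 0) := by
      refine (tendsto_cost_mixture s hx).congr' ?_
      filter_upwards [self_mem_nhdsWithin] with y hy
      rw [hFy y hy]; rfl
    have hc' := hT.tendsto_cost hc
    have hTx := tendsto_measure_singleton hδ0 hδt hδ
      (eventually_mem_nhdsWithin.mono fun y hy => by rw [hFy y hy]; exact hnull y hy)
      (hnull x hx) hc' a.2
    rw [hfx x hx]
    refine ((ENNReal.tendsto_toReal (measure_ne_top _ _)).comp hTx).congr' ?_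
    filter_upwards [self_mem_nhdsWithin] with y hy
    rw [hfx y hy, ← hFy y hy]
    rfl
  obtain ⟨x, hx, hxy⟩ := exists_eq_of_face_preserving f hcont hmaps hface
    (y := fun a => ν.real {(a : ℝ)}) ⟨fun a => measureReal_nonneg, sum_real_singleton hs⟩
  refine ⟨finSuppOfSimplex s x hx, Subtype.ext ?_⟩
  have hP := (T (finSuppOfSimplex s x hx)).2.1
  refine measure_eq_of_singleton_eq (hnull x hx) hs fun a ha => ?_
  have := congrFun hxy ⟨a, ha⟩
  rw [hfx x hx] at this
  exact (measureReal_eq_measureReal_iff).mp this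

/-! ### Quantile functions -/

/-- Atomless probability measures whose support is `[0,1]`. -/
structure IsFullOnUnit (μ : Measure ℝ) : Prop where
  prob : IsProbabilityMeasure μ
  noAtoms : NullSingletonClass μ
  compl : μ (Icc (0 : ℝ) 1)ᶜ = 0
  pos : ∀ a b : ℝ, 0 ≤ a → a < b → b ≤ 1 → 0 < μ (Ioc a b)

/-- The density is used only here: its minimum over the compact interval is positive, so
subintervals are charged. The later arguments need only atomlessness and full support. -/
theorem HasPositiveC1Density.isFullOnUnit {μ : Measure ℝ} [hμ : IsProbabilityMeasure μ]
    (h : HasPositiveC1Density μ) : IsFullOnUnit μ := by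
  obtain ⟨f, hf, hpos, rfl⟩ := h
  refine ⟨hμ, ⟨fun x => ?_⟩, ?_, ?_⟩
  · exact withDensity_absolutelyContinuous _ _ (measure_singleton x)
  · apply withDensity_absolutelyContinuous
    rw [Measure.restrict_apply measurableSet_Icc.compl]
    simp
  · intro a b ha hab hb
    rw [withDensity_apply _ measurableSet_Ioc]
    have hsub : Ioc a b ⊆ Icc (0 : ℝ) 1 := fun x hx => ⟨ha.trans hx.1.le, hx.2.trans hb⟩
    rw [Measure.restrict_restrict measurableSet_Ioc, inter_eq_left.mpr hsub]
    obtain ⟨m, hm, hmin⟩ := isCompact_Icc.exists_isMinOn (nonempty_Icc.mpr zero_le_one)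
      hf.continuousOn
    calc (0 : ℝ≥0∞) < ENNReal.ofReal (f m) * ENNReal.ofReal (b - a) := by
          simp [hpos m hm, hab]
      _ = ∫⁻ _x in Ioc a b, ENNReal.ofReal (f m) := by rw [setLIntegral_const, Real.volume_Ioc]
      _ ≤ ∫⁻ x in Ioc a b, ENNReal.ofReal (f x) :=
          lintegral_mono_ae ((ae_restrict_iff' measurableSet_Ioc).mpr
            (Eventually.of_forall fun x hx => ENNReal.ofReal_le_ofReal (hmin (hsub hx))))

theorem Gam_zero (μ ν : Measure ℝ) : Gam μ ν 0 = 0 := by simp [Gam]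

theorem exists_lt_cdf {ν : Measure ℝ} {y : ℝ} (hy : y < 1) : ∃ x, y < cdf ν x :=
  ((tendsto_cdf_atTop ν).eventually_const_lt hy).exists

theorem bddBelow_lt_cdf {ν : Measure ℝ} {y : ℝ} (hy : 0 < y) : BddBelow {x | y < cdf ν x} := by
  obtain ⟨x, hx⟩ := ((tendsto_cdf_atBot ν).eventually_lt_const hy).exists
  exact ⟨x, fun z hz => le_of_not_gt fun h => absurd (monotone_cdf ν h.le)
    (not_le.mpr (hx.trans hz))⟩

namespace IsFullOnUnit

variable {μ : Measure ℝ} (hμ : IsFullOnUnit μ)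
include hμ

theorem cdf_eq_zero {x : ℝ} (hx : x ≤ 0) : cdf μ x = 0 := by
  have := hμ.prob
  have := hμ.noAtoms
  rw [cdf_eq_real, measureReal_def]
  have : μ (Iic x) = 0 := by
    refine le_antisymm (((measure_mono (Iic_subset_Iic.mpr hx)).trans ?_)) zero_le
    rw [measure_congr Iio_ae_eq_Iic.symm]
    exact (measure_mono fun y (hy : y < 0) h => absurd h.1 (not_le.mpr hy)).trans hμ.compl.le
  rw [this, ENNReal.toReal_zero]

theorem cdf_eq_one {x : ℝ} (hx : 1 ≤ x) : cdf μ x = 1 := by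
  have := hμ.prob
  rw [cdf_eq_real, measureReal_def]
  have : μ (Iic x) = 1 := by
    rw [prob_compl_eq_zero_iff measurableSet_Iic |>.symm]
    exact measure_mono_null (t := (Icc (0 : ℝ) 1)ᶜ) (fun y hy h => hy (h.2.trans hx)) hμ.compl
  rw [this, ENNReal.toReal_one]

theorem strictMonoOn_cdf : StrictMonoOn (cdf μ) (Icc 0 1) := by
  have := hμ.prob
  intro a ha b hb hab
  have h := hμ.pos a b ha.1 hab hb.2
  rw [← measure_cdf μ, StieltjesFunction.measure_Ioc, ENNReal.ofReal_pos] at h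
  linarith

theorem continuous_cdf : Continuous (cdf μ) := by
  have := hμ.prob
  have := hμ.noAtoms
  rw [continuous_iff_continuousAt]
  intro x
  rw [(monotone_cdf μ).continuousAt_iff_leftLim_eq_rightLim, StieltjesFunction.rightLim_eq]
  have h : μ {x} = 0 := measure_singleton x
  rw [← measure_cdf μ, StieltjesFunction.measure_singleton, ENNReal.ofReal_eq_zero] at h
  exact le_antisymm ((monotone_cdf μ).leftLim_le le_rfl) (by linarith)

theorem cdf_mem_Ioo {l : ℝ} (hl : l ∈ Ioo (0 : ℝ) 1) : cdf μ l ∈ Ioo (0 : ℝ) 1 := by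
  have h1 := hμ.strictMonoOn_cdf (left_mem_Icc.mpr zero_le_one) ⟨hl.1.le, hl.2.le⟩ hl.1
  have h2 := hμ.strictMonoOn_cdf ⟨hl.1.le, hl.2.le⟩ (right_mem_Icc.mpr zero_le_one) hl.2
  rw [hμ.cdf_eq_zero le_rfl] at h1
  rw [hμ.cdf_eq_one le_rfl] at h2
  exact ⟨h1, h2⟩

theorem ae_mem_Ioo : ∀ᵐ l ∂μ, l ∈ Ioo (0 : ℝ) 1 := by
  have := hμ.noAtoms
  have h : ∀ᵐ l ∂μ, l ∈ Icc (0 : ℝ) 1 := by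
    rw [ae_iff]; exact hμ.compl
  have h0 : ∀ᵐ l ∂μ, l ≠ 0 := by rw [ae_iff]; simp
  have h1 : ∀ᵐ l ∂μ, l ≠ 1 := by rw [ae_iff]; simp
  filter_upwards [h, h0, h1] with l hl hl0 hl1
  exact ⟨lt_of_le_of_ne hl.1 hl0.symm, lt_of_le_of_ne hl.2 hl1⟩

/-- The distribution function of `μ` maps `[0,1]` continuously and strictly increasingly onto
`[0,1]`, so `γ_ν(s)` is a true preimage. The inserted point `1` takes care of `cdf ν s = 1`. -/
theorem gam_spec (ν : Measure ℝ) (s : ℝ) :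
    gam μ ν s ∈ Icc (0 : ℝ) 1 ∧ cdf μ (gam μ ν s) = cdf ν s := by
  have hy : cdf ν s ∈ Icc (cdf μ 0) (cdf μ 1) := by
    rw [hμ.cdf_eq_zero le_rfl, hμ.cdf_eq_one le_rfl]
    exact ⟨cdf_nonneg ν s, cdf_le_one ν s⟩
  obtain ⟨x, hx, hxy⟩ := intermediate_value_Icc zero_le_one hμ.continuous_cdf.continuousOn hy
  have hgam : gam μ ν s = x := by
    refine IsGLB.csInf_eq ⟨?_, ?_⟩ (insert_nonempty _ _)
    · rintro z (rfl | hz)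
      · exact hx.2
      · rw [mem_ofPred_eq, ← hxy] at hz
        exact le_of_not_gt fun h => absurd (monotone_cdf μ h.le) (not_le.mpr hz)
    · intro b hb
      refine le_of_forall_gt_imp_ge_of_dense fun z hz => ?_
      rcases le_or_gt 1 z with h | h
      · exact (hb (mem_insert _ _)).trans h
      · refine hb (mem_insert_of_mem _ ?_)
        rw [mem_ofPred_eq, ← hxy]
        exact hμ.strictMonoOn_cdf hx ⟨hx.1.trans hz.le, h.le⟩ hz
  rw [hgam]
  exact ⟨hx, hxy⟩

theorem gam_lt_iff {ν : Measure ℝ} {s a : ℝ} (ha : a ∈ Icc (0 : ℝ) 1) :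
    gam μ ν s < a ↔ cdf ν s < cdf μ a := by
  rw [← (hμ.gam_spec ν s).2, hμ.strictMonoOn_cdf.lt_iff_lt (hμ.gam_spec ν s).1 ha]

theorem lt_gam_iff {ν : Measure ℝ} {s a : ℝ} (ha : a ∈ Icc (0 : ℝ) 1) :
    a < gam μ ν s ↔ cdf μ a < cdf ν s := by
  rw [← (hμ.gam_spec ν s).2, hμ.strictMonoOn_cdf.lt_iff_lt ha (hμ.gam_spec ν s).1]

theorem monotone_gam (ν : Measure ℝ) : Monotone (gam μ ν) := fun s t hst => by
  rw [← hμ.strictMonoOn_cdf.le_iff_le (hμ.gam_spec ν s).1 (hμ.gam_spec ν t).1,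
    (hμ.gam_spec ν s).2, (hμ.gam_spec ν t).2]
  exact monotone_cdf ν hst

theorem abs_gam_le_one (ν : Measure ℝ) (s : ℝ) : |gam μ ν s| ≤ 1 := by
  have := (hμ.gam_spec ν s).1
  rw [abs_of_nonneg this.1]; exact this.2

theorem intervalIntegrable_gam (ν : Measure ℝ) (a b : ℝ) :
    IntervalIntegrable (gam μ ν) volume a b := (hμ.monotone_gam ν).intervalIntegrable

theorem Gam_sub (ν : Measure ℝ) (s t : ℝ) : Gam μ ν s - Gam μ ν t = ∫ x in t..s, gam μ ν x :=
  intervalIntegral.integral_interval_sub_left (hμ.intervalIntegrable_gam ν _ _)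
    (hμ.intervalIntegrable_gam ν _ _)

theorem abs_Gam_sub_le (ν : Measure ℝ) (s t : ℝ) : |Gam μ ν s - Gam μ ν t| ≤ |s - t| := by
  rw [hμ.Gam_sub]
  have := intervalIntegral.norm_integral_le_of_norm_le_const (a := t) (b := s) (C := 1)
    (f := gam μ ν) fun x _ => hμ.abs_gam_le_one ν x
  rwa [one_mul] at this

theorem abs_Gam_le (ν : Measure ℝ) (s : ℝ) : |Gam μ ν s| ≤ |s| := by
  simpa [Gam_zero] using hμ.abs_Gam_sub_le ν s 0

theorem lipschitzWith_Gam (ν : Measure ℝ) : LipschitzWith 1 (Gam μ ν) :=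
  LipschitzWith.of_dist_le_mul fun s t => by
    simpa [Real.dist_eq] using hμ.abs_Gam_sub_le ν s t

theorem measurable_Gam (ν : Measure ℝ) : Measurable (Gam μ ν) :=
  (hμ.lipschitzWith_Gam ν).continuous.measurable

section phi

variable {ν : Measure ℝ}

theorem phi_le_of_lt_cdf {l s : ℝ} (hl : l ∈ Ioo (0 : ℝ) 1) (h : cdf μ l < cdf ν s) :
    phi μ ν l ≤ s :=
  csInf_le (bddBelow_lt_cdf (hμ.cdf_mem_Ioo hl).1) h

theorem le_phi_of_cdf_le {l s : ℝ} (hl : l ∈ Ioo (0 : ℝ) 1) (h : cdf ν s ≤ cdf μ l) :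
    s ≤ phi μ ν l :=
  le_csInf (exists_lt_cdf (hμ.cdf_mem_Ioo hl).2) fun _x hx =>
    le_of_not_gt fun hxs => absurd ((monotone_cdf ν hxs.le).trans h) (not_le.mpr hx)

/-- Right continuity of `cdf ν` preserves the inequality slightly to the right of `s`, which makes
the conclusion strict. -/
theorem lt_phi_of_cdf_lt {l s : ℝ} (hl : l ∈ Ioo (0 : ℝ) 1) (h : cdf ν s < cdf μ l) :
    s < phi μ ν l := by
  have hr := ((cdf ν).right_continuous s).mono (Ioi_subset_Ici le_rfl)
  obtain ⟨t, ht, hst⟩ := ((hr.tendsto.eventually_lt_const h).and self_mem_nhdsWithin).exists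
  exact (show s < t from hst).trans_le (hμ.le_phi_of_cdf_le hl ht.le)

/-- `φ_ν` and `γ_ν` are generalized inverses of each other. Together with `gam_le_of_lt_phi`, this
says that `γ_ν - l` changes sign at `φ_ν(l)`. -/
theorem le_gam_of_phi_le {l s : ℝ} (hl : l ∈ Ioo (0 : ℝ) 1) (h : phi μ ν l ≤ s) :
    l ≤ gam μ ν s :=
  le_of_not_gt fun hlt => absurd h (not_le.mpr
    (hμ.lt_phi_of_cdf_lt hl ((hμ.gam_lt_iff ⟨hl.1.le, hl.2.le⟩).mp hlt)))

theorem gam_le_of_lt_phi {l s : ℝ} (hl : l ∈ Ioo (0 : ℝ) 1) (h : s < phi μ ν l) :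
    gam μ ν s ≤ l :=
  le_of_not_gt fun hlt => absurd h (not_lt.mpr
    (hμ.phi_le_of_lt_cdf hl ((hμ.lt_gam_iff ⟨hl.1.le, hl.2.le⟩).mp hlt)))

theorem monotoneOn_phi : MonotoneOn (phi μ ν) (Ioo 0 1) := by
  intro a ha b hb hab
  exact csInf_le_csInf (bddBelow_lt_cdf (hμ.cdf_mem_Ioo ha).1)
    (exists_lt_cdf (hμ.cdf_mem_Ioo hb).2) fun x hx => (monotone_cdf μ hab).trans_lt hx

theorem measurable_phi : Measurable (phi μ ν) := by
  refine measurable_of_restrict_of_restrict_compl (s := Ioo 0 1) measurableSet_Ioo ?_ ?_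
  · exact Monotone.measurable fun a b hab => hμ.monotoneOn_phi a.2 b.2 hab
  -- Off `(0,1)` the infimum may take its default value; it matters only that `φ_ν` is constant on
  -- each of the two half-lines.
  · have : (Ioo (0 : ℝ) 1)ᶜ.domRestrict (phi μ ν) =
        fun x : ↥(Ioo (0 : ℝ) 1)ᶜ => if (x : ℝ) ≤ 0 then phi μ ν 0 else phi μ ν 1 := by
      funext x
      change phi μ ν x = _
      split_ifs with h
      · simp only [phi, hμ.cdf_eq_zero h, hμ.cdf_eq_zero le_rfl]
      · have h1 : 1 ≤ (x : ℝ) := le_of_not_gt fun h' => x.2 ⟨not_le.mp h, h'⟩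
        simp only [phi, hμ.cdf_eq_one h1, hμ.cdf_eq_one le_rfl]
    rw [this]
    exact Measurable.ite (measurable_subtype_coe measurableSet_Iic) measurable_const
      measurable_const

/-- Quantile transform: up to a `μ`-null set, `φ_ν(l) ≤ s` means `l ≤ γ_ν(s)`, an event of
probability `cdf μ (γ_ν(s)) = cdf ν s`. -/
theorem map_phi [IsProbabilityMeasure ν] : μ.map (phi μ ν) = ν := by
  have := hμ.prob
  have := hμ.noAtoms
  have : IsProbabilityMeasure (μ.map (phi μ ν)) :=
    Measure.isProbabilityMeasure_map hμ.measurable_phi.aemeasurable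
  refine Measure.eq_of_cdf _ _ (StieltjesFunction.ext fun s => ?_)
  rw [cdf_eq_real, measureReal_def, Measure.map_apply hμ.measurable_phi measurableSet_Iic,
    ← (hμ.gam_spec ν s).2, cdf_eq_real, measureReal_def]
  congr 1
  apply le_antisymm
  · refine measure_mono_ae ?_
    filter_upwards [hμ.ae_mem_Ioo] with l hl h
    exact hμ.le_gam_of_phi_le hl h
  · rw [measure_congr Iio_ae_eq_Iic.symm]
    refine measure_mono_ae ?_
    filter_upwards [hμ.ae_mem_Ioo] with l hl h
    exact hμ.phi_le_of_lt_cdf hl ((hμ.lt_gam_iff ⟨hl.1.le, hl.2.le⟩).mp h)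

/-- `φ_ν(l)` maximizes the concave function `s ↦ l s - Γ_ν(s)`. -/
theorem mul_sub_Gam_le {l : ℝ} (hl : l ∈ Ioo (0 : ℝ) 1) (s : ℝ) :
    l * s - Gam μ ν s ≤ l * phi μ ν l - Gam μ ν (phi μ ν l) := by
  set t := phi μ ν l with ht
  rcases le_total t s with h | h
  · have h1 : ∫ _x in t..s, l ≤ ∫ x in t..s, gam μ ν x :=
      intervalIntegral.integral_mono_on h (by simp) (hμ.intervalIntegrable_gam ν _ _)
        fun x hx => hμ.le_gam_of_phi_le hl hx.1
    rw [← hμ.Gam_sub, intervalIntegral.integral_const, smul_eq_mul] at h1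
    linarith
  · have h1 : ∫ x in s..t, gam μ ν x ≤ ∫ _x in s..t, l :=
      intervalIntegral.integral_mono_on_of_le_Ioo h (hμ.intervalIntegrable_gam ν _ _) (by simp)
        fun x hx => hμ.gam_le_of_lt_phi hl hx.2
    rw [← hμ.Gam_sub, intervalIntegral.integral_const, smul_eq_mul] at h1
    linarith

end phi

end IsFullOnUnit

/-! ### Consequences of convergence in transport cost -/

theorem exists_coupling_of_cost_lt {ν₁ ν₂ : Measure ℝ} {c : ℝ≥0∞} (h : cost ν₁ ν₂ < c) :
    ∃ π : Measure (ℝ × ℝ), π.map Prod.fst = ν₁ ∧ π.map Prod.snd = ν₂ ∧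
      ∫⁻ z, edist z.1 z.2 ^ 2 ∂π < c := by
  obtain ⟨π, hπ⟩ := iInf_lt_iff.mp h
  obtain ⟨h1, h2⟩ := iInf_lt_iff.mp hπ
  exact ⟨π, h1.1, h1.2, h2⟩

theorem measure_Iic_sub_le_cost (ν₁ ν₂ : Measure ℝ) (x : ℝ) {δ : ℝ} :
    ENNReal.ofReal δ ^ 2 * (ν₁ (Iic x) - ν₂ (Iic (x + δ))) ≤ cost ν₁ ν₂ := by
  refine mul_measure_sub_le_cost measurableSet_Iic measurableSet_Iic fun a ha b hb => ?_
  rw [edist_dist, Real.dist_eq]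
  apply ENNReal.ofReal_le_ofReal
  rw [mem_Iic] at ha
  rw [mem_Iic, not_le] at hb
  rw [abs_sub_comm]
  exact le_trans (by linarith) (le_abs_self _)

section

variable {ι : Type*} {l : Filter ι} {ν : ι → Measure ℝ} {ν₀ : Measure ℝ}

/-- A Chebyshev bound: apart from mass `η`, nothing is transported farther than `δ`. -/
theorem cdf_le_add_of_cost_le {ν₁ ν₂ : Measure ℝ} [IsProbabilityMeasure ν₁]
    [IsProbabilityMeasure ν₂] {δ η : ℝ} (hδ : 0 < δ) (hη : 0 ≤ η)
    (h : cost ν₁ ν₂ ≤ ENNReal.ofReal (δ ^ 2 * η)) (x : ℝ) : cdf ν₁ x ≤ cdf ν₂ (x + δ) + η := by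
  have h1 := (measure_Iic_sub_le_cost ν₁ ν₂ x (δ := δ)).trans h
  rw [← ofReal_cdf, ← ofReal_cdf, ← ENNReal.ofReal_sub _ (cdf_nonneg _ _),
    ← ENNReal.ofReal_pow hδ.le, ← ENNReal.ofReal_mul (by positivity),
    ENNReal.ofReal_le_ofReal_iff (by positivity)] at h1
  have := le_of_mul_le_mul_left h1 (by positivity)
  linarith

theorem tendsto_cdf_of_tendsto_cost [∀ k, IsProbabilityMeasure (ν k)] [IsProbabilityMeasure ν₀]
    (h : Tendsto (fun k => cost (ν k) ν₀) l (𝓝 0)) {x : ℝ} (hx : ContinuousAt (cdf ν₀) x) :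
    Tendsto (fun k => cdf (ν k) x) l (𝓝 (cdf ν₀ x)) := by
  rw [Metric.tendsto_nhds]
  intro ε hε
  obtain ⟨δ, hδ, hδx⟩ := Metric.continuousAt_iff.mp hx (ε / 2) (half_pos hε)
  have hpos : 0 < (δ / 2) ^ 2 * (ε / 4) := by positivity
  filter_upwards [h.eventually_le_const (ENNReal.ofReal_pos.mpr hpos)] with k hk
  have h1 := cdf_le_add_of_cost_le (half_pos hδ) (by positivity) hk x
  rw [cost_comm] at hk
  have h2 := cdf_le_add_of_cost_le (half_pos hδ) (by positivity) hk (x - δ / 2)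
  rw [sub_add_cancel] at h2
  have h3 := hδx (x := x + δ / 2) (by
    rw [Real.dist_eq, add_sub_cancel_left, abs_of_pos (half_pos hδ)]; linarith)
  have h4 := hδx (x := x - δ / 2) (by
    rw [Real.dist_eq, sub_sub_cancel_left, abs_neg, abs_of_pos (half_pos hδ)]; linarith)
  rw [Real.dist_eq, abs_lt] at h3 h4 ⊢
  constructor <;> linarith

/-- Between any two reals there is a point of continuity of a distribution function. -/
theorem exists_continuousAt_cdf (ν : Measure ℝ) {a b : ℝ} (hab : a < b) :
    ∃ x ∈ Ioo a b, ContinuousAt (cdf ν) x := by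
  have h := (monotone_cdf ν).countable_not_continuousAt.dense_compl ℝ
  obtain ⟨x, hx, hxab⟩ := h.exists_between hab
  exact ⟨x, hxab, by simpa using hx⟩

theorem ae_continuousAt_cdf (ν : Measure ℝ) : ∀ᵐ x, ContinuousAt (cdf ν) x := by
  have := (monotone_cdf ν).countable_not_continuousAt.ae_notMem volume
  filter_upwards [this] with x hx
  simpa using hx

variable {μ : Measure ℝ} (hμ : IsFullOnUnit μ)
include hμ

/-- The monotone `φ_{ν₀}` has countably many discontinuities, which the atomless `μ` ignores.
Elsewhere, `φ_{ν₀}(x)` is bracketed by continuity points of `cdf ν₀`, at which the distribution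
functions converge. -/
theorem IsFullOnUnit.tendsto_phi [∀ k, IsProbabilityMeasure (ν k)] [IsProbabilityMeasure ν₀]
    (h : Tendsto (fun k => cost (ν k) ν₀) l (𝓝 0)) :
    ∀ᵐ x ∂μ, Tendsto (fun k => phi μ (ν k) x) l (𝓝 (phi μ ν₀ x)) := by
  have := hμ.noAtoms
  have hc := (hμ.monotoneOn_phi (ν := ν₀)).countable_not_continuousWithinAt.ae_notMem μ
  filter_upwards [hμ.ae_mem_Ioo, hc] with x hx hxc
  have hcont : ContinuousAt (phi μ ν₀) x := by
    have : ContinuousWithinAt (phi μ ν₀) (Ioo 0 1) x := by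
      by_contra hcon; exact hxc ⟨hx, hcon⟩
    exact this.continuousAt (isOpen_Ioo.mem_nhds hx)
  rw [tendsto_order]
  constructor
  · intro a ha
    obtain ⟨y, hy, hyc⟩ := exists_continuousAt_cdf ν₀ ha
    have hleft : ∀ᶠ z in 𝓝[<] x, y < phi μ ν₀ z :=
      (hcont.tendsto.mono_left nhdsWithin_le_nhds).eventually_const_lt hy.2
    have hmem : ∀ᶠ z in 𝓝[<] x, z ∈ Ioo (0 : ℝ) 1 :=
      nhdsWithin_le_nhds (isOpen_Ioo.mem_nhds hx)
    obtain ⟨z, ⟨hyz, hz⟩, hzx⟩ := ((hleft.and hmem).and self_mem_nhdsWithin).exists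
    have h1 : cdf ν₀ y ≤ cdf μ z := le_of_not_gt fun hlt =>
      absurd (hμ.phi_le_of_lt_cdf hz hlt) (not_le.mpr hyz)
    have h2 : cdf ν₀ y < cdf μ x := h1.trans_lt
      (hμ.strictMonoOn_cdf ⟨hz.1.le, hz.2.le⟩ ⟨hx.1.le, hx.2.le⟩ hzx)
    filter_upwards [(tendsto_cdf_of_tendsto_cost h hyc).eventually_lt_const h2] with k hk
    exact hy.1.trans_le (hμ.le_phi_of_cdf_le hx hk.le)
  · intro a ha
    obtain ⟨y, hy, hyc⟩ := exists_continuousAt_cdf ν₀ ha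
    have h2 : cdf μ x < cdf ν₀ y := by
      by_contra hcon
      exact absurd (hμ.le_phi_of_cdf_le hx (not_lt.mp hcon)) (not_le.mpr hy.1)
    filter_upwards [(tendsto_cdf_of_tendsto_cost h hyc).eventually_const_lt h2] with k hk
    exact (hμ.phi_le_of_lt_cdf hx hk).trans_lt hy.2

theorem IsFullOnUnit.tendsto_gam [∀ k, IsProbabilityMeasure (ν k)] [IsProbabilityMeasure ν₀]
    (h : Tendsto (fun k => cost (ν k) ν₀) l (𝓝 0)) {s : ℝ} (hs : ContinuousAt (cdf ν₀) s) :
    Tendsto (fun k => gam μ (ν k) s) l (𝓝 (gam μ ν₀ s)) := by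
  have hc := tendsto_cdf_of_tendsto_cost h hs
  have hg := (hμ.gam_spec ν₀ s).1
  rw [tendsto_order]
  constructor
  · intro a ha
    rcases lt_or_ge a 0 with h0 | h0
    · exact Eventually.of_forall fun k => h0.trans_le (hμ.gam_spec (ν k) s).1.1
    · have ha' : a ∈ Icc (0 : ℝ) 1 := ⟨h0, ha.le.trans hg.2⟩
      filter_upwards [hc.eventually_const_lt ((hμ.lt_gam_iff ha').mp ha)] with k hk
      exact (hμ.lt_gam_iff ha').mpr hk
  · intro a ha
    rcases lt_or_ge 1 a with h0 | h0
    · exact Eventually.of_forall fun k => (hμ.gam_spec (ν k) s).1.2.trans_lt h0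
    · have ha' : a ∈ Icc (0 : ℝ) 1 := ⟨hg.1.trans ha.le, h0⟩
      filter_upwards [hc.eventually_lt_const ((hμ.gam_lt_iff ha').mp ha)] with k hk
      exact (hμ.gam_lt_iff ha').mpr hk

theorem IsFullOnUnit.tendsto_Gam [l.IsCountablyGenerated] [∀ k, IsProbabilityMeasure (ν k)]
    [IsProbabilityMeasure ν₀] (h : Tendsto (fun k => cost (ν k) ν₀) l (𝓝 0)) (s : ℝ) :
    Tendsto (fun k => Gam μ (ν k) s) l (𝓝 (Gam μ ν₀ s)) := by
  refine intervalIntegral.tendsto_integral_filter_of_dominated_convergence (fun _ => 1)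
    (Eventually.of_forall fun k => (hμ.monotone_gam (ν k)).measurable.aestronglyMeasurable)
    (Eventually.of_forall fun k => Eventually.of_forall fun x _ => hμ.abs_gam_le_one (ν k) x)
    intervalIntegrable_const ?_
  filter_upwards [ae_continuousAt_cdf ν₀] with x hx _
  exact hμ.tendsto_gam h hx

omit hμ in
theorem InP2.integrable_id {lam : Measure ℝ} (h : InP2 lam) : Integrable (fun x => x) lam := by
  have := h.1
  have h2 : MemLp (fun x : ℝ => x) 2 lam := by
    refine ⟨measurable_id.aestronglyMeasurable, ?_⟩
    rw [eLpNorm_lt_top_iff_lintegral_rpow_enorm_lt_top (by norm_num) (by norm_num)]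
    simpa using h.2
  exact h2.integrable (by norm_num)

theorem IsFullOnUnit.integrable_Gam {lam : Measure ℝ} (h : InP2 lam) (ν : Measure ℝ) :
    Integrable (Gam μ ν) lam :=
  h.integrable_id.mono (hμ.measurable_Gam ν).aestronglyMeasurable
    (Eventually.of_forall fun s => hμ.abs_Gam_le ν s)

omit hμ in
/-- Means of a `1`-Lipschitz function differ little between measures at a small cost. -/
theorem abs_integral_sub_le_of_cost_lt {ν₁ ν₂ : Measure ℝ} [IsProbabilityMeasure ν₁] {f : ℝ → ℝ}
    (hf : LipschitzWith 1 f) (h₁ : Integrable f ν₁) (h₂ : Integrable f ν₂) {η : ℝ} (hη : 0 < η)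
    (h : cost ν₁ ν₂ < ENNReal.ofReal (η ^ 2)) : |∫ x, f x ∂ν₁ - ∫ x, f x ∂ν₂| ≤ 2 * η := by
  obtain ⟨π, rfl, rfl, hπ⟩ := exists_coupling_of_cost_lt h
  have hprob : π univ = 1 := by
    have := measure_univ (μ := π.map Prod.fst)
    rwa [Measure.map_apply measurable_fst MeasurableSet.univ, preimage_univ] at this
  have hfm : AEStronglyMeasurable f (π.map Prod.fst) := hf.continuous.aestronglyMeasurable
  have hfm' : AEStronglyMeasurable f (π.map Prod.snd) := hf.continuous.aestronglyMeasurable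
  have i₁ : Integrable (fun z => f z.1) π :=
    (integrable_map_measure hfm measurable_fst.aemeasurable).mp h₁
  have i₂ : Integrable (fun z => f z.2) π :=
    (integrable_map_measure hfm' measurable_snd.aemeasurable).mp h₂
  rw [integral_map measurable_fst.aemeasurable hfm, integral_map measurable_snd.aemeasurable hfm',
    ← integral_sub i₁ i₂, ← ENNReal.ofReal_le_ofReal_iff (by positivity), ← Real.norm_eq_abs,
    ofReal_norm]
  have hη' : ENNReal.ofReal η ≠ 0 := (ENNReal.ofReal_pos.mpr hη).ne'
  -- The elementary bound `t ≤ η + t² / η` passes from a quadratic cost to a first-order one.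
  have hpt : ∀ z : ℝ × ℝ, ‖f z.1 - f z.2‖ₑ ≤
      ENNReal.ofReal η + (ENNReal.ofReal η)⁻¹ * edist z.1 z.2 ^ 2 := by
    intro z
    rw [← edist_eq_enorm_sub]
    refine (hf z.1 z.2).trans ?_
    rw [ENNReal.coe_one, one_mul]
    rcases le_total (edist z.1 z.2) (ENNReal.ofReal η) with hle | hle
    · exact hle.trans le_self_add
    · refine le_trans ?_ le_add_self
      calc edist z.1 z.2 = (ENNReal.ofReal η)⁻¹ * ENNReal.ofReal η * edist z.1 z.2 := by
            rw [ENNReal.inv_mul_cancel hη' ENNReal.ofReal_ne_top, one_mul]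
        _ ≤ (ENNReal.ofReal η)⁻¹ * edist z.1 z.2 * edist z.1 z.2 := by gcongr
        _ = _ := by ring
  calc ‖∫ z, f z.1 - f z.2 ∂π‖ₑ ≤ ∫⁻ z, ‖f z.1 - f z.2‖ₑ ∂π := enorm_integral_le_lintegral_enorm _
    _ ≤ ∫⁻ z, ENNReal.ofReal η + (ENNReal.ofReal η)⁻¹ * edist z.1 z.2 ^ 2 ∂π :=
        lintegral_mono hpt
    _ = ENNReal.ofReal η + (ENNReal.ofReal η)⁻¹ * ∫⁻ z, edist z.1 z.2 ^ 2 ∂π := by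
        rw [lintegral_add_left (by fun_prop), lintegral_const, hprob, mul_one,
          lintegral_const_mul _ (by fun_prop)]
    _ ≤ ENNReal.ofReal η + (ENNReal.ofReal η)⁻¹ * ENNReal.ofReal (η ^ 2) := by gcongr
    _ = ENNReal.ofReal (2 * η) := by
        rw [pow_two, ENNReal.ofReal_mul hη.le, ← mul_assoc,
          ENNReal.inv_mul_cancel hη' ENNReal.ofReal_ne_top, one_mul, two_mul,
          ENNReal.ofReal_add hη.le hη.le]

/-- With `lam₀` fixed, dominated convergence applies because `|Γ_ν(s)| ≤ |s|`. Replacing `lam₀` by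
`lam k` costs little uniformly in `ν`, all the `Γ_ν` being `1`-Lipschitz. -/
theorem IsFullOnUnit.tendsto_integral_Gam [l.IsCountablyGenerated] {lam : ι → Measure ℝ}
    {lam₀ : Measure ℝ} (hlam : ∀ k, InP2 (lam k)) (hlam₀ : InP2 lam₀)
    [∀ k, IsProbabilityMeasure (ν k)] [IsProbabilityMeasure ν₀]
    (hl : Tendsto (fun k => cost (lam k) lam₀) l (𝓝 0))
    (h : Tendsto (fun k => cost (ν k) ν₀) l (𝓝 0)) :
    Tendsto (fun k => ∫ s, Gam μ (ν k) s ∂(lam k)) l (𝓝 (∫ s, Gam μ ν₀ s ∂lam₀)) := by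
  have h1 : Tendsto (fun k => ∫ s, Gam μ (ν k) s ∂lam₀) l (𝓝 (∫ s, Gam μ ν₀ s ∂lam₀)) := by
    refine tendsto_integral_filter_of_dominated_convergence (fun s => |s|)
      (Eventually.of_forall fun k => (hμ.measurable_Gam (ν k)).aestronglyMeasurable)
      (Eventually.of_forall fun k => Eventually.of_forall fun s => hμ.abs_Gam_le (ν k) s)
      hlam₀.integrable_id.abs (Eventually.of_forall fun s => hμ.tendsto_Gam h s)
  have h2 : Tendsto (fun k => ∫ s, Gam μ (ν k) s ∂(lam k) - ∫ s, Gam μ (ν k) s ∂lam₀) l (𝓝 0) := by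
    rw [Metric.tendsto_nhds]
    intro ε hε
    have hpos : 0 < (ε / 4) ^ 2 := by positivity
    filter_upwards [hl.eventually_lt_const (ENNReal.ofReal_pos.mpr hpos)] with k hk
    have := (hlam k).1
    have := abs_integral_sub_le_of_cost_lt (hμ.lipschitzWith_Gam (ν k))
      (hμ.integrable_Gam (hlam k) _) (hμ.integrable_Gam hlam₀ _) (by positivity) hk
    rw [Real.dist_eq, sub_zero]
    linarith
  simpa using h2.add h1

end

/-! ### Second moments and convergence in mean square. -/

theorem eLpNorm_two_eq {Ω : Type*} [MeasurableSpace Ω] (P : Measure Ω) (f : Ω → ℝ) :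
    eLpNorm f 2 P = (∫⁻ x, ‖f x‖ₑ ^ 2 ∂P) ^ (1 / 2 : ℝ) := by
  rw [eLpNorm_eq_lintegral_rpow_enorm_toReal (by norm_num) (by norm_num)]
  simp

/-- The `L²` norm is `1`-Lipschitz for `W2`. -/
theorem eLpNorm_id_le_add_W2 (ν₁ ν₂ : Measure ℝ) :
    eLpNorm (fun x => x) 2 ν₁ ≤ eLpNorm (fun x => x) 2 ν₂ + W2 ν₁ ν₂ := by
  rw [← tsub_le_iff_left]
  have h : (eLpNorm (fun x => x) 2 ν₁ - eLpNorm (fun x => x) 2 ν₂) ^ 2 ≤ cost ν₁ ν₂ := by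
    refine le_iInf₂ fun π hπ => ?_
    obtain ⟨rfl, rfl⟩ := hπ
    rw [eLpNorm_map_measure (by fun_prop) (by fun_prop),
      eLpNorm_map_measure (by fun_prop) (by fun_prop)]
    have h1 : eLpNorm ((fun x : ℝ => x) ∘ Prod.fst) 2 π ≤
        eLpNorm ((fun x : ℝ => x) ∘ Prod.snd) 2 π + eLpNorm (fun z : ℝ × ℝ => z.1 - z.2) 2 π := by
      have := eLpNorm_add_le (μ := π) (p := 2) (f := fun z : ℝ × ℝ => z.2)
        (g := fun z : ℝ × ℝ => z.1 - z.2) (by fun_prop) (by fun_prop) (by norm_num)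
      refine le_trans (le_of_eq ?_) this
      congr 1
      funext z
      simp
    rw [← tsub_le_iff_left] at h1
    have h2 : eLpNorm (fun z : ℝ × ℝ => z.1 - z.2) 2 π ^ 2 = ∫⁻ z, edist z.1 z.2 ^ 2 ∂π := by
      rw [eLpNorm_two_eq, ← ENNReal.rpow_natCast, ← ENNReal.rpow_mul]
      simp [edist_eq_enorm_sub]
    rw [← h2]
    gcongr
  rw [W2_eq_cost]
  calc _ = ((eLpNorm (fun x => x) 2 ν₁ - eLpNorm (fun x => x) 2 ν₂) ^ 2) ^ (1 / 2 : ℝ) := by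
        rw [← ENNReal.rpow_natCast, ← ENNReal.rpow_mul]; simp
    _ ≤ _ := by gcongr

/-- Almost everywhere convergence together with an asymptotic bound on the second moments gives
convergence in mean square. -/
theorem tendsto_lintegral_edist_sq {Ω : Type*} [MeasurableSpace Ω] {P : Measure Ω} {φ : ℕ → Ω → ℝ}
    {φ₀ : Ω → ℝ} (hφ : ∀ k, Measurable (φ k)) (hφ₀ : Measurable φ₀)
    (hlim : ∀ᵐ x ∂P, Tendsto (fun k => φ k x) atTop (𝓝 (φ₀ x)))
    (hfin : ∫⁻ x, ‖φ₀ x‖ₑ ^ 2 ∂P ≠ ⊤) {u : ℕ → ℝ≥0∞} (hu : ∀ k, ∫⁻ x, ‖φ k x‖ₑ ^ 2 ∂P ≤ u k)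
    (hulim : Tendsto u atTop (𝓝 (∫⁻ x, ‖φ₀ x‖ₑ ^ 2 ∂P))) :
    Tendsto (fun k => ∫⁻ x, edist (φ k x) (φ₀ x) ^ 2 ∂P) atTop (𝓝 0) := by
  set N := ∫⁻ x, ‖φ₀ x‖ₑ ^ 2 ∂P with hN
  set d : ℕ → Ω → ℝ≥0∞ := fun k x => edist (φ k x) (φ₀ x) ^ 2 with hd
  set G : ℕ → Ω → ℝ≥0∞ := fun k x => 2 * (‖φ k x‖ₑ ^ 2 + ‖φ₀ x‖ₑ ^ 2) with hG
  have hdG : ∀ k x, d k x ≤ G k x := fun k x => edist_sq_le _ _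
  have md : ∀ k, Measurable (d k) := fun k => by
    have := hφ k
    simp only [hd]; fun_prop
  have mG : ∀ k, Measurable (G k) := fun k => by
    have := hφ k
    simp only [hG]; fun_prop
  have hGint : ∀ k, ∫⁻ x, G k x ∂P ≤ 2 * (u k + N) := by
    intro k
    have := hφ k
    simp only [hG]
    rw [lintegral_const_mul _ (by fun_prop), lintegral_add_left (by fun_prop)]
    gcongr
    exact hu k
  -- Fatou's lemma for the nonnegative functions `G k - d k`, whose pointwise limit is `4 ‖φ₀‖²`. As
  -- `∫ G k` is asymptotically at most `4 N`, nothing is left for `∫ d k`.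
  have hfat : 4 * N ≤ liminf (fun k => ∫⁻ x, G k x - d k x ∂P) atTop := by
    refine le_trans (le_of_eq ?_) (lintegral_liminf_le fun k => (mG k).sub (md k))
    rw [hN, ← lintegral_const_mul _ (by fun_prop)]
    refine lintegral_congr_ae ?_
    filter_upwards [hlim] with x hx
    refine (Tendsto.liminf_eq ?_).symm
    have h1 : Tendsto (fun k => G k x) atTop (𝓝 (2 * (‖φ₀ x‖ₑ ^ 2 + ‖φ₀ x‖ₑ ^ 2))) := by
      refine ENNReal.Tendsto.const_mul (Tendsto.add ?_ tendsto_const_nhds) (Or.inr (by simp))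
      exact ((ENNReal.continuous_pow 2).comp continuous_enorm).continuousAt.tendsto.comp hx
    have h2 : Tendsto (fun k => d k x) atTop (𝓝 0) := by
      have := ((ENNReal.continuous_pow 2).tendsto 0).comp (tendsto_iff_edist_tendsto_0.mp hx)
      simpa [Function.comp_def] using this
    have h3 := ENNReal.Tendsto.sub h1 h2 (Or.inr ENNReal.zero_ne_top)
    have h4 : 4 * ‖φ₀ x‖ₑ ^ 2 = 2 * (‖φ₀ x‖ₑ ^ 2 + ‖φ₀ x‖ₑ ^ 2) - 0 := by
      rw [tsub_zero]; ring
    rw [h4]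
    exact h3
  rw [ENNReal.tendsto_nhds_zero]
  intro ε hε
  have hε2 : ε / 2 ≠ 0 := (ENNReal.half_pos hε.ne').ne'
  have h4N : 4 * N ≠ ⊤ := ENNReal.mul_ne_top (by simp) hfin
  have e1 : ∀ᶠ k in atTop, 4 * N - ε / 2 ≤ ∫⁻ x, G k x - d k x ∂P := by
    by_cases h0 : 4 * N = 0
    · exact Eventually.of_forall fun k => by simp [h0]
    · have := eventually_lt_of_lt_liminf ((ENNReal.sub_lt_self h4N h0 hε2).trans_le hfat)
      exact this.mono fun k hk => hk.le
  have e2 : ∀ᶠ k in atTop, 2 * (u k + N) ≤ 4 * N + ε / 2 := by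
    have h1 : Tendsto (fun k => 2 * (u k + N)) atTop (𝓝 (2 * (N + N))) :=
      ENNReal.Tendsto.const_mul (hulim.add tendsto_const_nhds) (Or.inr (by simp))
    have h2 : 2 * (N + N) = 4 * N := by ring
    rw [h2] at h1
    exact (h1.eventually_lt_const (ENNReal.lt_add_right h4N hε2)).mono fun k hk => hk.le
  have e3 : ∀ᶠ k in atTop, u k < ⊤ := hulim.eventually_lt_const hfin.lt_top
  filter_upwards [e1, e2, e3] with k h1 h2 h3
  have hsum : ∫⁻ x, G k x - d k x ∂P + ∫⁻ x, d k x ∂P = ∫⁻ x, G k x ∂P := by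
    rw [← lintegral_add_right _ (md k)]
    exact lintegral_congr fun x => tsub_add_cancel_of_le (hdG k x)
  have hGfin : ∫⁻ x, G k x ∂P ≠ ⊤ := ne_top_of_le_ne_top
    (ENNReal.mul_ne_top (by simp) (ENNReal.add_ne_top.mpr ⟨h3.ne, hfin⟩)) (hGint k)
  have hffin : ∫⁻ x, G k x - d k x ∂P ≠ ⊤ := ne_top_of_le_ne_top hGfin (hsum ▸ le_self_add)
  refine (ENNReal.add_le_add_iff_left hffin).mp ?_
  calc _ = ∫⁻ x, G k x ∂P := hsum
    _ ≤ 4 * N + ε / 2 := (hGint k).trans h2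
    _ ≤ (4 * N - ε / 2 + ε / 2) + ε / 2 := by gcongr; exact le_tsub_add
    _ = (4 * N - ε / 2) + ε := by rw [add_assoc, ENNReal.add_halves]
    _ ≤ _ := by gcongr

/-! ### The operator as a tilted law -/

/-- The density, up to normalization, that `T_lam(ν)` puts on the law of `L`. -/
noncomputable def tilt (μ : Measure ℝ) (H : ℝ → ℝ) (lam ν : Measure ℝ) (l : ℝ) : ℝ :=
  deriv H (l * phi μ ν l - Psi μ lam ν (phi μ ν l))

theorem IsRiskAversion.continuous_deriv {H : ℝ → ℝ} (hH : IsRiskAversion H) :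
    Continuous (deriv H) := hH.contDiff.continuous_deriv (by norm_num)

theorem IsFullOnUnit.measurable_Psi {μ : Measure ℝ} (hμ : IsFullOnUnit μ) (lam ν : Measure ℝ) :
    Measurable (Psi μ lam ν) := (hμ.measurable_Gam ν).sub_const _

theorem IsFullOnUnit.measurable_tilt {μ : Measure ℝ} (hμ : IsFullOnUnit μ) {H : ℝ → ℝ}
    (hH : IsRiskAversion H) (lam ν : Measure ℝ) : Measurable (tilt μ H lam ν) := by
  have h1 := hμ.measurable_phi (ν := ν)
  exact hH.continuous_deriv.measurable.comp
    ((measurable_id.mul h1).sub ((hμ.measurable_Psi lam ν).comp h1))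

section tilt

variable {μ : Measure ℝ} [IsProbabilityMeasure μ] {H : ℝ → ℝ} {lam ν : Measure ℝ}
  [IsProbabilityMeasure ν]

theorem IsRiskAversion.integrable_deriv_comp {H : ℝ → ℝ} (hH : IsRiskAversion H) {Ω : Type*}
    [MeasurableSpace Ω] {P : Measure Ω} [IsFiniteMeasure P] {f : Ω → ℝ} (hf : Measurable f) :
    Integrable (fun x => deriv H (f x)) P := by
  obtain ⟨ε, K, hε, hb⟩ := hH.deriv_bounds
  refine Integrable.of_bound (hH.continuous_deriv.measurable.comp hf).aestronglyMeasurable K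
    (Eventually.of_forall fun x => ?_)
  rw [Real.norm_eq_abs, abs_of_pos (hε.trans (hb _).1)]
  exact (hb _).2.le

theorem IsFullOnUnit.measurable_Y (hμ : IsFullOnUnit μ) (hH : IsRiskAversion H)
    (lam ν : Measure ℝ) : Measurable (Y μ H lam ν) := by
  have h1 : Measurable fun p : ℝ × ℝ => deriv H (p.2 * p.1 - Psi μ lam ν p.1) :=
    hH.continuous_deriv.measurable.comp
      ((measurable_snd.mul measurable_fst).sub ((hμ.measurable_Psi lam ν).comp measurable_fst))
  exact (h1.stronglyMeasurable.integral_condDistrib (Y := Prod.fst) (X := Prod.snd)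
    (μ := joint μ ν)).measurable

/-- Disintegrating the law of `(L, φ_ν(L))` over its second marginal `ν` exchanges the conditional
expectation `Y` for an explicit function of `L` under `μ`. -/
theorem lintegral_mul_ofReal_Y (hμ : IsFullOnUnit μ) (hH : IsRiskAversion H) {f : ℝ → ℝ≥0∞}
    (hf : Measurable f) : ∫⁻ s, f s * ENNReal.ofReal (Y μ H lam ν s) ∂ν =
      ∫⁻ l, f (phi μ ν l) * ENNReal.ofReal (tilt μ H lam ν l) ∂μ := by
  obtain ⟨ε, K, hε, hb⟩ := hH.deriv_bounds
  have hφ := hμ.measurable_phi (ν := ν)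
  have hd := hH.continuous_deriv.measurable
  have hP := hμ.measurable_Psi lam ν
  have hpair : Measurable fun l => (l, phi μ ν l) := measurable_id.prodMk hφ
  have hsnd : (joint μ ν).map Prod.snd = ν := by
    rw [joint, Measure.map_map measurable_snd hpair]
    exact hμ.map_phi
  have hY : ∀ s, ENNReal.ofReal (Y μ H lam ν s) = ∫⁻ l, ENNReal.ofReal
      (deriv H (l * s - Psi μ lam ν s)) ∂(condDistrib Prod.fst Prod.snd (joint μ ν) s) := by
    intro s
    exact ofReal_integral_eq_lintegral_ofReal
      (hH.integrable_deriv_comp ((measurable_id.mul_const s).sub_const _))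
      (Eventually.of_forall fun l => (hε.trans (hb _).1).le)
  have hm : Measurable fun p : ℝ × ℝ => f p.1 * ENNReal.ofReal
      (deriv H (p.2 * p.1 - Psi μ lam ν p.1)) :=
    (hf.comp measurable_fst).mul (hd.comp
      ((measurable_snd.mul measurable_fst).sub (hP.comp measurable_fst))).ennreal_ofReal
  have hdis := compProd_map_condDistrib (mβ := Real.measurableSpace) (X := Prod.snd) (Y := Prod.fst) (μ := joint μ ν)
    (measurable_fst.aemeasurable)
  rw [hsnd] at hdis
  calc ∫⁻ s, f s * ENNReal.ofReal (Y μ H lam ν s) ∂ν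
      = ∫⁻ s, ∫⁻ l, f s * ENNReal.ofReal (deriv H (l * s - Psi μ lam ν s))
          ∂(condDistrib Prod.fst Prod.snd (joint μ ν) s) ∂ν := by
        refine lintegral_congr fun s => ?_
        rw [hY, lintegral_const_mul]
        exact (hd.comp ((measurable_id.mul_const s).sub_const _)).ennreal_ofReal
    _ = ∫⁻ p, f p.1 * ENNReal.ofReal (deriv H (p.2 * p.1 - Psi μ lam ν p.1))
          ∂(ν ⊗ₘ condDistrib Prod.fst Prod.snd (joint μ ν)) := by
        rw [Measure.lintegral_compProd hm]
    _ = _ := by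
        rw [hdis, joint, Measure.map_map (by fun_prop) hpair, lintegral_map hm (by fun_prop)]
        rfl

theorem integral_Y (hμ : IsFullOnUnit μ) (hH : IsRiskAversion H) :
    ∫ s, Y μ H lam ν s ∂ν = ∫ l, tilt μ H lam ν l ∂μ := by
  obtain ⟨ε, K, hε, hb⟩ := hH.deriv_bounds
  rw [integral_eq_lintegral_of_nonneg_ae, integral_eq_lintegral_of_nonneg_ae]
  · have := lintegral_mul_ofReal_Y (lam := lam) (ν := ν) hμ hH (f := fun _ => 1) measurable_const
    simp only [one_mul] at this
    rw [this]
  · exact Eventually.of_forall fun l => (hε.trans (hb _).1).le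
  · exact (hμ.measurable_tilt hH lam ν).aestronglyMeasurable
  · exact Eventually.of_forall fun s => integral_nonneg fun l => (hε.trans (hb _).1).le
  · exact (hμ.measurable_Y hH lam ν).aestronglyMeasurable

theorem IsFullOnUnit.integrable_tilt (hμ : IsFullOnUnit μ) (hH : IsRiskAversion H)
    (lam ν : Measure ℝ) : Integrable (tilt μ H lam ν) μ := by
  have h1 := hμ.measurable_phi (ν := ν)
  exact hH.integrable_deriv_comp
    ((measurable_id.mul h1).sub ((hμ.measurable_Psi lam ν).comp h1))

/-- The normalized density of the law of `L` behind `T_lam(ν)`. -/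
noncomputable def normTilt (μ : Measure ℝ) (H : ℝ → ℝ) (lam ν : Measure ℝ) (l : ℝ) : ℝ≥0∞ :=
  ENNReal.ofReal ((∫ x, tilt μ H lam ν x ∂μ)⁻¹ * tilt μ H lam ν l)

omit [IsProbabilityMeasure μ] in
theorem IsFullOnUnit.measurable_normTilt (hμ : IsFullOnUnit μ) (hH : IsRiskAversion H)
    (lam ν : Measure ℝ) : Measurable (normTilt μ H lam ν) :=
  ((hμ.measurable_tilt hH lam ν).const_mul _).ennreal_ofReal

/-- This removes the conditional expectation from the operator and places all the measures
`T_lam(ν)` over the same space, where couplings are easy to build. -/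
theorem opT_eq_map (hμ : IsFullOnUnit μ) (hH : IsRiskAversion H) :
    opT μ H lam ν = (μ.withDensity (normTilt μ H lam ν)).map (phi μ ν) := by
  obtain ⟨ε, K, hε, hb⟩ := hH.deriv_bounds
  have hφ := hμ.measurable_phi (ν := ν)
  have hc : 0 ≤ (∫ x, tilt μ H lam ν x ∂μ)⁻¹ :=
    inv_nonneg.mpr (integral_nonneg fun l => (hε.trans (hb _).1).le)
  ext A hA
  rw [opT, withDensity_apply _ hA, ← lintegral_indicator hA, Measure.map_apply hφ hA,
    withDensity_apply _ (hφ hA), ← lintegral_indicator (hφ hA), integral_Y hμ hH]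
  have hf : Measurable (A.indicator fun _ => ENNReal.ofReal (∫ x, tilt μ H lam ν x ∂μ)⁻¹) :=
    measurable_const.indicator hA
  refine Eq.trans (lintegral_congr fun s => ?_) ((lintegral_mul_ofReal_Y (lam := lam) (ν := ν)
    hμ hH hf).trans (lintegral_congr fun l => ?_))
  · by_cases hs : s ∈ A
    · rw [indicator_of_mem hs, indicator_of_mem hs, ENNReal.ofReal_mul hc]
    · rw [indicator_of_notMem hs, indicator_of_notMem hs, zero_mul]
  · by_cases hs : phi μ ν l ∈ A
    · rw [indicator_of_mem hs, indicator_of_mem (by exact hs), normTilt, ENNReal.ofReal_mul hc]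
    · rw [indicator_of_notMem hs, indicator_of_notMem (by exact hs), zero_mul]

omit [IsProbabilityMeasure ν] in
theorem le_integral_tilt (hμ : IsFullOnUnit μ) (hH : IsRiskAversion H) {ε : ℝ}
    (hb : ∀ x, ε < deriv H x) : ε ≤ ∫ x, tilt μ H lam ν x ∂μ := by
  have h := integral_mono (μ := μ) (integrable_const ε) (hμ.integrable_tilt hH lam ν)
    fun l => (hb _).le
  simpa using h

omit [IsProbabilityMeasure ν] in
theorem lintegral_normTilt (hμ : IsFullOnUnit μ) (hH : IsRiskAversion H) :
    ∫⁻ l, normTilt μ H lam ν l ∂μ = 1 := by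
  obtain ⟨ε, K, hε, hb⟩ := hH.deriv_bounds
  have hpos : 0 < ∫ x, tilt μ H lam ν x ∂μ :=
    hε.trans_le (le_integral_tilt hμ hH fun x => (hb x).1)
  simp only [normTilt]
  rw [← ofReal_integral_eq_lintegral_ofReal ((hμ.integrable_tilt hH lam ν).const_mul _)
    (Eventually.of_forall fun l => mul_nonneg (inv_nonneg.mpr hpos.le) (hε.trans (hb _).1).le),
    integral_const_mul, inv_mul_cancel₀ hpos.ne', ENNReal.ofReal_one]

omit [IsProbabilityMeasure ν] in
-- The bound `K / ε` does not depend on `lam` or `ν`, so it serves as a common majorant in the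
-- limits.
theorem normTilt_le (hμ : IsFullOnUnit μ) (hH : IsRiskAversion H) {ε K : ℝ} (hε : 0 < ε)
    (hb : ∀ x, ε < deriv H x ∧ deriv H x < K) (l : ℝ) :
    normTilt μ H lam ν l ≤ ENNReal.ofReal (ε⁻¹ * K) := by
  apply ENNReal.ofReal_le_ofReal
  have h := le_integral_tilt (lam := lam) (ν := ν) hμ hH fun x => (hb x).1
  have hK : 0 < K := hε.trans ((hb 0).1.trans (hb 0).2)
  exact mul_le_mul (inv_anti₀ hε h) (hb _).2.le (hε.trans (hb _).1).le (by positivity)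

omit [IsProbabilityMeasure μ] in
theorem lintegral_phi_sq (hμ : IsFullOnUnit μ) :
    ∫⁻ l, ‖phi μ ν l‖ₑ ^ 2 ∂μ = ∫⁻ x, ‖x‖ₑ ^ 2 ∂ν := by
  conv_rhs => rw [← hμ.map_phi (ν := ν)]
  rw [lintegral_map (by fun_prop) hμ.measurable_phi]

theorem inP2_opT (hμ : IsFullOnUnit μ) (hH : IsRiskAversion H) (hν : InP2 ν) :
    InP2 (opT μ H lam ν) := by
  obtain ⟨ε, K, hε, hb⟩ := hH.deriv_bounds
  have hφ := hμ.measurable_phi (ν := ν)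
  have hm := hμ.measurable_normTilt hH lam ν
  rw [opT_eq_map hμ hH]
  constructor
  · constructor
    rw [Measure.map_apply hφ MeasurableSet.univ, preimage_univ,
      withDensity_apply _ MeasurableSet.univ, Measure.restrict_univ, lintegral_normTilt hμ hH]
  · rw [lintegral_map (by fun_prop) hφ, lintegral_withDensity_eq_lintegral_mul _ hm (by fun_prop)]
    calc ∫⁻ l, normTilt μ H lam ν l * ‖phi μ ν l‖ₑ ^ 2 ∂μ
        ≤ ∫⁻ l, ENNReal.ofReal (ε⁻¹ * K) * ‖phi μ ν l‖ₑ ^ 2 ∂μ := by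
          gcongr with l; exact normTilt_le hμ hH hε hb l
      _ = ENNReal.ofReal (ε⁻¹ * K) * ∫⁻ x, ‖x‖ₑ ^ 2 ∂ν := by
          rw [lintegral_const_mul _ (by fun_prop), lintegral_phi_sq hμ]
      _ < ⊤ := ENNReal.mul_lt_top ENNReal.ofReal_lt_top hν.2

end tilt

/-! ### Continuity of the operator -/

section

variable {μ : Measure ℝ} [IsProbabilityMeasure μ] {H : ℝ → ℝ}

omit [IsProbabilityMeasure μ] in
theorem tendsto_lintegral_edist_phi_sq (hμ : IsFullOnUnit μ) {ν : ℕ → Measure ℝ} {ν₀ : Measure ℝ}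
    (hν : ∀ k, InP2 (ν k)) (hν₀ : InP2 ν₀) (h : Tendsto (fun k => cost (ν k) ν₀) atTop (𝓝 0)) :
    Tendsto (fun k => ∫⁻ l, edist (phi μ (ν k) l) (phi μ ν₀ l) ^ 2 ∂μ) atTop (𝓝 0) := by
  have := fun k => (hν k).1
  have := hν₀.1
  have hsq : ∀ ν' : Measure ℝ, eLpNorm (fun x => x) 2 ν' ^ 2 = ∫⁻ x, ‖x‖ₑ ^ 2 ∂ν' := by
    intro ν'
    rw [eLpNorm_two_eq, ← ENNReal.rpow_natCast, ← ENNReal.rpow_mul]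
    simp
  refine tendsto_lintegral_edist_sq (fun k => hμ.measurable_phi) hμ.measurable_phi
    (hμ.tendsto_phi h) ?_ (u := fun k => (eLpNorm (fun x => x) 2 ν₀ + W2 (ν k) ν₀) ^ 2) ?_ ?_
  · rw [lintegral_phi_sq hμ]; exact hν₀.2.ne
  · intro k
    rw [lintegral_phi_sq hμ, ← hsq]
    gcongr
    exact eLpNorm_id_le_add_W2 _ _
  · rw [lintegral_phi_sq hμ, ← hsq]
    have h1 := (tendsto_const_nhds (x := eLpNorm (fun x => x) 2 ν₀)).add (tendsto_W2_iff.mpr h)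
    rw [add_zero] at h1
    exact ((ENNReal.continuous_pow 2).tendsto _).comp h1

theorem tendsto_normTilt (hμ : IsFullOnUnit μ) (hH : IsRiskAversion H) {lam ν : ℕ → Measure ℝ}
    {lam₀ ν₀ : Measure ℝ} (hlam : ∀ k, InP2 (lam k)) (hlam₀ : InP2 lam₀) (hν : ∀ k, InP2 (ν k))
    (hν₀ : InP2 ν₀) (hl : Tendsto (fun k => cost (lam k) lam₀) atTop (𝓝 0))
    (h : Tendsto (fun k => cost (ν k) ν₀) atTop (𝓝 0)) :
    ∀ᵐ x ∂μ, Tendsto (fun k => normTilt μ H (lam k) (ν k) x) atTop (𝓝 (normTilt μ H lam₀ ν₀ x)) := by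
  have := fun k => (hν k).1
  have := hν₀.1
  obtain ⟨ε, K, hε, hb⟩ := hH.deriv_bounds
  have hint := hμ.tendsto_integral_Gam hlam hlam₀ hl h
  have htilt : ∀ᵐ x ∂μ, Tendsto (fun k => tilt μ H (lam k) (ν k) x) atTop
      (𝓝 (tilt μ H lam₀ ν₀ x)) := by
    filter_upwards [hμ.tendsto_phi h] with x hx
    have hG : Tendsto (fun k => Gam μ (ν k) (phi μ (ν k) x)) atTop
        (𝓝 (Gam μ ν₀ (phi μ ν₀ x))) := by
      -- The common Lipschitz constant lets pointwise convergence of `Γ` be evaluated at a moving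
      -- point.
      have h1 : Tendsto (fun k => Gam μ (ν k) (phi μ (ν k) x) - Gam μ (ν k) (phi μ ν₀ x)) atTop
          (𝓝 0) := by
        refine squeeze_zero_norm (fun k => hμ.abs_Gam_sub_le (ν k) _ _) ?_
        have := (hx.sub_const (phi μ ν₀ x)).abs
        simpa using this
      simpa using h1.add (hμ.tendsto_Gam h (phi μ ν₀ x))
    exact (hH.continuous_deriv.tendsto _).comp ((hx.const_mul x).sub (hG.sub hint))
  have hc : Tendsto (fun k => ∫ x, tilt μ H (lam k) (ν k) x ∂μ) atTop
      (𝓝 (∫ x, tilt μ H lam₀ ν₀ x ∂μ)) := by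
    refine tendsto_integral_of_dominated_convergence (fun _ => K)
      (fun k => (hμ.measurable_tilt hH _ _).aestronglyMeasurable) (integrable_const K)
      (fun k => Eventually.of_forall fun x => ?_) htilt
    rw [Real.norm_eq_abs, tilt, abs_of_pos (hε.trans (hb _).1)]
    exact (hb _).2.le
  have hpos : 0 < ∫ x, tilt μ H lam₀ ν₀ x ∂μ :=
    hε.trans_le (le_integral_tilt hμ hH fun x => (hb x).1)
  filter_upwards [htilt] with x hx
  exact (ENNReal.continuous_ofReal.tendsto _).comp ((hc.inv₀ hpos.ne').mul hx)

/-- The operator `(lam, ν) ↦ T_lam(ν)` is jointly continuous. -/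
theorem tendsto_cost_opT (hμ : IsFullOnUnit μ) (hH : IsRiskAversion H) {lam ν : ℕ → Measure ℝ}
    {lam₀ ν₀ : Measure ℝ} (hlam : ∀ k, InP2 (lam k)) (hlam₀ : InP2 lam₀) (hν : ∀ k, InP2 (ν k))
    (hν₀ : InP2 ν₀) (hl : Tendsto (fun k => cost (lam k) lam₀) atTop (𝓝 0))
    (h : Tendsto (fun k => cost (ν k) ν₀) atTop (𝓝 0)) :
    Tendsto (fun k => cost (opT μ H (lam k) (ν k)) (opT μ H lam₀ ν₀)) atTop (𝓝 0) := by
  have := fun k => (hν k).1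
  have := hν₀.1
  obtain ⟨ε, K, hε, hb⟩ := hH.deriv_bounds
  set M := ENNReal.ofReal (ε⁻¹ * K) with hM
  set g : ℕ → ℝ → ℝ≥0∞ := fun k => normTilt μ H (lam k) (ν k) with hg
  set g₀ : ℝ → ℝ≥0∞ := normTilt μ H lam₀ ν₀ with hg₀
  set φ : ℕ → ℝ → ℝ := fun k => phi μ (ν k) with hφ
  set φ₀ : ℝ → ℝ := phi μ ν₀ with hφ₀
  have mg : ∀ k, Measurable (g k) := fun k => hμ.measurable_normTilt hH _ _
  have mg₀ : Measurable g₀ := hμ.measurable_normTilt hH _ _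
  have mφ : ∀ k, Measurable (φ k) := fun k => hμ.measurable_phi
  have mφ₀ : Measurable φ₀ := hμ.measurable_phi
  have hgM : ∀ k x, g k x ≤ M := fun k x => normTilt_le hμ hH hε hb x
  have hg₀M : ∀ x, g₀ x ≤ M := fun x => normTilt_le hμ hH hε hb x
  have hlim := tendsto_normTilt hμ hH hlam hlam₀ hν hν₀ hl h
  have hdist := tendsto_lintegral_edist_phi_sq hμ hν hν₀ h
  have hfin : ∫⁻ x, M * ‖φ₀ x‖ₑ ^ 2 ∂μ ≠ ⊤ := by
    rw [lintegral_const_mul _ (by fun_prop), lintegral_phi_sq hμ]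
    exact ENNReal.mul_ne_top ENNReal.ofReal_ne_top hν₀.2.ne
  have hgt : ∀ x, g₀ x ≠ ⊤ := fun x => ENNReal.ofReal_ne_top
  have h1 : Tendsto (fun k => ∫⁻ x, (g k x - g₀ x) * ‖φ₀ x‖ₑ ^ 2 ∂μ) atTop (𝓝 0) := by
    have := tendsto_lintegral_of_dominated_convergence (μ := μ)
      (F := fun k x => (g k x - g₀ x) * ‖φ₀ x‖ₑ ^ 2) (f := fun _ => 0)
      (fun x => M * ‖φ₀ x‖ₑ ^ 2) (fun k => ((mg k).sub mg₀).mul (by fun_prop))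
      (fun k => Eventually.of_forall fun x => by
        dsimp only; gcongr; exact tsub_le_self.trans (hgM k x)) hfin
      (by
        filter_upwards [hlim] with x hx
        have h2 := ENNReal.Tendsto.sub hx (tendsto_const_nhds (x := g₀ x)) (Or.inl (hgt x))
        rw [tsub_self] at h2
        have h3 := ENNReal.Tendsto.mul_const (b := ‖φ₀ x‖ₑ ^ 2) h2
          (Or.inr (ENNReal.pow_ne_top enorm_ne_top))
        rwa [zero_mul] at h3)
    simpa using this
  have h2 : Tendsto (fun k => ∫⁻ x, (g₀ x - g k x) * ‖φ₀ x‖ₑ ^ 2 ∂μ) atTop (𝓝 0) := by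
    have := tendsto_lintegral_of_dominated_convergence (μ := μ)
      (F := fun k x => (g₀ x - g k x) * ‖φ₀ x‖ₑ ^ 2) (f := fun _ => 0)
      (fun x => M * ‖φ₀ x‖ₑ ^ 2) (fun k => (mg₀.sub (mg k)).mul (by fun_prop))
      (fun k => Eventually.of_forall fun x => by
        dsimp only; gcongr; exact tsub_le_self.trans (hg₀M x)) hfin
      (by
        filter_upwards [hlim] with x hx
        have h2 := ENNReal.Tendsto.sub (tendsto_const_nhds (x := g₀ x)) hx (Or.inl (hgt x))
        rw [tsub_self] at h2
        have h3 := ENNReal.Tendsto.mul_const (b := ‖φ₀ x‖ₑ ^ 2) h2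
          (Or.inr (ENNReal.pow_ne_top enorm_ne_top))
        rwa [zero_mul] at h3)
    simpa using this
  -- The excess term with `‖φ k x‖²` is bounded through `2 (|φ k - φ₀|² + |φ₀|²)`, so every
  -- remaining integral is either the mean-square distance or dominated by a multiple of `|φ₀|²`.
  have hbound : ∀ k, cost (opT μ H (lam k) (ν k)) (opT μ H lam₀ ν₀) ≤
      M * ∫⁻ x, edist (φ k x) (φ₀ x) ^ 2 ∂μ +
        (2 * (2 * (M * ∫⁻ x, edist (φ k x) (φ₀ x) ^ 2 ∂μ +
          ∫⁻ x, (g k x - g₀ x) * ‖φ₀ x‖ₑ ^ 2 ∂μ)) +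
          2 * ∫⁻ x, (g₀ x - g k x) * ‖φ₀ x‖ₑ ^ 2 ∂μ) := by
    intro k
    have mk := mφ k
    have mgk := mg k
    rw [opT_eq_map hμ hH, opT_eq_map hμ hH]
    refine (cost_map_withDensity_le μ (mg k) mg₀ (lintegral_normTilt hμ hH)
      (lintegral_normTilt hμ hH) (mφ k) mφ₀).trans ?_
    have hM1 : ∫⁻ x, g k x * edist (φ k x) (φ₀ x) ^ 2 ∂μ ≤
        M * ∫⁻ x, edist (φ k x) (φ₀ x) ^ 2 ∂μ := by
      rw [← lintegral_const_mul _ (by fun_prop)]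
      gcongr with x
      exact hgM k x
    have hM2 : ∫⁻ x, (g k x - g₀ x) * ‖φ k x‖ₑ ^ 2 ∂μ ≤
        2 * (M * ∫⁻ x, edist (φ k x) (φ₀ x) ^ 2 ∂μ +
          ∫⁻ x, (g k x - g₀ x) * ‖φ₀ x‖ₑ ^ 2 ∂μ) := by
      rw [← lintegral_const_mul _ (by fun_prop), ← lintegral_add_left (by fun_prop),
        ← lintegral_const_mul _ (by fun_prop)]
      refine lintegral_mono fun x => ?_
      have hx : ‖φ k x‖ₑ ^ 2 ≤ 2 * (edist (φ k x) (φ₀ x) ^ 2 + ‖φ₀ x‖ₑ ^ 2) := by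
        have := edist_sq_le (φ k x - φ₀ x) (-φ₀ x)
        rw [edist_eq_enorm_sub, sub_neg_eq_add, sub_add_cancel, ← edist_eq_enorm_sub,
          enorm_neg] at this
        exact this
      calc (g k x - g₀ x) * ‖φ k x‖ₑ ^ 2
          ≤ (g k x - g₀ x) * (2 * (edist (φ k x) (φ₀ x) ^ 2 + ‖φ₀ x‖ₑ ^ 2)) := by gcongr
        _ = 2 * ((g k x - g₀ x) * edist (φ k x) (φ₀ x) ^ 2 + (g k x - g₀ x) * ‖φ₀ x‖ₑ ^ 2) := by
            ring
        _ ≤ _ := by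
            gcongr
            exact tsub_le_self.trans (hgM k x)
    gcongr
  have hMd := ENNReal.Tendsto.const_mul (a := M) hdist (Or.inr ENNReal.ofReal_ne_top)
  rw [mul_zero] at hMd
  have htot := hMd.add ((ENNReal.Tendsto.const_mul (a := 2) (ENNReal.Tendsto.const_mul (a := 2)
    (hMd.add h1) (Or.inr (by simp))) (Or.inr (by simp))).add
    (ENNReal.Tendsto.const_mul (a := 2) h2 (Or.inr (by simp))))
  simp only [add_zero, mul_zero] at htot
  exact tendsto_of_tendsto_of_tendsto_of_le_of_le tendsto_const_nhds htot (fun _ => zero_le) hbound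

/-! ### The operator on finitely supported measures -/

theorem FinSupp.inP2 (ν : FinSupp) : InP2 ν.1 := by
  obtain ⟨ν, hν, s, hs⟩ := ν
  refine ⟨hν, ?_⟩
  change ∫⁻ x, ‖x‖ₑ ^ 2 ∂ν < ⊤
  have h : ∀ᵐ x ∂ν, ‖x‖ₑ ^ 2 ≤ s.sup fun a => ‖a‖ₑ ^ 2 := by
    have : ∀ᵐ x ∂ν, x ∈ (s : Set ℝ) := by rw [ae_iff]; exact hs
    filter_upwards [this] with x hx
    exact Finset.le_sup (f := fun a : ℝ => ‖a‖ₑ ^ 2) hx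
  calc ∫⁻ x, ‖x‖ₑ ^ 2 ∂ν ≤ ∫⁻ _x, (s.sup fun a => ‖a‖ₑ ^ 2) ∂ν := lintegral_mono_ae h
    _ = s.sup fun a => ‖a‖ₑ ^ 2 := by rw [lintegral_const, measure_univ, mul_one]
    _ < ⊤ := (Finset.sup_lt_iff (by simp)).mpr fun a _ => ENNReal.pow_lt_top enorm_lt_top

/-- The law of `S_n`, as a finitely supported measure. -/
noncomputable def lamBarFinSupp (n : ℕ) : FinSupp :=
  ⟨lamBar n, Measure.isProbabilityMeasure_map (measurable_of_finite _).aemeasurable,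
    Finset.univ.image fun ω : Fin n → Bool => (1 / √(n : ℝ)) * ∑ q, sgn (ω q), by
      rw [lamBar, Measure.map_apply (measurable_of_finite _) (Finset.measurableSet _).compl]
      refine measure_mono_null (t := ∅) (fun ω hω => ?_) measure_empty
      simp at hω⟩

theorem opT_absolutelyContinuous (lam ν : Measure ℝ) : opT μ H lam ν ≪ ν :=
  withDensity_absolutelyContinuous _ _

/-- The restriction of `T_lam` to the finitely supported measures. -/
noncomputable def opTFinSupp (hμ : IsFullOnUnit μ) (hH : IsRiskAversion H) (lam : Measure ℝ)
    (ν : FinSupp) : FinSupp :=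
  ⟨opT μ H lam ν.1, (have := ν.2.1; inP2_opT hμ hH ν.inP2).1,
    ν.2.2.imp fun _ hs => opT_absolutelyContinuous lam ν.1 hs⟩

theorem W2Continuous_opTFinSupp (hμ : IsFullOnUnit μ) (hH : IsRiskAversion H) {lam : Measure ℝ}
    (hlam : InP2 lam) : W2Continuous (opTFinSupp hμ hH lam) := by
  intro ν ε hε
  by_contra hcon
  push Not at hcon
  have hδ : ∀ k : ℕ, 0 < ((k : ℝ≥0∞) + 1)⁻¹ := fun k => by simp
  choose x hx hxε using fun k : ℕ => hcon _ (hδ k)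
  have hlim : Tendsto (fun k => W2 (x k).1 ν.1) atTop (𝓝 0) := by
    have h0 : Tendsto (fun k : ℕ => ((k : ℝ≥0∞) + 1)⁻¹) atTop (𝓝 0) := by
      have := (tendsto_add_atTop_iff_nat 1).mpr ENNReal.tendsto_inv_nat_nhds_zero
      simpa using this
    exact tendsto_of_tendsto_of_tendsto_of_le_of_le tendsto_const_nhds h0 (fun _ => zero_le)
      fun k => (hx k).le
  have hself : cost lam lam = 0 := by
    refine le_antisymm ((cost_le (π := lam.map fun x => (x, x)) ?_ ?_).trans ?_) zero_le
    · rw [Measure.map_map measurable_fst (by fun_prop)]; exact Measure.map_id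
    · rw [Measure.map_map measurable_snd (by fun_prop)]; exact Measure.map_id
    · rw [lintegral_map (by fun_prop) (by fun_prop)]; simp
  have h := tendsto_W2_iff.mpr (tendsto_cost_opT hμ hH (lam := fun _ => lam) (lam₀ := lam)
    (fun _ => hlam) hlam (fun k => (x k).inP2) ν.inP2 (by simp [hself]) (tendsto_W2_iff.mp hlim))
  obtain ⟨k, hk⟩ := (h.eventually_lt_const hε).exists
  exact absurd hk (not_lt.mpr (hxε k))

end

/-! ### Histories and price paths -/

/-- The tuple `x` followed by `a`. -/
abbrev snocTuple {α : Type*} {q : ℕ} (x : Fin q → α) (a : α) : Fin (q + 1) → α :=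
  Fin.snoc (α := fun _ => α) x a

/-- The tuple without its last entry. -/
abbrev initTuple {α : Type*} {q : ℕ} (x : Fin (q + 1) → α) : Fin q → α :=
  Fin.init (α := fun _ => α) x

theorem measurable_snocTuple {α : Type*} [MeasurableSpace α] (q : ℕ) :
    Measurable fun z : (Fin q → α) × α => snocTuple z.1 z.2 := by
  refine measurable_pi_lambda _ fun i => ?_
  refine Fin.lastCases ?_ (fun j => ?_) i
  · simpa [snocTuple] using measurable_snd
  · simp only [snocTuple, Fin.snoc_castSucc]
    exact (measurable_pi_apply j).comp measurable_fst

theorem sum_snocTuple {M : Type*} [AddCommMonoid M] {q : ℕ} (f : (Fin (q + 1) → Bool) → M) :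
    ∑ u, f u = ∑ u, (f (snocTuple u true) + f (snocTuple u false)) := by
  rw [← (Fin.snocEquiv fun _ => Bool).sum_comp, Fintype.sum_prod_type, Fintype.sum_bool,
    ← Finset.sum_add_distrib]
  rfl

/-- The history with actions `u` and prices `p`. -/
def histOf {q : ℕ} (u : Fin q → Bool) (p : Fin q → ℝ) : Hist q := fun i => (u i, p i)

theorem measurable_histOf {q : ℕ} (u : Fin q → Bool) : Measurable (histOf u) :=
  measurable_pi_lambda _ fun i => measurable_const.prodMk (measurable_pi_apply i)

theorem snoc_histOf {q : ℕ} (u : Fin q → Bool) (p : Fin q → ℝ) (b : Bool) (x : ℝ) :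
    (Fin.snoc (histOf u p) (b, x) : Hist (q + 1)) = histOf (snocTuple u b) (snocTuple p x) := by
  funext i
  refine Fin.lastCases ?_ (fun j => ?_) i
  · simp [histOf]
  · simp [histOf]

/-- The prices along the actions `u` when the price after the actions `v` is `p q v`. -/
def priceVec (p : ∀ q, (Fin q → Bool) → ℝ) : (q : ℕ) → (Fin q → Bool) → Fin q → ℝ
  | 0, _ => Fin.elim0
  | q + 1, u => snocTuple (priceVec p q (initTuple u)) (p q (initTuple u))

theorem priceVec_snoc (p : ∀ q, (Fin q → Bool) → ℝ) (q : ℕ) (u : Fin q → Bool) (b : Bool) :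
    priceVec p (q + 1) (snocTuple u b) = snocTuple (priceVec p q u) (p q u) := by
  simp [priceVec]

theorem priceVec_congr {p p' : ∀ q, (Fin q → Bool) → ℝ} {q : ℕ} (h : ∀ k < q, p k = p' k) :
    priceVec p q = priceVec p' q := by
  induction q with
  | zero => funext u i; exact i.elim0
  | succ q ih =>
    funext u
    simp only [priceVec]
    rw [ih fun k hk => h k (hk.trans (Nat.lt_succ_self q)), h q (Nat.lt_succ_self q)]

/-- The total paid by player 1 along the actions `u`. -/
noncomputable def transfer {q : ℕ} (u : Fin q → Bool) (p : Fin q → ℝ) : ℝ := ∑ i, sgn (u i) * p i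

theorem transfer_snoc {q : ℕ} (u : Fin q → Bool) (p : Fin q → ℝ) (b : Bool) (x : ℝ) :
    transfer (snocTuple u b) (snocTuple p x) = transfer u p + sgn b * x := by
  simp [transfer, Fin.sum_univ_castSucc]

theorem sgn_true : sgn true = 1 := rfl

theorem sgn_false : sgn false = -1 := rfl

/-- The last price is quoted before the last action, so it is paid on one continuation and received
on the other. -/
theorem sum_transfer_priceVec (p : ∀ q, (Fin q → Bool) → ℝ) (q : ℕ) :
    ∑ u, transfer u (priceVec p q u) = 0 := by
  induction q with
  | zero => simp [transfer]
  | succ q ih =>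
    rw [sum_snocTuple]
    simp only [priceVec_snoc, transfer_snoc, sgn_true, sgn_false]
    have : ∀ u : Fin q → Bool, transfer u (priceVec p q u) + 1 * p q u +
        (transfer u (priceVec p q u) + -1 * p q u) = 2 * transfer u (priceVec p q u) :=
      fun u => by ring
    simp only [this, ← Finset.mul_sum, ih, mul_zero]

/-- Every function of zero sum on the cube is the total transfer of a system of prices. -/
theorem exists_transfer_eq {q : ℕ} (V : (Fin q → Bool) → ℝ) (hV : ∑ u, V u = 0) :
    ∃ p : ∀ q, (Fin q → Bool) → ℝ, ∀ u, transfer u (priceVec p q u) = V u := by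
  induction q with
  | zero =>
    refine ⟨fun _ _ => 0, fun u => ?_⟩
    rw [Fintype.sum_subsingleton _ u] at hV
    rw [hV]; simp [transfer]
  | succ q ih =>
    rw [sum_snocTuple] at hV
    obtain ⟨p, hp⟩ := ih (fun u => (V (snocTuple u true) + V (snocTuple u false)) / 2)
      (by rw [← Finset.sum_div, hV, zero_div])
    -- The earlier prices realize the average of `V` over the last action, and the last price is the
    -- half-difference. Changing stage `q` leaves the earlier payments untouched.
    refine ⟨Function.update p q fun u => (V (snocTuple u true) - V (snocTuple u false)) / 2,
      fun u => ?_⟩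
    obtain ⟨v, b, rfl⟩ : ∃ v b, u = snocTuple v b := ⟨initTuple u, u (Fin.last q), by simp⟩
    rw [priceVec_snoc, transfer_snoc, Function.update_self,
      priceVec_congr (p' := p) fun k hk => Function.update_of_ne hk.ne _ _, hp]
    cases b
    · rw [sgn_false]; ring
    · rw [sgn_true]; ring

/-! ### The law of the prices given the actions of player 1 -/

/-- The law of the prices quoted by `τ` along the actions `u`. -/
noncomputable def priceLaw {n : ℕ} (τ : Strategy2 n) :
    (q : ℕ) → q ≤ n → (Fin q → Bool) → Measure (Fin q → ℝ)
  | 0, _, _ => Measure.dirac Fin.elim0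
  | q + 1, hq, u =>
      ((priceLaw τ q (Nat.le_of_succ_le hq) (initTuple u)) ⊗ₘ
        ((τ.kernel q hq).comap (histOf (initTuple u)) (measurable_histOf _))).map
        fun z => snocTuple z.1 z.2

theorem isProbabilityMeasure_priceLaw {n : ℕ} (τ : Strategy2 n) (q : ℕ) (hq : q ≤ n)
    (u : Fin q → Bool) : IsProbabilityMeasure (priceLaw τ q hq u) := by
  induction q with
  | zero => exact Measure.dirac.isProbabilityMeasure
  | succ q ih =>
    have := ih (Nat.le_of_succ_le hq) (initTuple u)
    exact Measure.isProbabilityMeasure_map (measurable_snocTuple q).aemeasurable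

attribute [instance] isProbabilityMeasure_priceLaw

theorem lintegral_priceLaw_snoc {n : ℕ} (τ : Strategy2 n) (q : ℕ) (hq : q + 1 ≤ n)
    (u : Fin q → Bool) (b : Bool) {f : (Fin (q + 1) → ℝ) → ℝ≥0∞} (hf : Measurable f) :
    ∫⁻ p, f p ∂(priceLaw τ (q + 1) hq (snocTuple u b)) =
      ∫⁻ p, ∫⁻ x, f (snocTuple p x) ∂(τ.kernel q hq (histOf u p))
        ∂(priceLaw τ q (Nat.le_of_succ_le hq) u) := by
  simp only [priceLaw, initTuple, snocTuple, Fin.init_snoc]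
  rw [lintegral_map hf (measurable_snocTuple q)]
  exact Measure.lintegral_compProd (hf.comp (measurable_snocTuple q))

/-- The probability of the actions `u` of player 1 given `L = l`, where the prices entering his
strategy are those of `p`. -/
noncomputable def weight {n : ℕ} (σ : Strategy1 n) (p : ∀ q, (Fin q → Bool) → ℝ) :
    (q : ℕ) → q ≤ n → (Fin q → Bool) → ℝ → ℝ≥0∞
  | 0, _, _, _ => 1
  | q + 1, hq, u, l => weight σ p q (Nat.le_of_succ_le hq) (initTuple u) l *
      σ.kernel q hq (histOf (initTuple u) (priceVec p q (initTuple u)), l) {u (Fin.last q)}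

theorem weight_snoc {n : ℕ} (σ : Strategy1 n) (p : ∀ q, (Fin q → Bool) → ℝ) (q : ℕ)
    (hq : q + 1 ≤ n) (u : Fin q → Bool) (b : Bool) (l : ℝ) :
    weight σ p (q + 1) hq (snocTuple u b) l = weight σ p q (Nat.le_of_succ_le hq) u l *
      σ.kernel q hq (histOf u (priceVec p q u), l) {b} := by
  simp [weight]

theorem measurable_weight {n : ℕ} (σ : Strategy1 n) (p : ∀ q, (Fin q → Bool) → ℝ) (q : ℕ)
    (hq : q ≤ n) (u : Fin q → Bool) : Measurable (weight σ p q hq u) := by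
  induction q with
  | zero => exact measurable_const
  | succ q ih =>
    exact (ih _ _).mul (((σ.kernel q hq).measurable_coe (measurableSet_singleton _)).comp
      (measurable_const.prodMk measurable_id))

theorem sum_kernel_bool {α : Type*} [MeasurableSpace α] (κ : Kernel α Bool) [IsMarkovKernel κ]
    (a : α) : κ a {true} + κ a {false} = 1 := by
  have h := lintegral_fintype (μ := κ a) fun _ => 1
  rw [lintegral_one, measure_univ, Fintype.sum_bool, one_mul, one_mul] at h
  exact h.symm

theorem sum_weight {n : ℕ} (σ : Strategy1 n) (p : ∀ q, (Fin q → Bool) → ℝ) (q : ℕ) (hq : q ≤ n)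
    (l : ℝ) : ∑ u, weight σ p q hq u l = 1 := by
  induction q with
  | zero => simp [weight]
  | succ q ih =>
    rw [sum_snocTuple]
    simp only [weight_snoc, ← mul_add, sum_kernel_bool, mul_one]
    exact ih _

/-- Player 1 reacts along the price paths of `τ` as if the prices were those of `p`. -/
def ReactsAs {n : ℕ} (σ : Strategy1 n) (τ : Strategy2 n) (p : ∀ q, (Fin q → Bool) → ℝ) : Prop :=
  ∀ (q : ℕ) (hq : q < n) (u : Fin q → Bool) (l : ℝ), ∀ᵐ x ∂(priceLaw τ q hq.le u),
    σ.kernel q hq (histOf u x, l) = σ.kernel q hq (histOf u (priceVec p q u), l)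

theorem Strategy1.IsReduced.kernel_eq {n : ℕ} {σ : Strategy1 n} (hσ : σ.IsReduced) (q : ℕ)
    (hq : q < n) (u : Fin q → Bool) (x y : Fin q → ℝ) (l : ℝ) :
    σ.kernel q hq (histOf u x, l) = σ.kernel q hq (histOf u y, l) := by
  obtain ⟨κ, hκ⟩ := hσ q hq
  rw [hκ]
  rfl

/-- One of the two situations in which player 1's lotteries do not depend on the realized prices;
the other is a pure strategy of player 2 (`reactsAs_pureStrategy`). -/
theorem Strategy1.IsReduced.reactsAs {n : ℕ} {σ : Strategy1 n} (hσ : σ.IsReduced)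
    (τ : Strategy2 n) (p : ∀ q, (Fin q → Bool) → ℝ) : ReactsAs σ τ p :=
  fun q hq u l => Eventually.of_forall fun x => hσ.kernel_eq q hq u x _ l

instance isProbabilityMeasure_law (μ : Measure ℝ) [IsProbabilityMeasure μ] {n : ℕ}
    (σ : Strategy1 n) (τ : Strategy2 n) (q : ℕ) (hq : q ≤ n) :
    IsProbabilityMeasure (law μ σ τ q hq) := by
  induction q with
  | zero => exact Measure.isProbabilityMeasure_map (by fun_prop)
  | succ q ih =>
    have := ih (Nat.le_of_succ_le hq)
    refine Measure.isProbabilityMeasure_map (Measurable.aemeasurable ?_)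
    exact ((measurable_snocTuple q).comp
      ((measurable_fst.comp measurable_fst).prodMk measurable_snd)).prodMk
      (measurable_snd.comp measurable_fst)

/-- The law of the history and of `L`, disintegrated along `L` and the actions of player 1. -/
theorem lintegral_law (μ : Measure ℝ) [IsProbabilityMeasure μ] {n : ℕ} {σ : Strategy1 n}
    {τ : Strategy2 n} {p : ∀ q, (Fin q → Bool) → ℝ} (h : ReactsAs σ τ p) (q : ℕ) (hq : q ≤ n)
    {f : Hist q × ℝ → ℝ≥0∞} (hf : Measurable f) :
    ∫⁻ z, f z ∂(law μ σ τ q hq) =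
      ∫⁻ l, ∑ u, weight σ p q hq u l * ∫⁻ x, f (histOf u x, l) ∂(priceLaw τ q hq u) ∂μ := by
  induction q with
  | zero =>
    simp only [law, weight, priceLaw]
    rw [lintegral_map hf (by fun_prop)]
    refine lintegral_congr fun l => ?_
    rw [Fintype.sum_subsingleton _ Fin.elim0, one_mul, lintegral_dirac']
    · congr 2
      funext i
      exact i.elim0
    · exact hf.comp ((measurable_histOf _).prodMk measurable_const)
  | succ q ih =>
    have hq' : q ≤ n := Nat.le_of_succ_le hq
    set g : (Hist q × ℝ) × (Bool × ℝ) → Hist (q + 1) × ℝ :=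
      fun z => ((Fin.snoc z.1.1 z.2 : Hist (q + 1)), z.1.2) with hg
    have mg : Measurable g := ((measurable_snocTuple q).comp
      ((measurable_fst.comp measurable_fst).prodMk measurable_snd)).prodMk
      (measurable_snd.comp measurable_fst)
    set κ := (σ.kernel q hq) ×ₖ ((τ.kernel q hq).comap Prod.fst measurable_fst) with hκ
    have mF : Measurable fun z => ∫⁻ y, f (g (z, y)) ∂(κ z) :=
      (hf.comp mg).lintegral_kernel_prod_right'
    have hlaw : ∫⁻ z, f z ∂(law μ σ τ (q + 1) hq) =
        ∫⁻ z, ∫⁻ y, f (g (z, y)) ∂(κ z) ∂(law μ σ τ q hq') := by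
      simp only [law]
      rw [lintegral_map hf mg]
      exact Measure.lintegral_compProd (hf.comp mg)
    rw [hlaw, ih hq' mF]
    refine lintegral_congr fun l => ?_
    rw [sum_snocTuple]
    refine Finset.sum_congr rfl fun u _ => ?_
    have mfb : ∀ b, Measurable fun z : (Fin q → ℝ) × ℝ =>
        f (histOf (snocTuple u b) (snocTuple z.1 z.2), l) := fun b =>
      hf.comp (((measurable_histOf _).comp (measurable_snocTuple q)).prodMk measurable_const)
    have hinner : ∀ x, ∫⁻ y, f (g ((histOf u x, l), y)) ∂(κ (histOf u x, l)) =
        σ.kernel q hq (histOf u x, l) {true} *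
            ∫⁻ y, f (histOf (snocTuple u true) (snocTuple x y), l) ∂(τ.kernel q hq (histOf u x)) +
          σ.kernel q hq (histOf u x, l) {false} *
            ∫⁻ y, f (histOf (snocTuple u false) (snocTuple x y), l)
              ∂(τ.kernel q hq (histOf u x)) := by
      intro x
      have mx : Measurable fun y => f (g ((histOf u x, l), y)) :=
        hf.comp (mg.comp measurable_prodMk_left)
      rw [hκ, Kernel.lintegral_prod _ _ _ mx, lintegral_fintype, Fintype.sum_bool, Kernel.comap_apply]
      simp only [hg, snoc_histOf]
      ring
    have mb : ∀ b, Measurable fun x => f (histOf (snocTuple u b) x, l) := fun b =>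
      hf.comp ((measurable_histOf _).prodMk measurable_const)
    rw [lintegral_priceLaw_snoc τ q hq u true (mb true), lintegral_priceLaw_snoc τ q hq u false
      (mb false), weight_snoc, weight_snoc, mul_assoc, mul_assoc, ← mul_add]
    congr 1
    have mker : ∀ b, Measurable fun x => ∫⁻ y, f (histOf (snocTuple u b) (snocTuple x y), l)
        ∂(τ.kernel q hq (histOf u x)) := fun b =>
      (mfb b).lintegral_kernel_prod_right'
        (κ := (τ.kernel q hq).comap (histOf u) (measurable_histOf u))
    -- `ReactsAs` makes the action probabilities constant for almost all price paths, so they leave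
    -- the integral over prices.
    calc ∫⁻ x, ∫⁻ y, f (g ((histOf u x, l), y)) ∂(κ (histOf u x, l)) ∂(priceLaw τ q hq' u)
        = ∫⁻ x, (σ.kernel q hq (histOf u (priceVec p q u), l) {true} *
            ∫⁻ y, f (histOf (snocTuple u true) (snocTuple x y), l) ∂(τ.kernel q hq (histOf u x)) +
          σ.kernel q hq (histOf u (priceVec p q u), l) {false} *
            ∫⁻ y, f (histOf (snocTuple u false) (snocTuple x y), l)
              ∂(τ.kernel q hq (histOf u x))) ∂(priceLaw τ q hq' u) := by
          refine lintegral_congr_ae ?_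
          filter_upwards [h q hq u l] with x hx
          rw [hinner, hx]
      _ = _ := by
          rw [lintegral_add_left ((mker true).const_mul _), lintegral_const_mul _ (mker true),
            lintegral_const_mul _ (mker false)]

/-- The law of the outcome as a sum over the actions of player 1. -/
theorem outcome_eq_sum (μ : Measure ℝ) [IsProbabilityMeasure μ] {n : ℕ} {σ : Strategy1 n}
    {τ : Strategy2 n} {p : ∀ q, (Fin q → Bool) → ℝ} (h : ReactsAs σ τ p) :
    outcome μ σ τ = ∑ u, ((μ.withDensity (weight σ p n le_rfl u)).prod
      (priceLaw τ n le_rfl u)).map fun z => (histOf u z.2, z.1) := by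
  have mh : ∀ u : Fin n → Bool, Measurable fun z : ℝ × (Fin n → ℝ) => (histOf u z.2, z.1) :=
    fun u => ((measurable_histOf u).comp measurable_snd).prodMk measurable_fst
  refine Measure.ext_of_lintegral _ fun f hf => ?_
  have mi : ∀ u : Fin n → Bool, Measurable fun l =>
      ∫⁻ x, f (histOf u x, l) ∂(priceLaw τ n le_rfl u) := fun u =>
    Measurable.lintegral_prod_right' (hf.comp (mh u))
  rw [outcome, lintegral_law μ h n le_rfl hf, lintegral_finsetSum_measure]
  refine (lintegral_finsetSum _ fun u _ => (measurable_weight σ p n le_rfl u).mul (mi u)).trans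
    (Finset.sum_congr rfl fun u _ => ?_)
  rw [lintegral_map hf (mh u), lintegral_prod _ (by exact (hf.comp (mh u)).aemeasurable),
    lintegral_withDensity_eq_lintegral_mul _ (measurable_weight σ p n le_rfl u) (mi u)]

/-! ### Expectations -/

theorem expectation_eq_integral {Ω : Type} [MeasurableSpace Ω] {P : Measure Ω} {f : Ω → ℝ}
    (hf : Integrable f P) : expectation P f = ((∫ x, f x ∂P : ℝ) : EReal) := by
  have h1 : ∫⁻ x, ENNReal.ofReal (f x) ∂P ≠ ⊤ := hf.lintegral_lt_top.ne
  have h2 : ∫⁻ x, ENNReal.ofReal (-f x) ∂P ≠ ⊤ := hf.neg.lintegral_lt_top.ne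
  rw [expectation, integral_eq_lintegral_pos_part_sub_lintegral_neg_part hf, EReal.coe_sub,
    EReal.coe_ennreal_toReal h1, EReal.coe_ennreal_toReal h2]

theorem expectationExists_of_integrable {Ω : Type} [MeasurableSpace Ω] {P : Measure Ω} {f : Ω → ℝ}
    (hf : Integrable f P) : ExpectationExists P f := Or.inl hf.lintegral_lt_top.ne

/-! ### Pure strategies of player 2 -/

/-- The pure strategy of player 2 with prices `p`. -/
noncomputable def pureStrategy (n : ℕ) (p : ∀ q, (Fin q → Bool) → ℝ) : Strategy2 n where
  kernel q _ := Kernel.deterministic (fun h : Hist q => p q h.moves)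
    ((measurable_of_finite (p q)).comp (Hist.measurable_moves q))
  markov _ _ := inferInstance

theorem isPure_pureStrategy (n : ℕ) (p : ∀ q, (Fin q → Bool) → ℝ) : (pureStrategy n p).IsPure :=
  fun q _ => ⟨p q, rfl⟩

theorem Strategy2.IsPure.exists_eq {n : ℕ} {τ : Strategy2 n} (h : τ.IsPure) :
    ∃ p, τ = pureStrategy n p := by
  choose p hp using h
  refine ⟨fun q => if hq : q < n then p q hq else fun _ => 0, ?_⟩
  obtain ⟨κ, hκ⟩ := τ
  have : κ = (pureStrategy n fun q => if hq : q < n then p q hq else fun _ => 0).kernel := by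
    funext q hq
    rw [show κ q hq = _ from hp q hq]
    simp only [pureStrategy, dif_pos hq]
  subst this
  rfl

theorem priceLaw_pureStrategy {n : ℕ} (p : ∀ q, (Fin q → Bool) → ℝ) (q : ℕ) (hq : q ≤ n)
    (u : Fin q → Bool) : priceLaw (pureStrategy n p) q hq u = Measure.dirac (priceVec p q u) := by
  induction q with
  | zero => rfl
  | succ q ih =>
    obtain ⟨v, b, rfl⟩ : ∃ v b, u = snocTuple v b := ⟨initTuple u, u (Fin.last q), by simp⟩
    refine Measure.ext_of_lintegral _ fun f hf => ?_
    rw [lintegral_priceLaw_snoc _ _ _ _ _ hf, ih, lintegral_dirac, lintegral_dirac' _ hf,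
      priceVec_snoc]
    exact lintegral_dirac' _ (hf.comp ((measurable_snocTuple q).comp measurable_prodMk_left))

theorem reactsAs_pureStrategy {n : ℕ} (σ : Strategy1 n) (p : ∀ q, (Fin q → Bool) → ℝ) :
    ReactsAs σ (pureStrategy n p) p := by
  intro q hq u l
  rw [priceLaw_pureStrategy, ae_dirac_eq]
  exact rfl

/-- The normalized sum of the actions of player 1. -/
noncomputable def score {n : ℕ} (u : Fin n → Bool) : ℝ := (1 / √(n : ℝ)) * ∑ q, sgn (u q)

theorem gain_histOf {n : ℕ} (u : Fin n → Bool) (x : Fin n → ℝ) (l : ℝ) :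
    gain n (histOf u x, l) = l * score u - (1 / √(n : ℝ)) * transfer u x := by
  simp only [gain, histOf, score, transfer, mul_sub, Finset.sum_sub_distrib, ← Finset.sum_mul]
  ring

theorem measurable_gain (n : ℕ) : Measurable (gain n) := by
  have hs : Measurable sgn := measurable_of_finite _
  refine Measurable.const_mul (Finset.measurable_sum _ fun q _ => ?_) _
  have h1 : Measurable fun z : Hist n × ℝ => z.1 q := (measurable_pi_apply q).comp measurable_fst
  exact (hs.comp h1.fst).mul (measurable_snd.sub h1.snd)

section

variable {μ : Measure ℝ} [IsProbabilityMeasure μ] {n : ℕ}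

/-- The law of `L` on the event that player 1 plays `u`. -/
noncomputable def actionLaw (μ : Measure ℝ) {n : ℕ} (σ : Strategy1 n)
    (p : ∀ q, (Fin q → Bool) → ℝ) (u : Fin n → Bool) : Measure ℝ :=
  μ.withDensity (weight σ p n le_rfl u)

omit [IsProbabilityMeasure μ] in
theorem sum_actionLaw (σ : Strategy1 n) (p : ∀ q, (Fin q → Bool) → ℝ) :
    ∑ u, actionLaw μ σ p u = μ := by
  ext A hA
  rw [Measure.finsetSum_apply]
  simp only [actionLaw, withDensity_apply _ hA]
  rw [← lintegral_finsetSum _ fun u _ => measurable_weight σ p n le_rfl u]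
  simp [sum_weight]

instance isFiniteMeasure_actionLaw (σ : Strategy1 n) (p : ∀ q, (Fin q → Bool) → ℝ)
    (u : Fin n → Bool) : IsFiniteMeasure (actionLaw μ σ p u) := by
  refine isFiniteMeasure_withDensity (ne_top_of_le_ne_top ENNReal.one_ne_top ?_)
  calc ∫⁻ l, weight σ p n le_rfl u l ∂μ ≤ ∫⁻ _l, 1 ∂μ := lintegral_mono fun l => by
        rw [← sum_weight σ p n le_rfl l]
        exact Finset.single_le_sum (f := fun u => weight σ p n le_rfl u l) (fun _ _ => zero_le)
          (Finset.mem_univ u)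
    _ = 1 := by simp

omit [IsProbabilityMeasure μ] in
theorem actionLaw_absolutelyContinuous (σ : Strategy1 n) (p : ∀ q, (Fin q → Bool) → ℝ)
    (u : Fin n → Bool) : actionLaw μ σ p u ≪ μ := withDensity_absolutelyContinuous _ _

omit [IsProbabilityMeasure μ] in
theorem IsFullOnUnit.ae_actionLaw (hμ : IsFullOnUnit μ) (σ : Strategy1 n)
    (p : ∀ q, (Fin q → Bool) → ℝ) (u : Fin n → Bool) :
    ∀ᵐ l ∂(actionLaw μ σ p u), l ∈ Ioo (0 : ℝ) 1 :=
  (actionLaw_absolutelyContinuous σ p u).ae_le hμ.ae_mem_Ioo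

theorem IsFullOnUnit.integrable_actionLaw (hμ : IsFullOnUnit μ) (σ : Strategy1 n)
    (p : ∀ q, (Fin q → Bool) → ℝ) (u : Fin n → Bool) {g : ℝ → ℝ} (hg : Continuous g) :
    Integrable g (actionLaw μ σ p u) := by
  obtain ⟨C, hC⟩ := (isCompact_Icc (a := (0 : ℝ)) (b := 1)).exists_bound_of_continuousOn
    hg.continuousOn
  refine Integrable.of_bound hg.aestronglyMeasurable C ?_
  filter_upwards [hμ.ae_actionLaw σ p u] with l hl
  exact hC l ⟨hl.1.le, hl.2.le⟩

theorem outcome_pureStrategy (σ : Strategy1 n) (p : ∀ q, (Fin q → Bool) → ℝ) :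
    outcome μ σ (pureStrategy n p) =
      ∑ u, (actionLaw μ σ p u).map fun l => (histOf u (priceVec p n u), l) := by
  rw [outcome_eq_sum μ (reactsAs_pureStrategy σ p)]
  refine Finset.sum_congr rfl fun u _ => ?_
  rw [priceLaw_pureStrategy, Measure.prod_dirac, Measure.map_map]
  · rfl
  · exact ((measurable_histOf u).comp measurable_snd).prodMk measurable_fst
  · exact measurable_id.prodMk measurable_const

/-- The transfers in the normalized gain. -/
noncomputable def normTransfer (n : ℕ) (p : ∀ q, (Fin q → Bool) → ℝ) (u : Fin n → Bool) : ℝ :=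
  (1 / √(n : ℝ)) * transfer u (priceVec p n u)

omit [IsProbabilityMeasure μ] in
theorem sum_normTransfer (n : ℕ) (p : ∀ q, (Fin q → Bool) → ℝ) : ∑ u, normTransfer n p u = 0 := by
  simp only [normTransfer, ← Finset.mul_sum, sum_transfer_priceVec, mul_zero]

omit [IsProbabilityMeasure μ] in
theorem exists_normTransfer_eq (hn : 1 ≤ n) (V : (Fin n → Bool) → ℝ) (hV : ∑ u, V u = 0) :
    ∃ p, ∀ u, normTransfer n p u = V u := by
  obtain ⟨p, hp⟩ := exists_transfer_eq (fun u => √(n : ℝ) * V u)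
    (by rw [← Finset.mul_sum, hV, mul_zero])
  have hpos : 0 < √(n : ℝ) := Real.sqrt_pos.mpr (by exact_mod_cast hn)
  refine ⟨p, fun u => ?_⟩
  rw [normTransfer, hp]
  field_simp

/-- For each of the finitely many `u`, the gain is an affine function of `L`, which lives in
`(0,1)`; integrability is automatic. -/
theorem integrable_outcome_pureStrategy (hμ : IsFullOnUnit μ) (σ : Strategy1 n)
    (p : ∀ q, (Fin q → Bool) → ℝ) {g : ℝ → ℝ} (hg : Continuous g) :
    Integrable (fun z => g (gain n z)) (outcome μ σ (pureStrategy n p)) ∧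
      ∫ z, g (gain n z) ∂(outcome μ σ (pureStrategy n p)) =
        ∑ u, ∫ l, g (l * score u - normTransfer n p u) ∂(actionLaw μ σ p u) := by
  have mh : ∀ u : Fin n → Bool, Measurable fun l : ℝ => (histOf u (priceVec p n u), l) :=
    fun u => measurable_const.prodMk measurable_id
  have mg : Measurable fun z => g (gain n z) := hg.measurable.comp (measurable_gain n)
  have hcont : ∀ u : Fin n → Bool, Continuous fun l =>
      g (gain n (histOf u (priceVec p n u), l)) := fun u => by
    simp only [gain_histOf]
    fun_prop
  have hint : ∀ u ∈ (Finset.univ : Finset (Fin n → Bool)), Integrable (fun z => g (gain n z))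
      ((actionLaw μ σ p u).map fun l => (histOf u (priceVec p n u), l)) := fun u _ =>
    (integrable_map_measure mg.aestronglyMeasurable (mh u).aemeasurable).mpr
      (hμ.integrable_actionLaw σ p u (hcont u))
  rw [outcome_pureStrategy]
  refine ⟨integrable_finsetSum_measure.mpr hint, ?_⟩
  rw [integral_finsetSum_measure hint]
  refine Finset.sum_congr rfl fun u _ => ?_
  rw [integral_map (mh u).aemeasurable mg.aestronglyMeasurable]
  simp only [gain_histOf, normTransfer]

theorem payoff1_pureStrategy (hμ : IsFullOnUnit μ) (σ : Strategy1 n)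
    (p : ∀ q, (Fin q → Bool) → ℝ) : payoff1 μ σ (pureStrategy n p) =
      ((∑ u, ∫ l, (l * score u - normTransfer n p u) ∂(actionLaw μ σ p u) : ℝ) : EReal) := by
  obtain ⟨h1, h2⟩ := integrable_outcome_pureStrategy hμ σ p continuous_id
  rw [payoff1, expectation_eq_integral (f := gain n) h1]
  exact congrArg _ h2

theorem payoff2_pureStrategy (hμ : IsFullOnUnit μ) {H : ℝ → ℝ} (hH : Continuous H)
    (σ : Strategy1 n) (p : ∀ q, (Fin q → Bool) → ℝ) : payoff2 μ H σ (pureStrategy n p) =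
      ((∑ u, ∫ l, H (l * score u - normTransfer n p u) ∂(actionLaw μ σ p u) : ℝ) : EReal) := by
  obtain ⟨h1, h2⟩ := integrable_outcome_pureStrategy hμ σ p hH
  rw [payoff2, expectation_eq_integral h1, h2]

omit [IsProbabilityMeasure μ] in
/-- Against a pure strategy of player 2, the past prices carry no information. -/
theorem exists_reduced_actionLaw_eq (σ : Strategy1 n) (p : ∀ q, (Fin q → Bool) → ℝ) :
    ∃ σ' : Strategy1 n, σ'.IsReduced ∧ actionLaw μ σ' p = actionLaw μ σ p := by
  have mf : ∀ q, Measurable fun x : (Fin q → Bool) × ℝ =>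
      ((histOf x.1 (priceVec p q x.1), x.2) : Hist q × ℝ) := fun q =>
    ((measurable_of_finite fun u : Fin q → Bool => histOf u (priceVec p q u)).comp
      measurable_fst).prodMk measurable_snd
  have mm : ∀ q, Measurable fun x : Hist q × ℝ => (x.1.moves, x.2) := fun q =>
    ((Hist.measurable_moves q).comp measurable_fst).prodMk measurable_snd
  let σ' : Strategy1 n :=
    { kernel := fun q hq => ((σ.kernel q hq).comap _ (mf q)).comap _ (mm q)
      markov := fun q hq => inferInstance }
  refine ⟨σ', fun q hq => ⟨(σ.kernel q hq).comap _ (mf q), rfl⟩, ?_⟩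
  have hw : ∀ q (hq : q ≤ n) u l, weight σ' p q hq u l = weight σ p q hq u l := by
    intro q
    induction q with
    | zero => intro _ _ _; rfl
    | succ q ih =>
      intro hq u l
      simp only [weight, ih]
      rfl
  funext u
  rw [actionLaw, actionLaw, funext (hw n le_rfl u)]

end

/-! ### Growth of the risk-aversion function -/

theorem IsRiskAversion.differentiable {H : ℝ → ℝ} (hH : IsRiskAversion H) : Differentiable ℝ H :=
  hH.contDiff.differentiable (by norm_num)

theorem IsRiskAversion.exists_lipschitzWith {H : ℝ → ℝ} (hH : IsRiskAversion H) :
    ∃ K : ℝ≥0, LipschitzWith K H := by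
  obtain ⟨ε, K, hε, hb⟩ := hH.deriv_bounds
  refine ⟨K.toNNReal, lipschitzWith_of_nnnorm_deriv_le hH.differentiable fun x => ?_⟩
  rw [← NNReal.coe_le_coe, coe_nnnorm, Real.norm_eq_abs, abs_of_pos (hε.trans (hb x).1)]
  exact (hb x).2.le.trans (Real.le_coe_toNNReal K)

theorem IsRiskAversion.exists_mul_le {H : ℝ → ℝ} (hH : IsRiskAversion H) :
    ∃ ε : ℝ, 0 < ε ∧ ∀ x y, x ≤ y → ε * (y - x) ≤ H y - H x := by
  obtain ⟨ε, K, hε, hb⟩ := hH.deriv_bounds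
  exact ⟨ε, hε, fun x y hxy =>
    mul_sub_le_image_sub_of_le_deriv hH.differentiable (fun z => (hb z).1.le) hxy⟩

theorem IsRiskAversion.integrable_comp {H : ℝ → ℝ} (hH : IsRiskAversion H) {Ω : Type*}
    [MeasurableSpace Ω] {P : Measure Ω} [IsFiniteMeasure P] {f : Ω → ℝ} (hf : Integrable f P) :
    Integrable (fun x => H (f x)) P := by
  obtain ⟨K, hK⟩ := hH.exists_lipschitzWith
  refine Integrable.mono' (g := fun x => |H 0| + K * |f x|)
    ((integrable_const _).add (hf.abs.const_mul _))
    (hK.continuous.comp_aestronglyMeasurable hf.aestronglyMeasurable)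
    (Eventually.of_forall fun x => ?_)
  have := hK.dist_le_mul (f x) 0
  rw [Real.dist_eq, Real.dist_eq, sub_zero] at this
  rw [Real.norm_eq_abs]
  have h2 := abs_add_le (H (f x) - H 0) (H 0)
  rw [sub_add_cancel] at h2
  linarith

/-! ### Strategies of player 1 that ignore the prices -/

section

variable {μ : Measure ℝ} [IsProbabilityMeasure μ] {n : ℕ} {H : ℝ → ℝ} {σ : Strategy1 n}

theorem Strategy1.IsReduced.weight_eq (hσ : σ.IsReduced) (p p' : ∀ q, (Fin q → Bool) → ℝ) (q : ℕ)
    (hq : q ≤ n) (u : Fin q → Bool) : weight σ p q hq u = weight σ p' q hq u := by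
  induction q with
  | zero => rfl
  | succ q ih =>
    funext l
    simp only [weight, ih]
    rw [hσ.kernel_eq q hq _ _ (priceVec p' q (initTuple u)) l]

omit [IsProbabilityMeasure μ] in
theorem Strategy1.IsReduced.actionLaw_eq (hσ : σ.IsReduced) (p p' : ∀ q, (Fin q → Bool) → ℝ) :
    actionLaw μ σ p = actionLaw μ σ p' := by
  funext u
  rw [actionLaw, actionLaw, hσ.weight_eq p p']

theorem sum_actionLaw_real_univ (σ : Strategy1 n) (p : ∀ q, (Fin q → Bool) → ℝ) :
    ∑ u, (actionLaw μ σ p u).real univ = 1 := by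
  have h := congrArg (fun m : Measure ℝ => m univ) (sum_actionLaw (μ := μ) σ p)
  simp only [Measure.finsetSum_apply, measure_univ] at h
  simp only [Measure.real]
  rw [← ENNReal.toReal_sum fun u _ => measure_ne_top _ _, h, ENNReal.toReal_one]

/-- At an equilibrium, every sequence of actions of player 1 has a positive probability. -/
theorem actionLaw_univ_ne_zero (hμ : IsFullOnUnit μ) (hH : IsRiskAversion H) (hn : 1 ≤ n)
    (hσ : σ.IsReduced) {p : ∀ q, (Fin q → Bool) → ℝ}
    (hbest : ∀ p', payoff2 μ H σ (pureStrategy n p) ≤ payoff2 μ H σ (pureStrategy n p'))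
    (u₀ : Fin n → Bool) : actionLaw μ σ p u₀ univ ≠ 0 := by
  intro h0
  have hHc := hH.contDiff.continuous
  obtain ⟨ε, hε, hHε⟩ := hH.exists_mul_le
  have hz : actionLaw μ σ p u₀ = 0 := Measure.measure_univ_eq_zero.mp h0
  -- Were `u₀` never played, player 2 could collect one more unit on every other sequence and let
  -- `u₀` carry the balancing `2 ^ n`. The zero-sum constraint holds, and the payoff falls by at
  -- least `ε`.
  obtain ⟨p', hp'⟩ := exists_normTransfer_eq hn
    (fun u => normTransfer n p u + 1 - if u = u₀ then (2 : ℝ) ^ n else 0) (by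
      rw [Finset.sum_sub_distrib, Finset.sum_add_distrib, sum_normTransfer]
      simp)
  have h := hbest p'
  rw [payoff2_pureStrategy hμ hHc, payoff2_pureStrategy hμ hHc, EReal.coe_le_coe_iff,
    hσ.actionLaw_eq p' p] at h
  have hle : ∀ u, ∫ l, H (l * score u - normTransfer n p' u) ∂(actionLaw μ σ p u) ≤
      ∫ l, H (l * score u - normTransfer n p u) ∂(actionLaw μ σ p u) -
        ε * (actionLaw μ σ p u).real univ := by
    intro u
    by_cases hu : u = u₀
    · subst hu
      simp [hz]
    · have hc : (actionLaw μ σ p u).real univ * ε = ∫ _l, ε ∂(actionLaw μ σ p u) := by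
        rw [integral_const, smul_eq_mul]
      rw [mul_comm, hc, ← integral_sub (hμ.integrable_actionLaw σ p u (by fun_prop))
        (integrable_const _)]
      refine integral_mono (hμ.integrable_actionLaw σ p u (by fun_prop))
        ((hμ.integrable_actionLaw σ p u (by fun_prop)).sub (integrable_const _)) fun l => ?_
      have := hHε (l * score u - normTransfer n p' u) (l * score u - normTransfer n p u)
        (by rw [hp', if_neg hu]; linarith)
      rw [hp', if_neg hu] at this ⊢
      simp only at this ⊢
      linarith
  have hs := Finset.sum_le_sum fun u (_ : u ∈ Finset.univ) => hle u
  rw [Finset.sum_sub_distrib, ← Finset.mul_sum, sum_actionLaw_real_univ] at hs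
  linarith

/-- `H` grows at least linearly at `+∞`, so a finite positive part of the payoff bounds the positive
part of the gain, hence the negative part of the payment. Along `u` the prices are independent of
`L`, and the positive mass of `u` isolates their law. -/
theorem lintegral_neg_transfer_ne_top (hμ : IsFullOnUnit μ) (hH : IsRiskAversion H) (hn : 1 ≤ n)
    (hσ : σ.IsReduced) {p : ∀ q, (Fin q → Bool) → ℝ} {τ : Strategy2 n}
    (hpos : ∀ u, actionLaw μ σ p u univ ≠ 0)
    (hfin : ∫⁻ z, ENNReal.ofReal (H (gain n z)) ∂(outcome μ σ τ) ≠ ⊤) (u : Fin n → Bool) :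
    ∫⁻ x, ENNReal.ofReal (-transfer u x) ∂(priceLaw τ n le_rfl u) ≠ ⊤ := by
  obtain ⟨ε, hε, hHε⟩ := hH.exists_mul_le
  have hc : 0 < 1 / √(n : ℝ) := by
    have : 0 < √(n : ℝ) := Real.sqrt_pos.mpr (by exact_mod_cast hn)
    positivity
  set c := 1 / √(n : ℝ) with hcdef
  have mt : Measurable fun x : Fin n → ℝ => transfer u x :=
    Finset.measurable_sum _ fun i _ => (measurable_pi_apply i).const_mul _
  have mh : Measurable fun z : ℝ × (Fin n → ℝ) => (histOf u z.2, z.1) :=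
    ((measurable_histOf u).comp measurable_snd).prodMk measurable_fst
  have mH : Measurable fun z => ENNReal.ofReal (H (gain n z)) :=
    (hH.contDiff.continuous.measurable.comp (measurable_gain n)).ennreal_ofReal
  have hu : ∫⁻ z : ℝ × (Fin n → ℝ), ENNReal.ofReal (H (z.1 * score u - c * transfer u z.2))
      ∂((actionLaw μ σ p u).prod (priceLaw τ n le_rfl u)) ≠ ⊤ := by
    refine ne_top_of_le_ne_top hfin ?_
    rw [outcome_eq_sum μ (hσ.reactsAs τ p), lintegral_finsetSum_measure]
    refine le_trans (le_of_eq ?_) (Finset.single_le_sum (fun _ _ => zero_le) (Finset.mem_univ u))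
    rw [lintegral_map mH mh]
    simp only [gain_histOf]
    rfl
  have hbound : ∀ᵐ z ∂((actionLaw μ σ p u).prod (priceLaw τ n le_rfl u)),
      ENNReal.ofReal (-transfer u z.2) ≤ ENNReal.ofReal ((c * ε)⁻¹) *
        ENNReal.ofReal (H (z.1 * score u - c * transfer u z.2)) +
          ENNReal.ofReal ((c * ε)⁻¹ * |H 0| + c⁻¹ * |score u|) := by
    have hI : ∀ᵐ z ∂((actionLaw μ σ p u).prod (priceLaw τ n le_rfl u)), z.1 ∈ Ioo (0 : ℝ) 1 :=
      Measure.quasiMeasurePreserving_fst.ae (hμ.ae_actionLaw σ p u)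
    filter_upwards [hI] with z hz
    have hs : -|score u| ≤ z.1 * score u := by
      have h1 : |z.1 * score u| ≤ |score u| := by
        rw [abs_mul, abs_of_pos hz.1]
        exact mul_le_of_le_one_left (abs_nonneg _) hz.2.le
      exact (neg_le_neg h1).trans (neg_abs_le _)
    set y := z.1 * score u - c * transfer u z.2 with hy
    have hcε : 0 < c * ε := mul_pos hc hε
    have hty : -transfer u z.2 ≤ c⁻¹ * y + c⁻¹ * |score u| := by
      rw [← mul_add, inv_mul_eq_div, le_div_iff₀ hc]
      linarith
    rw [← ENNReal.ofReal_mul (inv_nonneg.mpr hcε.le)]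
    rcases le_total 0 y with h0 | h0
    · have h1 := hHε 0 y h0
      rw [sub_zero] at h1
      refine le_trans (ENNReal.ofReal_le_ofReal ?_) ENNReal.ofReal_add_le
      have h2 : c⁻¹ * y ≤ (c * ε)⁻¹ * (H y + |H 0|) := by
        rw [mul_inv, mul_assoc]
        refine mul_le_mul_of_nonneg_left ?_ (inv_nonneg.mpr hc.le)
        rw [inv_mul_eq_div, le_div_iff₀ hε]
        linarith [neg_abs_le (H 0)]
      linarith
    · refine le_trans (ENNReal.ofReal_le_ofReal ?_) le_add_self
      have h1 : c⁻¹ * y ≤ 0 := mul_nonpos_of_nonneg_of_nonpos (inv_nonneg.mpr hc.le) h0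
      have h2 : 0 ≤ (c * ε)⁻¹ * |H 0| := by positivity
      linarith
  have hprod : ∫⁻ z : ℝ × (Fin n → ℝ), ENNReal.ofReal (-transfer u z.2)
      ∂((actionLaw μ σ p u).prod (priceLaw τ n le_rfl u)) ≠ ⊤ := by
    refine ne_top_of_le_ne_top ?_ (lintegral_mono_ae hbound)
    rw [lintegral_add_right _ measurable_const, lintegral_const_mul' _ _ ENNReal.ofReal_ne_top,
      lintegral_const]
    exact ENNReal.add_ne_top.mpr ⟨ENNReal.mul_ne_top ENNReal.ofReal_ne_top hu,
      ENNReal.mul_ne_top ENNReal.ofReal_ne_top (measure_ne_top _ _)⟩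
  have mt' : Measurable fun z : ℝ × (Fin n → ℝ) => ENNReal.ofReal (-transfer u z.2) :=
    (mt.comp measurable_snd).neg.ennreal_ofReal
  rw [lintegral_prod _ mt'.aemeasurable] at hprod
  simp only [lintegral_const] at hprod
  intro htop
  exact hprod (by rw [htop, ENNReal.top_mul (hpos u)])

end

/-! ### Integrability of the prices -/

theorem measurable_transfer {q : ℕ} (u : Fin q → Bool) : Measurable (transfer u) :=
  Finset.measurable_sum _ fun i _ => (measurable_pi_apply i).const_mul _

/-- Backward induction: whatever the sign of the next price, one of the two actions does not
increase the payment, so the current negative part is below the sum of the next two. -/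
theorem lintegral_priceLaw_neg_transfer_ne_top {n : ℕ} {τ : Strategy2 n}
    (h : ∀ u, ∫⁻ x, ENNReal.ofReal (-transfer u x) ∂(priceLaw τ n le_rfl u) ≠ ⊤) (q : ℕ)
    (hq : q ≤ n) (u : Fin q → Bool) :
    ∫⁻ x, ENNReal.ofReal (-transfer u x) ∂(priceLaw τ q hq u) ≠ ⊤ := by
  induction hq using Nat.decreasingInduction with
  | self => exact h u
  | of_succ q hq ih =>
    have mt : ∀ b, Measurable fun x => ENNReal.ofReal (-transfer (snocTuple u b) x) := fun b =>
      (measurable_transfer _).neg.ennreal_ofReal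
    have mk : Measurable fun x => ∫⁻ y, ENNReal.ofReal
        (-transfer (snocTuple u true) (snocTuple x y)) ∂(τ.kernel q hq (histOf u x)) :=
      ((mt true).comp (measurable_snocTuple q)).lintegral_kernel_prod_right'
        (κ := (τ.kernel q hq).comap (histOf u) (measurable_histOf u))
    refine ne_top_of_le_ne_top (ENNReal.add_ne_top.mpr ⟨ih (snocTuple u true),
      ih (snocTuple u false)⟩) ?_
    rw [lintegral_priceLaw_snoc _ _ _ _ _ (mt true), lintegral_priceLaw_snoc _ _ _ _ _ (mt false),
      ← lintegral_add_left mk]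
    refine lintegral_mono fun x => ?_
    have mt' : Measurable fun y => ENNReal.ofReal (-transfer (snocTuple u true) (snocTuple x y)) :=
      (mt true).comp ((measurable_snocTuple q).comp measurable_prodMk_left)
    rw [← lintegral_add_left mt']
    calc ENNReal.ofReal (-transfer u x)
        = ∫⁻ _y, ENNReal.ofReal (-transfer u x) ∂(τ.kernel q hq (histOf u x)) := by simp
      _ ≤ _ := lintegral_mono fun y => ?_
    simp only [transfer_snoc, sgn_true, sgn_false]
    rcases le_total 0 y with hy | hy
    · exact le_trans (ENNReal.ofReal_le_ofReal (by linarith)) le_add_self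
    · exact le_trans (ENNReal.ofReal_le_ofReal (by linarith)) le_self_add

theorem map_initTuple_priceLaw {n : ℕ} (τ : Strategy2 n) (q : ℕ) (hq : q + 1 ≤ n)
    (u : Fin q → Bool) (b : Bool) :
    (priceLaw τ (q + 1) hq (snocTuple u b)).map initTuple =
      priceLaw τ q (Nat.le_of_succ_le hq) u := by
  have mi : Measurable fun x : Fin (q + 1) → ℝ => initTuple x :=
    measurable_pi_lambda _ fun i => measurable_pi_apply _
  refine Measure.ext_of_lintegral _ fun f hf => ?_
  rw [lintegral_map hf mi, lintegral_priceLaw_snoc _ _ _ _ _ (by exact hf.comp mi)]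
  simp

/-- Forward induction. With `t` the payment so far and `y` the new price, `|y| ≤ (t + y)⁻ + (t - y)⁻
+ |t|`. The possibility of both buying and selling bounds the price on both sides. -/
theorem integrable_priceLaw {n : ℕ} {τ : Strategy2 n}
    (h : ∀ u, ∫⁻ x, ENNReal.ofReal (-transfer u x) ∂(priceLaw τ n le_rfl u) ≠ ⊤) (q : ℕ)
    (hq : q ≤ n) (u : Fin q → Bool) (i : Fin q) :
    Integrable (fun x => x i) (priceLaw τ q hq u) := by
  induction q with
  | zero => exact i.elim0
  | succ q ih =>
    obtain ⟨v, b, rfl⟩ : ∃ v b, u = snocTuple v b := ⟨initTuple u, u (Fin.last q), by simp⟩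
    have hq' : q ≤ n := Nat.le_of_succ_le hq
    refine Fin.lastCases ?_ (fun j => ?_) i
    · refine ⟨(measurable_pi_apply _).aestronglyMeasurable, ?_⟩
      have mt : ∀ b, Measurable fun x => ENNReal.ofReal (-transfer (snocTuple v b) x) := fun b =>
        (measurable_transfer _).neg.ennreal_ofReal
      have mk : ∀ b, Measurable fun x => ∫⁻ y, ENNReal.ofReal
          (-transfer (snocTuple v b) (snocTuple x y)) ∂(τ.kernel q hq (histOf v x)) := fun b =>
        ((mt b).comp (measurable_snocTuple q)).lintegral_kernel_prod_right'
          (κ := (τ.kernel q hq).comap (histOf v) (measurable_histOf v))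
      have ht : Integrable (transfer v) (priceLaw τ q hq' v) :=
        integrable_finsetSum _ fun j _ => (ih hq' v j).const_mul _
      have hb := fun b => lintegral_priceLaw_neg_transfer_ne_top h (q + 1) hq (snocTuple v b)
      have hsum := ENNReal.add_ne_top.mpr ⟨ENNReal.add_ne_top.mpr ⟨hb true, hb false⟩,
        ht.hasFiniteIntegral.ne⟩
      refine lt_of_le_of_lt ?_ (lt_top_iff_ne_top.mpr hsum)
      rw [lintegral_priceLaw_snoc _ _ _ _ _ (mt true),
        lintegral_priceLaw_snoc _ _ _ _ _ (mt false), ← lintegral_add_left (mk true),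
        ← lintegral_add_right _ (measurable_transfer v).enorm,
        lintegral_priceLaw_snoc _ _ _ _ _ (measurable_pi_apply _).enorm]
      refine lintegral_mono fun x => ?_
      have mt' : ∀ b, Measurable fun y => ENNReal.ofReal
          (-transfer (snocTuple v b) (snocTuple x y)) := fun b =>
        (mt b).comp ((measurable_snocTuple q).comp measurable_prodMk_left)
      calc ∫⁻ y, ‖snocTuple x y (Fin.last q)‖ₑ ∂(τ.kernel q hq (histOf v x))
          ≤ ∫⁻ y, (ENNReal.ofReal (-transfer (snocTuple v true) (snocTuple x y)) +
              ENNReal.ofReal (-transfer (snocTuple v false) (snocTuple x y)) + ‖transfer v x‖ₑ)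
                ∂(τ.kernel q hq (histOf v x)) := lintegral_mono fun y => by
            simp only [transfer_snoc, sgn_true, sgn_false, snocTuple, Fin.snoc_last,
              Real.enorm_eq_ofReal_abs]
            rcases le_total 0 y with hy | hy
            · rw [abs_of_nonneg hy, add_assoc]
              refine le_trans (le_trans (ENNReal.ofReal_le_ofReal ?_) ENNReal.ofReal_add_le)
                le_add_self
              linarith [le_abs_self (transfer v x)]
            · rw [abs_of_nonpos hy, add_right_comm]
              refine le_trans (le_trans (ENNReal.ofReal_le_ofReal ?_) ENNReal.ofReal_add_le)
                le_self_add
              linarith [le_abs_self (transfer v x)]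
        _ = _ := by
            rw [lintegral_add_right _ measurable_const, lintegral_add_left (mt' true)]
            simp
    · have hj := ih hq' v j
      rw [← map_initTuple_priceLaw τ q hq v b] at hj
      exact hj.comp_measurable (measurable_pi_lambda _ fun i => measurable_pi_apply _)

/-- The mean price quoted by `τ` after the actions `u`. -/
noncomputable def meanPrice {n : ℕ} (τ : Strategy2 n) (q : ℕ) (u : Fin q → Bool) : ℝ :=
  if hq : q < n then ∫ x, x (Fin.last q) ∂(priceLaw τ (q + 1) hq (snocTuple u true)) else 0

/-- A price is drawn without knowledge of the simultaneous action, so the action `true` appended in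
`meanPrice` is immaterial. -/
theorem integral_priceLaw {n : ℕ} (τ : Strategy2 n) (q : ℕ)
    (hq : q ≤ n) (u : Fin q → Bool) (i : Fin q) :
    ∫ x, x i ∂(priceLaw τ q hq u) = priceVec (meanPrice τ) q u i := by
  induction q with
  | zero => exact i.elim0
  | succ q ih =>
    obtain ⟨v, b, rfl⟩ : ∃ v b, u = snocTuple v b := ⟨initTuple u, u (Fin.last q), by simp⟩
    rw [priceVec_snoc]
    refine Fin.lastCases ?_ (fun j => ?_) i
    · simp only [snocTuple, Fin.snoc_last]
      rw [meanPrice, dif_pos (show q < n from hq)]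
      simp only [priceLaw, initTuple, snocTuple, Fin.init_snoc]
    · simp only [snocTuple, Fin.snoc_castSucc]
      rw [← ih (Nat.le_of_succ_le hq) v j, ← map_initTuple_priceLaw τ q hq v b, integral_map]
      · rfl
      · exact (measurable_pi_lambda _ fun i => measurable_pi_apply _).aemeasurable
      · exact (measurable_pi_apply j).aestronglyMeasurable

section

variable {μ : Measure ℝ} [IsProbabilityMeasure μ] {n : ℕ} {H : ℝ → ℝ} {σ : Strategy1 n}

/-- Against a strategy that ignores the prices, player 2 does not lose by quoting mean prices. -/
theorem payoff2_meanPrice_le (hμ : IsFullOnUnit μ) (hH : IsRiskAversion H) (hσ : σ.IsReduced)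
    {τ : Strategy2 n}
    (h : ∀ u, ∫⁻ x, ENNReal.ofReal (-transfer u x) ∂(priceLaw τ n le_rfl u) ≠ ⊤) :
    payoff2 μ H σ (pureStrategy n (meanPrice τ)) ≤ payoff2 μ H σ τ := by
  have hHc := hH.contDiff.continuous
  set p := meanPrice τ with hp
  have mh : ∀ u, Measurable fun z : ℝ × (Fin n → ℝ) => (histOf u z.2, z.1) := fun u =>
    ((measurable_histOf u).comp measurable_snd).prodMk measurable_fst
  have mH : Measurable fun z => H (gain n z) := hHc.measurable.comp (measurable_gain n)
  have ht : ∀ u, Integrable (transfer u) (priceLaw τ n le_rfl u) := fun u =>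
    integrable_finsetSum _ fun j _ => (integrable_priceLaw h n le_rfl u j).const_mul _
  have hgain : ∀ u, Integrable (fun z : ℝ × (Fin n → ℝ) =>
      z.1 * score u - (1 / √(n : ℝ)) * transfer u z.2)
      ((actionLaw μ σ p u).prod (priceLaw τ n le_rfl u)) := fun u =>
    ((hμ.integrable_actionLaw σ p u (g := fun l => l * score u) (by fun_prop)).comp_fst _).sub
      (((ht u).comp_snd (actionLaw μ σ p u)).const_mul _)
  have hint : ∀ u ∈ (Finset.univ : Finset (Fin n → Bool)), Integrable (fun z => H (gain n z))
      (((actionLaw μ σ p u).prod (priceLaw τ n le_rfl u)).map fun z => (histOf u z.2, z.1)) := by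
    intro u _
    refine (integrable_map_measure mH.aestronglyMeasurable (mh u).aemeasurable).mpr ?_
    simpa only [Function.comp_def, gain_histOf] using hH.integrable_comp (hgain u)
  have hout : outcome μ σ τ = ∑ u, ((actionLaw μ σ p u).prod
      (priceLaw τ n le_rfl u)).map fun z => (histOf u z.2, z.1) :=
    outcome_eq_sum μ (hσ.reactsAs τ p)
  have hint' : Integrable (fun z => H (gain n z)) (outcome μ σ τ) := by
    rw [hout]
    exact integrable_finsetSum_measure.mpr hint
  rw [payoff2_pureStrategy hμ hHc, payoff2, expectation_eq_integral hint', EReal.coe_le_coe_iff,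
    hout, integral_finsetSum_measure hint]
  refine Finset.sum_le_sum fun u _ => ?_
  have hi := hH.integrable_comp (hgain u)
  rw [integral_map (mh u).aemeasurable mH.aestronglyMeasurable]
  simp only [gain_histOf]
  rw [integral_prod _ hi]
  refine integral_mono (hμ.integrable_actionLaw σ p u (by fun_prop)) hi.integral_prod_left
    fun l => ?_
  have hf : Integrable (fun x => l * score u - (1 / √(n : ℝ)) * transfer u x)
      (priceLaw τ n le_rfl u) := (integrable_const _).sub ((ht u).const_mul _)
  have hmean : ∫ x, (l * score u - (1 / √(n : ℝ)) * transfer u x) ∂(priceLaw τ n le_rfl u) =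
      l * score u - normTransfer n p u := by
    rw [integral_sub (integrable_const _) ((ht u).const_mul _), integral_const,
      integral_const_mul, probReal_univ, one_smul, normTransfer]
    congr 2
    simp only [transfer]
    rw [integral_finsetSum _ fun j _ => (integrable_priceLaw h n le_rfl u j).const_mul _]
    exact Finset.sum_congr rfl fun j _ => by rw [integral_const_mul, integral_priceLaw]
  -- Jensen's inequality given `L = l` and the actions `u`; the law of the prices along `u` does not
  -- involve `l`.
  have := hH.strictConvex.convexOn.map_integral_le (μ := priceLaw τ n le_rfl u)
    hHc.continuousOn isClosed_univ (Eventually.of_forall fun _ => mem_univ _) hf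
    (hH.integrable_comp hf)
  rw [hmean] at this
  exact this

/-- Equilibria of the reduced game are equilibria of the game. -/
theorem IsReducedEquilibrium.isEquilibrium (hμ : IsFullOnUnit μ) (hH : IsRiskAversion H)
    (hn : 1 ≤ n) {τ : Strategy2 n} (h : IsReducedEquilibrium μ H σ τ) : IsEquilibrium μ H σ τ := by
  have hHc := hH.contDiff.continuous
  have hσ : σ.IsReduced := h.mem1
  obtain ⟨p, rfl⟩ := Strategy2.IsPure.exists_eq h.mem2
  have hbest : ∀ p', payoff2 μ H σ (pureStrategy n p) ≤ payoff2 μ H σ (pureStrategy n p') :=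
    fun p' => h.best2 _ (isPure_pureStrategy n p')
      (expectationExists_of_integrable (integrable_outcome_pureStrategy hμ σ p' hHc).1)
  refine ⟨mem_univ _, mem_univ _, h.integrable1, h.integrable2, fun σ' _ _ => ?_, fun τ' _ hex => ?_⟩
  · obtain ⟨σ'', hσ'', heq⟩ := exists_reduced_actionLaw_eq (μ := μ) σ' p
    have h1 : payoff1 μ σ' (pureStrategy n p) = payoff1 μ σ'' (pureStrategy n p) := by
      rw [payoff1_pureStrategy hμ, payoff1_pureStrategy hμ, heq]
    rw [h1]
    exact h.best1 σ'' hσ'' (expectationExists_of_integrable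
      (integrable_outcome_pureStrategy hμ σ'' p continuous_id).1)
  -- A deviation with infinite positive part has payoff `+∞`, because its expectation exists;
  -- otherwise its prices have means and can be replaced by them.
  · by_cases hfin : ∫⁻ z, ENNReal.ofReal (H (gain n z)) ∂(outcome μ σ τ') = ⊤
    · have h2 : ∫⁻ z, ENNReal.ofReal (-H (gain n z)) ∂(outcome μ σ τ') ≠ ⊤ :=
        hex.resolve_left fun h => h hfin
      have : payoff2 μ H σ τ' = ⊤ := by
        rw [payoff2, expectation, hfin, ← EReal.coe_ennreal_toReal h2, EReal.coe_ennreal_top,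
          EReal.top_sub_coe]
      rw [this]
      exact le_top
    · exact (hbest _).trans (payoff2_meanPrice_le hμ hH hσ
        (lintegral_neg_transfer_ne_top hμ hH hn hσ
          (actionLaw_univ_ne_zero hμ hH hn hσ hbest) hfin))

end

/-! ### Realizing a conditional law of the actions by a strategy -/

section

variable {n : ℕ}

/-- The marginal on the first `q` actions of a conditional law `ω` of the actions given `L`. -/
noncomputable def prefixLaw (ω : (Fin n → Bool) → ℝ → ℝ≥0∞) (q : ℕ) (hq : q ≤ n)
    (v : Fin q → Bool) (l : ℝ) : ℝ≥0∞ :=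
  ∑ u, if (fun i => u (Fin.castLE hq i)) = v then ω u l else 0

variable {ω : (Fin n → Bool) → ℝ → ℝ≥0∞}

theorem prefixLaw_zero (hω : ∀ l, ∑ u, ω u l = 1) (v : Fin 0 → Bool) (l : ℝ) :
    prefixLaw ω 0 (Nat.zero_le n) v l = 1 := by
  rw [← hω l]
  exact Finset.sum_congr rfl fun u _ => if_pos (Subsingleton.elim _ _)

theorem prefixLaw_self (v : Fin n → Bool) (l : ℝ) : prefixLaw ω n le_rfl v l = ω v l := by
  simp [prefixLaw]

theorem prefixLaw_succ (q : ℕ) (hq : q + 1 ≤ n) (v : Fin q → Bool) (l : ℝ) :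
    prefixLaw ω (q + 1) hq (snocTuple v true) l + prefixLaw ω (q + 1) hq (snocTuple v false) l =
      prefixLaw ω q (Nat.le_of_succ_le hq) v l := by
  have key : ∀ (u : Fin n → Bool) b, (fun i => u (Fin.castLE hq i)) = snocTuple v b ↔
      (fun i => u (Fin.castLE (Nat.le_of_succ_le hq) i)) = v ∧
        u (Fin.castLE hq (Fin.last q)) = b := by
    intro u b
    constructor
    · intro h
      refine ⟨funext fun i => ?_, ?_⟩
      · simpa using congrFun h i.castSucc
      · simpa using congrFun h (Fin.last q)
    · rintro ⟨h1, h2⟩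
      funext i
      refine Fin.lastCases ?_ (fun j => ?_) i
      · simpa using h2
      · simpa using congrFun h1 j
  simp only [prefixLaw, key, ← Finset.sum_add_distrib]
  refine Finset.sum_congr rfl fun u _ => ?_
  by_cases h : (fun i => u (Fin.castLE (Nat.le_of_succ_le hq) i)) = v
  · cases hb : u (Fin.castLE hq (Fin.last q)) <;> simp [h]
  · simp [h]

theorem prefixLaw_le (hω : ∀ l, ∑ u, ω u l = 1) (q : ℕ) (hq : q ≤ n) (v : Fin q → Bool) (l : ℝ) :
    prefixLaw ω q hq v l ≤ 1 := by
  rw [← hω l]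
  exact Finset.sum_le_sum fun u _ => by split_ifs <;> simp

theorem measurable_prefixLaw (hm : ∀ u, Measurable (ω u)) (q : ℕ) (hq : q ≤ n)
    (v : Fin q → Bool) : Measurable (prefixLaw ω q hq v) :=
  Finset.measurable_sum _ fun u _ => by split_ifs <;> [exact hm u; exact measurable_const]

/-- The conditional law of the next action. -/
noncomputable def nextLaw (ω : (Fin n → Bool) → ℝ → ℝ≥0∞) (q : ℕ) (hq : q < n)
    (x : (Fin q → Bool) × ℝ) (b : Bool) : ℝ≥0∞ :=
  if prefixLaw ω q hq.le x.1 x.2 = 0 then 2⁻¹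
    else prefixLaw ω (q + 1) hq (snocTuple x.1 b) x.2 / prefixLaw ω q hq.le x.1 x.2

theorem measurable_nextLaw (hm : ∀ u, Measurable (ω u)) (q : ℕ) (hq : q < n) :
    Measurable (Function.uncurry (nextLaw ω q hq)) := by
  refine measurable_from_prod_countable_left fun b => ?_
  refine measurable_from_prod_countable_right fun v => ?_
  refine Measurable.ite (measurable_prefixLaw hm q hq.le v (measurableSet_singleton 0))
    measurable_const ?_
  exact (measurable_prefixLaw hm (q + 1) hq (snocTuple v b)).div (measurable_prefixLaw hm q hq.le v)

/-- Any measurable conditional law of the actions given `L` comes from a strategy that ignores the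
prices. -/
theorem exists_isReduced_weight_eq (hm : ∀ u, Measurable (ω u)) (hω : ∀ l, ∑ u, ω u l = 1) :
    ∃ σ : Strategy1 n, σ.IsReduced ∧ ∀ p u, weight σ p n le_rfl u = ω u := by
  let κ : ∀ q, q < n → Kernel ((Fin q → Bool) × ℝ) Bool := fun q hq =>
    (Kernel.const _ Measure.count).withDensity (nextLaw ω q hq)
  have hκ : ∀ q hq x b, κ q hq x {b} = nextLaw ω q hq x b := by
    intro q hq x b
    simp only [κ]
    rw [Kernel.withDensity_apply' _ (measurable_nextLaw hm q hq)]
    simp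
  have hfin : ∀ q (hq : q ≤ n) v l, prefixLaw ω q hq v l ≠ ⊤ := fun q hq v l =>
    ne_top_of_le_ne_top ENNReal.one_ne_top (prefixLaw_le hω q hq v l)
  have hmk : ∀ q hq, IsMarkovKernel (κ q hq) := by
    refine fun q hq => ⟨fun x => ⟨?_⟩⟩
    have h := lintegral_fintype (μ := κ q hq x) fun _ => 1
    rw [lintegral_one, Fintype.sum_bool, one_mul, one_mul, hκ, hκ] at h
    rw [h]
    simp only [nextLaw]
    split_ifs with h0
    · exact ENNReal.inv_two_add_inv_two
    · rw [← ENNReal.add_div, prefixLaw_succ, ENNReal.div_self h0 (hfin _ _ _ _)]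
  have mm : ∀ q, Measurable fun x : Hist q × ℝ => (x.1.moves, x.2) := fun q =>
    ((Hist.measurable_moves q).comp measurable_fst).prodMk measurable_snd
  let σ : Strategy1 n :=
    { kernel := fun q hq => (κ q hq).comap _ (mm q)
      markov := fun q hq => inferInstance }
  refine ⟨σ, fun q hq => ⟨κ q hq, rfl⟩, fun p u => ?_⟩
  have hw : ∀ q (hq : q ≤ n) u l, weight σ p q hq u l = prefixLaw ω q hq u l := by
    intro q
    induction q with
    | zero => intro hq u l; rw [prefixLaw_zero hω]; rfl
    | succ q ih =>
      intro hq u l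
      obtain ⟨v, b, rfl⟩ : ∃ v b, u = snocTuple v b := ⟨initTuple u, u (Fin.last q), by simp⟩
      have hstep : σ.kernel q hq (histOf v (priceVec p q v), l) {b} = nextLaw ω q hq (v, l) b :=
        hκ q hq (v, l) b
      rw [weight_snoc, ih, hstep, nextLaw]
      split_ifs with h0
      · have h0' : prefixLaw ω q (Nat.le_of_succ_le hq) v l = 0 := h0
        rw [h0', zero_mul]
        rw [← prefixLaw_succ q hq v l, add_eq_zero] at h0'
        cases b
        · exact h0'.2.symm
        · exact h0'.1.symm
      · exact ENNReal.mul_div_cancel h0 (hfin _ _ _ _)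
  funext l
  rw [hw, prefixLaw_self]

end

/-! ### The law of the score -/

theorem lintegral_lamBar (n : ℕ) {f : ℝ → ℝ≥0∞} (hf : Measurable f) :
    ∫⁻ s, f s ∂(lamBar n) = (2 ^ n)⁻¹ * ∑ u : Fin n → Bool, f (score u) := by
  rw [lamBar, lintegral_map hf (measurable_of_finite _), lintegral_fintype, Finset.mul_sum]
  refine Finset.sum_congr rfl fun u _ => ?_
  rw [PMF.toMeasure_apply_singleton _ _ (measurableSet_singleton _), mul_comm]
  simp [score]

theorem integral_lamBar (n : ℕ) {f : ℝ → ℝ} (hf : Measurable f) :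
    ∫ s, f s ∂(lamBar n) = (2 ^ n)⁻¹ * ∑ u : Fin n → Bool, f (score u) := by
  rw [lamBar, integral_map (measurable_of_finite _).aemeasurable hf.aestronglyMeasurable,
    PMF.integral_eq_sum, Finset.mul_sum]
  refine Finset.sum_congr rfl fun u _ => ?_
  simp [score]

/-- The number of action sequences with score `s`. -/
noncomputable def scoreCount (n : ℕ) (s : ℝ) : ℝ≥0∞ :=
  ∑ u : Fin n → Bool, if score u = s then 1 else 0

theorem measurable_ite_score {n : ℕ} (u : Fin n → Bool) :
    Measurable fun s : ℝ => if score u = s then (1 : ℝ≥0∞) else 0 :=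
  Measurable.ite (measurableSet_eq_fun measurable_const measurable_id) measurable_const
    measurable_const

theorem measurable_scoreCount (n : ℕ) : Measurable (scoreCount n) :=
  Finset.measurable_sum _ fun u _ => measurable_ite_score u

theorem scoreCount_score_ne_zero {n : ℕ} (u : Fin n → Bool) : scoreCount n (score u) ≠ 0 := by
  intro h
  have := (Finset.sum_eq_zero_iff.mp h) u (Finset.mem_univ u)
  simp at this

theorem scoreCount_ne_top (n : ℕ) (s : ℝ) : scoreCount n s ≠ ⊤ :=
  ENNReal.sum_ne_top.mpr fun u _ => by split_ifs <;> simp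

/-- The uniform law on the action sequences with score `s`. -/
noncomputable def scoreLaw {n : ℕ} (u : Fin n → Bool) (s : ℝ) : ℝ≥0∞ :=
  (if score u = s then 1 else 0) / scoreCount n s

theorem measurable_scoreLaw {n : ℕ} (u : Fin n → Bool) : Measurable (scoreLaw u) :=
  (measurable_ite_score u).div (measurable_scoreCount n)

theorem sum_scoreLaw {n : ℕ} {s : ℝ} (hs : scoreCount n s ≠ 0) :
    ∑ u : Fin n → Bool, scoreLaw u s = 1 := by
  simp only [scoreLaw, div_eq_mul_inv, ← Finset.sum_mul]
  exact ENNReal.mul_inv_cancel hs (scoreCount_ne_top n s)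

/-- Drawing a score from `lamBar n` and then a uniform sequence with that score gives back the
uniform law on sequences. -/
theorem lintegral_scoreLaw {n : ℕ} (u : Fin n → Bool) :
    ∫⁻ s, scoreLaw u s ∂(lamBar n) = (2 ^ n)⁻¹ := by
  rw [lintegral_lamBar n (measurable_scoreLaw u)]
  have : ∀ v : Fin n → Bool, scoreLaw u (score v) =
      (if score v = score u then 1 else 0) / scoreCount n (score u) := by
    intro v
    by_cases h : score u = score v
    · rw [scoreLaw, if_pos h, if_pos h.symm, h]
    · rw [scoreLaw, if_neg h, if_neg (Ne.symm h), ENNReal.zero_div, ENNReal.zero_div]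
  simp only [this, div_eq_mul_inv, ← Finset.sum_mul]
  rw [show (∑ v : Fin n → Bool, if score v = score u then (1 : ℝ≥0∞) else 0) =
    scoreCount n (score u) from rfl, ENNReal.mul_inv_cancel (scoreCount_score_ne_zero u)
    (scoreCount_ne_top n _), mul_one]

/-! ### Existence of equilibria -/

theorem IsRiskAversion.add_deriv_mul_le {H : ℝ → ℝ} (hH : IsRiskAversion H) (x y : ℝ) :
    H x + deriv H x * (y - x) ≤ H y := by
  have hc := hH.strictConvex.convexOn
  rcases lt_trichotomy x y with h | rfl | h
  · have := hc.deriv_le_slope (mem_univ x) (mem_univ y) h (hH.differentiable x)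
    rw [slope_def_field, le_div_iff₀ (sub_pos.mpr h)] at this
    linarith
  · simp
  · have := hc.slope_le_deriv (mem_univ y) (mem_univ x) h (hH.differentiable x)
    rw [slope_def_field, div_le_iff₀ (sub_pos.mpr h)] at this
    linarith

section

variable {μ : Measure ℝ} [IsProbabilityMeasure μ] {n : ℕ} {H : ℝ → ℝ} {ν : Measure ℝ}
  [IsProbabilityMeasure ν]

/-- When `T ν` is the law of the score, `φ_ν(L)` is almost surely the score of some actions. -/
theorem ae_scoreCount_phi_ne_zero (hμ : IsFullOnUnit μ) (hH : IsRiskAversion H)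
    (hν : opT μ H (lamBar n) ν = lamBar n) : ∀ᵐ l ∂μ, scoreCount n (phi μ ν l) ≠ 0 := by
  obtain ⟨ε, K, hε, hb⟩ := hH.deriv_bounds
  have h1 : ∀ᵐ s ∂(lamBar n), scoreCount n s ≠ 0 := by
    rw [lamBar]
    refine (ae_map_iff (measurable_of_finite _).aemeasurable
      ((measurable_scoreCount n) (measurableSet_singleton 0)).compl).mpr
      (Eventually.of_forall fun u => scoreCount_score_ne_zero u)
  rw [← hν, opT_eq_map hμ hH] at h1
  have h2 := ae_of_ae_map hμ.measurable_phi.aemeasurable h1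
  rw [ae_withDensity_iff (hμ.measurable_normTilt hH _ _)] at h2
  -- The normalized tilt is strictly positive, so reweighting `μ` by it does not change the null
  -- sets.
  filter_upwards [h2] with l hl
  refine hl ?_
  rw [normTilt, Ne, ENNReal.ofReal_eq_zero, not_le]
  exact mul_pos (inv_pos.mpr (hε.trans_le (le_integral_tilt hμ hH fun x => (hb x).1)))
    (hε.trans (hb _).1)

/-- A strategy of player 1 that, given `L`, is uniform on the actions with score `φ_ν(L)`. -/
theorem exists_isReduced_score_eq_phi (hμ : IsFullOnUnit μ) (hH : IsRiskAversion H)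
    (hν : opT μ H (lamBar n) ν = lamBar n) :
    ∃ σ : Strategy1 n, σ.IsReduced ∧ ∀ p u, (∀ᵐ l ∂(actionLaw μ σ p u), score u = phi μ ν l) ∧
      ∫⁻ l, normTilt μ H (lamBar n) ν l ∂(actionLaw μ σ p u) = (2 ^ n)⁻¹ := by
  have hφ : Measurable (phi μ ν) := hμ.measurable_phi
  have hmt := hμ.measurable_normTilt hH (lamBar n) ν
  let ω : (Fin n → Bool) → ℝ → ℝ≥0∞ := fun u l =>
    if scoreCount n (phi μ ν l) = 0 then (2 ^ n)⁻¹ else scoreLaw u (phi μ ν l)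
  have hm : ∀ u, Measurable (ω u) := fun u =>
    Measurable.ite (((measurable_scoreCount n).comp hφ) (measurableSet_singleton 0))
      measurable_const ((measurable_scoreLaw u).comp hφ)
  have hω : ∀ l, ∑ u, ω u l = 1 := by
    intro l
    by_cases h : scoreCount n (phi μ ν l) = 0
    · simp only [ω, if_pos h, Finset.sum_const, nsmul_eq_mul]
      simpa using ENNReal.mul_inv_cancel (a := 2 ^ n) (by simp) (by simp)
    · simp only [ω, if_neg h]
      exact sum_scoreLaw h
  obtain ⟨σ, hσ, hw⟩ := exists_isReduced_weight_eq hm hω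
  have hae := ae_scoreCount_phi_ne_zero hμ hH hν
  refine ⟨σ, hσ, fun p u => ⟨?_, ?_⟩⟩
  · rw [actionLaw, hw, ae_withDensity_iff (hm u)]
    filter_upwards [hae] with l hl h
    simp only [ω, if_neg hl, scoreLaw] at h
    by_contra hne
    rw [if_neg hne, ENNReal.zero_div] at h
    exact h rfl
  · rw [actionLaw, hw, lintegral_withDensity_eq_lintegral_mul _ (hm u) hmt, ← lintegral_scoreLaw u]
    conv_rhs => rw [← hν, opT_eq_map hμ hH]
    rw [lintegral_map (measurable_scoreLaw u) hφ,
      lintegral_withDensity_eq_lintegral_mul _ hmt (by exact (measurable_scoreLaw u).comp hφ)]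
    refine lintegral_congr_ae ?_
    filter_upwards [hae] with l hl
    simp only [Pi.mul_apply, ω, if_neg hl]
    exact mul_comm _ _

theorem exists_isReducedEquilibrium_of_opT_eq (hμ : IsFullOnUnit μ) (hH : IsRiskAversion H)
    (hn : 1 ≤ n) (hν : opT μ H (lamBar n) ν = lamBar n) :
    ∃ (σ : Strategy1 n) (τ : Strategy2 n), IsReducedEquilibrium μ H σ τ := by
  have hHc := hH.contDiff.continuous
  obtain ⟨ε, K, hε, hb⟩ := hH.deriv_bounds
  have hpos : 0 < ∫ x, tilt μ H (lamBar n) ν x ∂μ :=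
    hε.trans_le (le_integral_tilt hμ hH fun x => (hb x).1)
  set c := ∫ x, tilt μ H (lamBar n) ν x ∂μ with hc
  obtain ⟨σ, hσ, hσs⟩ := exists_isReduced_score_eq_phi hμ hH hν
  -- Centering `Γ_ν` by its `lamBar n`-mean is exactly what makes these payments sum to zero over
  -- the cube.
  obtain ⟨p, hp⟩ := exists_normTransfer_eq hn (fun u => Psi μ (lamBar n) ν (score u)) (by
    simp only [Psi, Finset.sum_sub_distrib]
    rw [integral_lamBar n (hμ.measurable_Gam ν)]
    simp)
  refine ⟨σ, pureStrategy n p, hσ, isPure_pureStrategy n p,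
    (integrable_outcome_pureStrategy hμ σ p continuous_id).1,
    (integrable_outcome_pureStrategy hμ σ p hHc).1, fun σ' _ _ => ?_, fun τ' hτ' _ => ?_⟩
  -- No strategy earns more than the mean of this upper envelope, which depends only on the law of
  -- `L`. The candidate attains it because its score `φ_ν(l)` maximizes `l s - Γ_ν(s)`.
  · set M : ℝ → ℝ := fun l =>
      Finset.univ.sup' Finset.univ_nonempty fun u => l * score u - normTransfer n p u with hM
    have hMc : Continuous M :=
      Continuous.finset_sup'_apply Finset.univ_nonempty fun u _ => by fun_prop
    have hMsum : ∀ s : Strategy1 n, ∑ u, ∫ l, M l ∂(actionLaw μ s p u) = ∫ l, M l ∂μ := fun s => by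
      rw [← integral_finsetSum_measure fun u _ => hμ.integrable_actionLaw s p u hMc, sum_actionLaw]
    rw [payoff1_pureStrategy hμ, payoff1_pureStrategy hμ, EReal.coe_le_coe_iff]
    calc ∑ u, ∫ l, (l * score u - normTransfer n p u) ∂(actionLaw μ σ' p u)
        ≤ ∑ u, ∫ l, M l ∂(actionLaw μ σ' p u) := Finset.sum_le_sum fun u _ =>
          integral_mono (hμ.integrable_actionLaw σ' p u (by fun_prop))
            (hμ.integrable_actionLaw σ' p u hMc) fun l =>
            Finset.le_sup' (fun u => l * score u - normTransfer n p u) (Finset.mem_univ u)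
      _ = ∑ u, ∫ l, M l ∂(actionLaw μ σ p u) := (hMsum σ').trans (hMsum σ).symm
      _ ≤ _ := Finset.sum_le_sum fun u _ => ?_
    refine integral_mono_ae (hμ.integrable_actionLaw σ p u hMc)
      (hμ.integrable_actionLaw σ p u (by fun_prop)) ?_
    filter_upwards [(hσs p u).1, hμ.ae_actionLaw σ p u] with l hl hI
    refine Finset.sup'_le _ _ fun v _ => ?_
    have := hμ.mul_sub_Gam_le (ν := ν) hI (score v)
    rw [← hl] at this
    simp only [hp, Psi]
    linarith
  · obtain ⟨p', rfl⟩ := Strategy2.IsPure.exists_eq hτ'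
    rw [payoff2_pureStrategy hμ hHc, payoff2_pureStrategy hμ hHc, hσ.actionLaw_eq p' p,
      EReal.coe_le_coe_iff]
    have hd : Continuous (deriv H) := hH.continuous_deriv
    -- Player 2's first-order condition under the zero-sum constraint, with Lagrange multiplier `c /
    -- 2 ^ n`. It expresses that the actions are uniform under the tilted law.
    have hfoc : ∀ u, ∫ l, deriv H (l * score u - normTransfer n p u) ∂(actionLaw μ σ p u) =
        c * (2 ^ n)⁻¹ := by
      intro u
      have h1 : ∫⁻ l, ENNReal.ofReal (c⁻¹ * deriv H (l * score u - normTransfer n p u))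
          ∂(actionLaw μ σ p u) = (2 ^ n)⁻¹ := by
        rw [← (hσs p u).2]
        refine lintegral_congr_ae ?_
        filter_upwards [(hσs p u).1] with l hl
        rw [normTilt, tilt, ← hl, hp]
      rw [← ofReal_integral_eq_lintegral_ofReal
        ((hμ.integrable_actionLaw σ p u (by fun_prop)).const_mul _)
        (Eventually.of_forall fun l => mul_nonneg (inv_nonneg.mpr hpos.le)
          (hε.trans (hb _).1).le), integral_const_mul] at h1
      have h2 := congrArg ENNReal.toReal h1
      rw [ENNReal.toReal_ofReal (mul_nonneg (inv_nonneg.mpr hpos.le)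
        (integral_nonneg fun l => (hε.trans (hb _).1).le))] at h2
      simp only [ENNReal.toReal_inv, ENNReal.toReal_pow, ENNReal.toReal_ofNat] at h2
      rw [← h2, mul_inv_cancel_left₀ hpos.ne']
    -- The tangent inequality for `H`, integrated. Summed over `u`, the linear terms cancel because
    -- the multiplier is common and both payment systems sum to zero.
    have hle : ∀ u, ∫ l, H (l * score u - normTransfer n p u) ∂(actionLaw μ σ p u) +
        (normTransfer n p u - normTransfer n p' u) * (c * (2 ^ n)⁻¹) ≤
          ∫ l, H (l * score u - normTransfer n p' u) ∂(actionLaw μ σ p u) := by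
      intro u
      rw [← hfoc u, ← integral_const_mul, ← integral_add
        (hμ.integrable_actionLaw σ p u (by fun_prop))
        ((hμ.integrable_actionLaw σ p u (by fun_prop)).const_mul _)]
      refine integral_mono ((hμ.integrable_actionLaw σ p u (by fun_prop)).add
        ((hμ.integrable_actionLaw σ p u (by fun_prop)).const_mul _))
        (hμ.integrable_actionLaw σ p u (by fun_prop)) fun l => ?_
      have := hH.add_deriv_mul_le (l * score u - normTransfer n p u)
        (l * score u - normTransfer n p' u)
      simp only
      linarith
    have hs := Finset.sum_le_sum fun u (_ : u ∈ Finset.univ) => hle u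
    rw [Finset.sum_add_distrib, ← Finset.sum_mul, Finset.sum_sub_distrib, sum_normTransfer,
      sum_normTransfer, sub_zero, zero_mul, add_zero] at hs
    exact hs

/-- The law of the score is finitely supported, hence in the range of the operator; any preimage `ν`
yields an equilibrium. -/
theorem exists_isReducedEquilibrium (hμ : IsFullOnUnit μ) (hH : IsRiskAversion H) (hn : 1 ≤ n) :
    ∃ (σ : Strategy1 n) (τ : Strategy2 n), IsReducedEquilibrium μ H σ τ := by
  obtain ⟨ν, hν⟩ := surjective_of_W2Continuous
    (W2Continuous_opTFinSupp hμ hH (lamBarFinSupp n).inP2)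
    (fun ν => opT_absolutelyContinuous _ _) (lamBarFinSupp n)
  have := ν.2.1
  exact exists_isReducedEquilibrium_of_opT_eq hμ hH hn (congrArg Subtype.val hν)

end

end InsiderGame

theorem mainTheorem3 :
    -- `W2`-continuous self-maps `T` of `Δ_f(ℝ)` with `T ν ≪ ν` are onto
    (∀ T : FinSupp → FinSupp, W2Continuous T → (∀ ν, (T ν).1 ≪ ν.1) → Function.Surjective T) ∧
    ∀ (μ : Measure ℝ) [IsProbabilityMeasure μ] (H : ℝ → ℝ),
      HasPositiveC1Density μ → IsRiskAversion H →
      -- joint `W2`-continuity of `(lam, ν) ↦ T_lam(ν)`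
      (∀ (lam ν : ℕ → Measure ℝ) (lam' ν' : Measure ℝ),
        (∀ k, InP2 (lam k)) → (∀ k, InP2 (ν k)) → InP2 lam' → InP2 ν' →
        Tendsto (fun k => W2 (lam k) lam') atTop (𝓝 0) →
        Tendsto (fun k => W2 (ν k) ν') atTop (𝓝 0) →
        (∀ k, InP2 (opT μ H (lam k) (ν k))) ∧ InP2 (opT μ H lam' ν') ∧
          Tendsto (fun k => W2 (opT μ H (lam k) (ν k)) (opT μ H lam' ν')) atTop (𝓝 0)) ∧
      ∀ n : ℕ, 1 ≤ n →
        -- `T_{lamBar n}` is a `W2`-continuous map of `Δ_f(ℝ)` onto itself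
        (∃ T : FinSupp → FinSupp, (∀ ν, (T ν).1 = opT μ H (lamBar n) ν.1) ∧
          W2Continuous T ∧ (∀ ν, (T ν).1 ≪ ν.1) ∧ Function.Surjective T) ∧
        -- equilibria of the reduced game are equilibria of the original game
        (∀ (σ : Strategy1 n) (τ : Strategy2 n),
          IsReducedEquilibrium μ H σ τ → IsEquilibrium μ H σ τ) ∧
        -- existence of equilibria
        (∃ (σ : Strategy1 n) (τ : Strategy2 n), IsReducedEquilibrium μ H σ τ) ∧
        (∃ (σ : Strategy1 n) (τ : Strategy2 n), IsEquilibrium μ H σ τ) := by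
  refine ⟨fun T hT hac => surjective_of_W2Continuous hT hac, fun μ _ H hμ' hH => ?_⟩
  have hμ := hμ'.isFullOnUnit
  refine ⟨fun lam ν lam' ν' hlam hν hlam' hν' hl h => ?_, fun n hn => ?_⟩
  · refine ⟨fun k => ?_, ?_, tendsto_W2_iff.mpr (tendsto_cost_opT hμ hH hlam hlam' hν hν'
      (tendsto_W2_iff.mp hl) (tendsto_W2_iff.mp h))⟩
    · have := (hν k).1
      exact inP2_opT hμ hH (hν k)
    · have := hν'.1
      exact inP2_opT hμ hH hν'
  · have hcont := W2Continuous_opTFinSupp hμ hH (lamBarFinSupp n).inP2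
    have hac : ∀ ν, (opTFinSupp hμ hH (lamBarFinSupp n).1 ν).1 ≪ ν.1 :=
      fun ν => opT_absolutelyContinuous _ _
    obtain ⟨σ, τ, heq⟩ := exists_isReducedEquilibrium hμ hH hn
    exact ⟨⟨_, fun ν => rfl, hcont, hac, surjective_of_W2Continuous hcont hac⟩,
      fun σ τ h => h.isEquilibrium hμ hH hn, ⟨σ, τ, heq⟩, ⟨σ, τ, heq.isEquilibrium hμ hH hn⟩⟩
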